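/- **Setting.** Let $P\subset\mathbb R^n$ be a lattice Delzant polytope: the convex hull of finitely many lattice points such that at each vertex $p$ exactly $n$ edges meet, along vectors $u_{p,1},\dots,u_{p,n}\in\mathbb Z^n$ that form a basis of $\mathbb Z^n$. Let $M$ be the associated compact toric manifold. It is covered by charts $\mathbb C^n$, one for each vertex $p$, with coordinates $w_j=z^{u_{p,j}}$, where $z=e^{x/2+\sqrt{-1}\,\theta}$ are the coordinates of the open orbit $(\mathbb C^*)^n$; thus $|w_j|^2=e^{\langle u_{p,j},x\rangle}$. Torus-invariant functions on $M$ are regarded as functions of $x\in\mathbb R^n$. A function $\psi$ on $\mathbb R^n$ is called the open-orbit potential of a toric Kähler metric if $\sqrt{-1}\,\partial\bar\partial\psi$ extends to a Kähler metric on $M$ with moment polytope $P$, i.e. if for every vertex $p$ the function $\psi-\langle p,x\rangle$ extends to a smooth strictly plurisubharmonic function on the chart at $p$. *Cauchy data* are functions $\psi_0,\dot\psi_0$ on $\mathbb R^n$ with $\psi_0\in C^\infty(\mathbb R^n)$, $\nabla^2\psi_0>0$, $\overline{\operatorname{Im}\nabla\psi_0}=P$ and $\dot\psi_0\in C^\infty\cap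 L^\infty(\mathbb R^n)$. They are *toric Cauchy data* if, moreover, $\psi_0$ is the open-orbit potential of a toric Kähler metric and $\dot\psi_0$ extends to a smooth function on $M$. For $I=[0,T]$ or $I=[0,\infty)$, an *admissible solution on $I$* of the Cauchy problem for the homogeneous real Monge–Ampère equation $$\mathrm{MA}\,\psi=0,\qquad \psi(0,\cdot)=\psi_0,\qquad \partial_s\psi(0,\cdot)=\dot\psi_0 \tag{1}$$ is a convex function $\psi$ on $I\times\mathbb R^n$ that satisfies the two initial conditions (the derivative being one-sided), such that $\psi(s,\cdot)$ is strictly convex with $\overline{\operatorname{Im}\partial\psi(s,\cdot)}=P$ for every $s\in I$, and such that the image of $\operatorname{int}(I)\times\mathbb R^n$ under the subdifferential mapping $\partial\psi$ is a Lebesgue null set in $\mathbb R^{n+1}$ (Alexandrov weak solution). The *smooth lifespan* $T^\infty_{\rm span}\in[0,\infty]$ of (1) is the supremum of the $T\ge0$ for which there is an admissible solution on $[0,T]$ that is smooth on $[0,T]\times\mathbb R^n$. For toric Cauchy data the *smooth lifespan on $M$* is defined in the same way, requiring that $\psi-\psi_0$ extends to a smooth function on $[0,T]\times M$. The *convex lifespan*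 is $$T^{\rm cvx}_{\rm span}=\sup\{s>0:\ \psi_0^\star-s\,\dot\psi_0\circ(\nabla\psi_0)^{-1}\ \text{is convex on } P\setminus\partial P\}\in[0,\infty],$$ where $\psi_0^\star$ is the Legendre transform and $\sup\emptyset=0$. **Statement.** (i) For all Cauchy data, $T^\infty_{\rm span}=T^{\rm cvx}_{\rm span}$. For all toric Cauchy data the smooth lifespan on $M$ is equal to $T^{\rm cvx}_{\rm span}$ as well. (ii) Fix a toric Kähler metric $\omega$ on $M$ with open-orbit potential $\psi_\omega$. A *smooth toric geodesic ray* is a family $\varphi_s$, $s\ge0$, of torus-invariant functions, smooth on $[0,\infty)\times M$, such that every $\omega_{\varphi_s}=\omega+\sqrt{-1}\,\partial\bar\partial\varphi_s$ is a Kähler metric, and such that the geodesic equation $\ddot\varphi_s=|\partial\dot\varphi_s|^2_{\omega_{\varphi_s}}$ of the Mabuchi metric holds on $[0,\infty)\times M$. The map $\varphi\mapsto\psi_\omega+\varphi$ is a bijection from the set of smooth toric geodesic rays onto the set of all functions on $[0,\infty)\times\mathbb R^n$ that are an admissible solution on $[0,\infty)$ of (1) for some toric Cauchy data $(\psi_0,\dot\psi_0)$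 with $\dot\psi_0\circ(\nabla\psi_0)^{-1}$ concave on $P\setminus\partial P$. For all toric Cauchy data with this concavity property there is exactly one admissible solution of (1) on $[0,\infty)$. -/

import Mathlib

open Set MeasureTheory
open scoped ContDiff ENNReal NNReal

noncomputable section

/-- Euclidean `n`-space; in logarithmic coordinates it is the real slice of the open orbit of a toric
manifold. -/
abbrev RSpace (n : ℕ) : Type := EuclideanSpace ℝ (Fin n)

/-- A lattice vector, seen in Euclidean space. -/
def intVec {n : ℕ} (m : Fin n → ℤ) : RSpace n := WithLp.toLp 2 (fun i => (m i : ℝ))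

/-! ### Delzant lattice polytopes and the charts of their toric manifolds -/

/-- A Delzant lattice polytope in `ℝⁿ`: the convex hull of finitely many lattice points, each of which
is a vertex where exactly `n` edges meet, these edges pointing along a basis of the lattice `ℤⁿ`.
(The cone of `P` at a vertex is the cone spanned by the edges at this vertex. As the edge vectors are
linearly independent, this cone is pointed, so that every member of `vertices` is an extreme point.) -/
structure DelzantPolytope (n : ℕ) where
  /-- The polytope itself. -/
  carrier : Set (RSpace n)
  /-- Its vertices. -/
  vertices : Finset (Fin n → ℤ)
  vertices_nonempty : vertices.Nonempty
  carrier_eq : carrier = convexHull ℝ (intVec '' (vertices : Set (Fin n → ℤ)))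
  /-- `edge p j` is the primitive vector along the `j`-th edge that emanates from the vertex `p`. -/
  edge : (Fin n → ℤ) → Fin n → (Fin n → ℤ)
  span_edge : ∀ p ∈ vertices, Submodule.span ℤ (range (edge p)) = ⊤
  cone_eq : ∀ p ∈ vertices,
    {v : RSpace n | ∃ t : ℝ, 0 ≤ t ∧ ∃ y ∈ carrier, v = t • (y - intVec p)} =
      {v : RSpace n | ∃ a : Fin n → ℝ, (∀ j, 0 ≤ a j) ∧ v = ∑ j, a j • intVec (edge p j)}

/-- The toric manifold `M` of `P` is covered by one copy of `ℂⁿ` for each vertex `p`. If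
`z = exp (x / 2 + i θ)` are the coordinates on the open orbit `(ℂ*)ⁿ`, the chart at `p` has the
coordinates `w j = z ^ (edge p j)`, so that `|w j|² = exp ⟨edge p j, x⟩`. The relation
`OverChart P p w x` says that the point `w` of the chart at `p` lies in the open orbit and has the
logarithmic coordinate `x`. -/
def OverChart {n : ℕ} (P : DelzantPolytope n) (p : Fin n → ℤ) (w : Fin n → ℂ) (x : RSpace n) : Prop :=
  ∀ j, ‖w j‖ ^ 2 = Real.exp (inner ℝ (intVec (P.edge p j)) x)

/-- `h`, seen as a torus-invariant function on the open orbit, extends to a smooth function on the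
whole toric manifold `M` (that is, to every chart; the open orbit is dense, so the extensions are
unique, torus-invariant and agree on overlaps). -/
def IsSmoothToricFunction {n : ℕ} (P : DelzantPolytope n) (h : RSpace n → ℝ) : Prop :=
  ∀ p ∈ P.vertices, ∃ F : (Fin n → ℂ) → ℝ,
    ContDiff ℝ ∞ F ∧ ∀ w x, OverChart P p w x → F w = h x

/-- The time-dependent version: `h` extends to a smooth function on `I × M`. -/
def IsSmoothToricPath {n : ℕ} (P : DelzantPolytope n) (I : Set ℝ) (h : ℝ × RSpace n → ℝ) : Prop :=
  ∀ p ∈ P.vertices, ∃ F : ℝ × (Fin n → ℂ) → ℝ,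
    ContDiffOn ℝ ∞ F (I ×ˢ univ) ∧ ∀ s ∈ I, ∀ w x, OverChart P p w x → F (s, w) = h (s, x)

/-- The real part `Re ∑ F_{j k̄} v_j ū_k` of the Levi form of a function `F` on `ℂⁿ` at `w`. -/
def leviForm {n : ℕ} (F : (Fin n → ℂ) → ℝ) (w v u : Fin n → ℂ) : ℝ :=
  (fderiv ℝ (fderiv ℝ F) w v u
    + fderiv ℝ (fderiv ℝ F) w (Complex.I • v) (Complex.I • u)) / 4

/-- `F` is a local potential of `√-1 ∂∂̄ ψ` in the chart at the vertex `p`: it continues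
`ψ - ⟨p, x⟩`, which differs from `ψ` by a function that is pluriharmonic on the open orbit. -/
def IsLocalPotential {n : ℕ} (P : DelzantPolytope n) (p : Fin n → ℤ) (ψ : RSpace n → ℝ)
    (F : (Fin n → ℂ) → ℝ) : Prop :=
  ∀ w x, OverChart P p w x → F w = ψ x - inner ℝ (intVec p) x

/-- `ψ` is the open-orbit potential of a torus-invariant Kähler metric on the toric manifold `M` of `P`
(in the class, and with the moment polytope, fixed by `P`): the form `√-1 ∂∂̄ ψ` on the open orbit
extends to a smooth positive form in every chart. -/
def IsToricKahlerPotential {n : ℕ} (P : DelzantPolytope n) (ψ : RSpace n → ℝ) : Prop :=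
  ∀ p ∈ P.vertices, ∃ F : (Fin n → ℂ) → ℝ,
    ContDiff ℝ ∞ F ∧ IsLocalPotential P p ψ F ∧ ∀ w v, v ≠ 0 → 0 < leviForm F w v v

/-- The toric part of the space of Kähler metrics in the class of `ω = √-1 ∂∂̄ ψω`: the smooth
torus-invariant functions `φ` on `M` for which `ω + √-1 ∂∂̄ φ` is a Kähler metric. -/
def toricMetrics {n : ℕ} (P : DelzantPolytope n) (ψω : RSpace n → ℝ) : Set (RSpace n → ℝ) :=
  {φ | IsSmoothToricFunction P φ ∧ IsToricKahlerPotential P (fun x => ψω x + φ x)}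

/-- The geodesic equation `φ̈ = |∂φ̇|²` of the Mabuchi metric, written in a chart for a local potential
`G (s, ·)` of the metric `ω_{φ(s)}` (so that `∂ₛ G = φ̇`). Here `v` is the gradient, the solution of
`∑ⱼ G_{j k̄} v_j = ∂_{k̄} φ̇`, and `|∂φ̇|² = ∑ G_{j k̄} v_j v̄_k`. -/
def SolvesGeodesicEq {n : ℕ} (I : Set ℝ) (G : ℝ × (Fin n → ℂ) → ℝ) : Prop :=
  ∀ s ∈ I, ∀ w, ∃ v : Fin n → ℂ,
    (∀ u, leviForm (fun w' => G (s, w')) w v u =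
      fderiv ℝ (fun w' => derivWithin (fun r => G (r, w')) I s) w u / 2) ∧
    derivWithin (fun r => derivWithin (fun r' => G (r', w)) I r) I s =
      leviForm (fun w' => G (s, w')) w v v

/-- A ray, parametrized by `[0, ∞)`, as a function on space-time (only its values at nonnegative times
are ever used). -/
def rayFun {n : ℕ} (γ : ℝ≥0 → RSpace n → ℝ) : ℝ × RSpace n → ℝ := fun q => γ q.1.toNNReal q.2

/-- Smooth geodesic rays in the space of toric metrics: paths in this space, smooth on `[0, ∞) × M`,
that satisfy the geodesic equation on `[0, ∞) × M`. -/
def IsSmoothToricGeodesicRay {n : ℕ} (P : DelzantPolytope n) (ψω : RSpace n → ℝ)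
    (φ : ℝ≥0 → RSpace n → ℝ) : Prop :=
  (∀ s, φ s ∈ toricMetrics P ψω) ∧
  IsSmoothToricPath P (Ici 0) (rayFun φ) ∧
  ∀ p ∈ P.vertices, ∃ G : ℝ × (Fin n → ℂ) → ℝ,
    ContDiffOn ℝ ∞ G (Ici 0 ×ˢ univ) ∧
    (∀ s ∈ Ici (0 : ℝ),
      IsLocalPotential P p (fun x => ψω x + rayFun φ (s, x)) (fun w => G (s, w))) ∧
    SolvesGeodesicEq (Ici 0) G

/-! ### The Cauchy problem for the homogeneous real Monge–Ampère equation -/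

/-- The subdifferential of a function on `ℝⁿ`. -/
def subdiff {n : ℕ} (f : RSpace n → ℝ) (x : RSpace n) : Set (RSpace n) :=
  {y | ∀ z, f x + inner ℝ y (z - x) ≤ f z}

/-- The subdifferential at `(s, x)` of a function on `I × ℝⁿ`. -/
def subdiffOn {n : ℕ} (I : Set ℝ) (ψ : ℝ × RSpace n → ℝ) (s : ℝ) (x : RSpace n) :
    Set (ℝ × RSpace n) :=
  {q | ∀ r ∈ I, ∀ z, ψ (s, x) + (q.1 * (r - s) + inner ℝ q.2 (z - x)) ≤ ψ (r, z)}

/-- Weak solutions of `MA ψ = 0` in the sense of Alexandrov: the image of the subdifferential mapping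
is Lebesgue null. Only interior times count (at an end of the time interval the
subdifferential contains a half-line, for every function). -/
def IsAlexandrovSolution {n : ℕ} (I : Set ℝ) (ψ : ℝ × RSpace n → ℝ) : Prop :=
  volume (⋃ s ∈ interior I, ⋃ x : RSpace n, subdiffOn I ψ s x) = 0

/-- Smooth Cauchy data on `ℝⁿ`. -/
structure IsCauchyData {n : ℕ} (P : Set (RSpace n)) (ψ₀ ψ₁ : RSpace n → ℝ) : Prop where
  smooth : ContDiff ℝ ∞ ψ₀
  hessian_pos : ∀ x v, v ≠ 0 → 0 < fderiv ℝ (fderiv ℝ ψ₀) x v v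
  closure_range : closure (range (gradient ψ₀)) = P
  smooth_deriv : ContDiff ℝ ∞ ψ₁
  bounded_deriv : ∃ C : ℝ, ∀ x, |ψ₁ x| ≤ C

/-- Smooth Cauchy data on the toric manifold: in addition, `ψ₀` comes from a toric Kähler
metric and `ψ₁` from a smooth torus-invariant function on `M`. -/
structure IsToricCauchyData {n : ℕ} (P : DelzantPolytope n) (ψ₀ ψ₁ : RSpace n → ℝ) : Prop
    extends IsCauchyData P.carrier ψ₀ ψ₁ where
  kahler : IsToricKahlerPotential P ψ₀
  smooth_toric : IsSmoothToricFunction P ψ₁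

/-- Admissible solutions on `I × ℝⁿ` of the Cauchy problem `MA ψ = 0`, `ψ (0, ·) = ψ₀`,
`∂ₛ ψ (0, ·) = ψ₁`; the time interval `I` is `[0, T]` or `[0, ∞)`. -/
structure IsAdmissibleSolution {n : ℕ} (P : Set (RSpace n)) (I : Set ℝ) (ψ₀ ψ₁ : RSpace n → ℝ)
    (ψ : ℝ × RSpace n → ℝ) : Prop where
  convex : ConvexOn ℝ (I ×ˢ univ) ψ
  initial : ∀ x, ψ (0, x) = ψ₀ x
  initial_deriv : ∀ x, HasDerivWithinAt (fun s => ψ (s, x)) (ψ₁ x) I 0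
  strictConvex : ∀ s ∈ I, StrictConvexOn ℝ univ (fun x => ψ (s, x))
  closure_image : ∀ s ∈ I, closure (⋃ x, subdiff (fun x' => ψ (s, x')) x) = P
  weak : IsAlexandrovSolution I ψ

/-- The smooth lifespan of the Cauchy problem: the supremum of the `T ≥ 0` for which there is an
admissible solution that is smooth on `[0, T] × ℝⁿ`. -/
def smoothLifespan {n : ℕ} (P : Set (RSpace n)) (ψ₀ ψ₁ : RSpace n → ℝ) : ℝ≥0∞ :=
  sSup {t | ∃ T : ℝ, 0 ≤ T ∧ t = ENNReal.ofReal T ∧ ∃ ψ : ℝ × RSpace n → ℝ,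
    IsAdmissibleSolution P (Icc 0 T) ψ₀ ψ₁ ψ ∧ ContDiffOn ℝ ∞ ψ (Icc 0 T ×ˢ univ)}

/-- The smooth lifespan on the toric manifold: the supremum of the `T ≥ 0` for which there is an
admissible solution `ψ` such that `φ = ψ - ψ₀` is smooth on `[0, T] × M`. -/
def toricSmoothLifespan {n : ℕ} (P : DelzantPolytope n) (ψ₀ ψ₁ : RSpace n → ℝ) : ℝ≥0∞ :=
  sSup {t | ∃ T : ℝ, 0 ≤ T ∧ t = ENNReal.ofReal T ∧ ∃ ψ : ℝ × RSpace n → ℝ,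
    IsAdmissibleSolution P.carrier (Icc 0 T) ψ₀ ψ₁ ψ ∧
    IsSmoothToricPath P (Icc 0 T) (fun q => ψ q - ψ₀ q.2)}

/-- The Legendre transform. For Cauchy data `ψ₀` it is finite on the interior of `P`, the only place
where it is used. -/
def legendre {n : ℕ} (ψ₀ : RSpace n → ℝ) (y : RSpace n) : ℝ :=
  ⨆ x : RSpace n, (inner ℝ x y - ψ₀ x)

/-- The function `ψ₁ ∘ (∇ψ₀)⁻¹`, defined on the range of `∇ψ₀`, which is the interior of `P`. -/
def momentVelocity {n : ℕ} (ψ₀ ψ₁ : RSpace n → ℝ) (y : RSpace n) : ℝ :=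
  ψ₁ (Function.invFun (gradient ψ₀) y)

/-- The convex lifespan. -/
def convexLifespan {n : ℕ} (P : Set (RSpace n)) (ψ₀ ψ₁ : RSpace n → ℝ) : ℝ≥0∞ :=
  sSup {t | ∃ s : ℝ, 0 < s ∧ t = ENNReal.ofReal s ∧
    ConvexOn ℝ (interior P) (fun y => legendre ψ₀ y - s * momentVelocity ψ₀ ψ₁ y)}

end

/-! The Legendre transform in space linearizes the equation. For `y` in the interior of `P` put
`sliceInf ψ y s = inf_x (ψ(s,x) - ⟨y,x⟩)`. Joint convexity of `ψ` makes this convex in `s`. If it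
were not affine on the interior times, its slopes would fill an interval, and by Fubini the
subdifferential image can be that large only over a null set of `y`; continuity in `y` removes the
exceptional set (`IsAdmissibleSolution.affine`). The initial conditions fix intercept and slope, so
the transform is `-(ψ₀⋆ - s u)` with `u = ψ₁ ∘ (∇ψ₀)⁻¹` (`sliceInf_eq_legendre`). Being an infimum
of affine functions of `y`, it is concave. Hence `ψ₀⋆ - s u` is convex at every interior time of an
admissible solution, which bounds both lifespans from above. A slice is recovered from its transform
on the interior of `P`, which gives uniqueness (`eq_of_mem_interior`).

For existence, let `ψ₀⋆ - T u` be convex and `0 ≤ s < T`. The gradient of `ψ₀⋆ - s u` at `∇ψ₀(x)` is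
the characteristic flow `X_s(x) = x - s ∇u(∇ψ₀(x))`. Interpolating between the strict inequalities
at time `0` and the weak ones at time `T` makes `X_s` injective with invertible differential. It is
also proper because `P` and `ψ₁` are bounded, so it is a diffeomorphism of `ℝⁿ`. The supremum of the
affine functions that support the solution along the characteristics is then smooth. Its
differential is constant along characteristics, so its image is that of `(ψ₁, ∇ψ₀)`, a null set
(`isAdmissibleSolution_envelope`).

On a chart of `M` the flow multiplies each `w_j` by a positive factor `exp(-s v_j / 2)`. The
exponents `v_j` extend smoothly across the coordinate hyperplanes: the metric gradient of the
initial speed is smooth, has components `w_j v_j`, and smooth division with a radial quotient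
applies (`exists_toricChart`). The flow is a diffeomorphism of the chart, it transports the initial
Kähler form to the evolved one, and the geodesic equation follows by differentiating along it
(`levi_evolved_pos`, `solvesGeodesicEq_evolved`).

Conversely, the geodesic equation says that the space-time Hessian has a kernel vector transversal
to the time slices, so a geodesic ray is convex with null gradient image, hence an admissible
solution (`isAdmissibleSolution_of_geodesic`). A solution for all times makes `ψ₀⋆ - s u` convex for
every `s > 0`, which forces `u` to be concave; conversely, for concave `u` every time lies before
the convex lifespan. -/

noncomputable section

open Filter Topology

/-! ### Convex analysis -/

/-- The effective domain of the Legendre transform of `f`. -/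
def conjugateDomain {n : ℕ} (f : RSpace n → ℝ) : Set (RSpace n) :=
  {y | ∃ c : ℝ, ∀ x, c ≤ f x - inner ℝ y x}

theorem convex_conjugateDomain {n : ℕ} (f : RSpace n → ℝ) : Convex ℝ (conjugateDomain f) := by
  rintro y ⟨c, hc⟩ z ⟨d, hd⟩ a b ha hb hab
  refine ⟨a * c + b * d, fun x => ?_⟩
  have h1 := mul_le_mul_of_nonneg_left (hc x) ha
  have h2 := mul_le_mul_of_nonneg_left (hd x) hb
  have h3 : f x = a * f x + b * f x := by rw [← add_mul, hab, one_mul]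
  rw [inner_add_left, real_inner_smul_left, real_inner_smul_left]
  linarith

theorem iUnion_subdiff_subset_conjugateDomain {n : ℕ} (f : RSpace n → ℝ) :
    (⋃ x, subdiff f x) ⊆ conjugateDomain f := by
  rintro y hy
  obtain ⟨x, hx⟩ := mem_iUnion.1 hy
  refine ⟨f x - inner ℝ y x, fun z => ?_⟩
  have := hx z
  rw [inner_sub_right] at this
  linarith

theorem mem_subdiff_of_isMin {n : ℕ} {f : RSpace n → ℝ} {x y : RSpace n}
    (h : ∀ z, f x - inner ℝ y x ≤ f z - inner ℝ y z) : y ∈ subdiff f x := by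
  intro z
  have := h z
  rw [inner_sub_right]
  linarith

/-- A quadratic lower support of a convex function is a subgradient. -/
theorem mem_subdiff_of_quadratic {n : ℕ} {f : RSpace n → ℝ} (hf : ConvexOn ℝ univ f)
    {x y : RSpace n} {ε : ℝ}
    (h : ∀ z, f x + inner ℝ y (z - x) - ε * ‖z - x‖ ^ 2 ≤ f z) : y ∈ subdiff f x := by
  intro z
  -- The quadratic bound at `x + t (z - x)` combined with convexity can be divided by `t`; the error
  -- becomes linear in `t` and vanishes in the limit.
  have key : ∀ t : ℝ, 0 < t → t ≤ 1 →
      f x + inner ℝ y (z - x) - t * (ε * ‖z - x‖ ^ 2) ≤ f z := by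
    intro t ht ht1
    have h1 := h (x + t • (z - x))
    have h2 := hf.2 (mem_univ x) (mem_univ z) (sub_nonneg.2 ht1) ht.le (by ring)
    have h3 : (1 - t) • x + t • z = x + t • (z - x) := by module
    rw [h3] at h2
    simp only [add_sub_cancel_left, real_inner_smul_right, norm_smul, Real.norm_eq_abs,
      abs_of_pos ht, smul_eq_mul, mul_pow] at h1 h2
    have : t * (f x + inner ℝ y (z - x) - t * (ε * ‖z - x‖ ^ 2)) ≤ t * f z := by nlinarith
    exact le_of_mul_le_mul_left this ht
  have hlim : Tendsto (fun t : ℝ => f x + inner ℝ y (z - x) - t * (ε * ‖z - x‖ ^ 2)) (𝓝[>] 0)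
      (𝓝 (f x + inner ℝ y (z - x) - 0 * (ε * ‖z - x‖ ^ 2))) := by
    apply tendsto_nhdsWithin_of_tendsto_nhds
    apply Continuous.tendsto
    fun_prop
  rw [zero_mul, sub_zero] at hlim
  refine le_of_tendsto hlim ?_
  filter_upwards [Ioc_mem_nhdsGT (zero_lt_one' ℝ)] with t ht using key t ht.1 ht.2

/-- Penalization: `f - ⟨y,·⟩` is bounded below but need not attain its infimum, whereas adding
`ε‖x‖²` forces a minimizer `x`. Then `y - 2εx` is a subgradient at `x`, and comparison with the
origin gives `ε‖x‖² ≤ M`, so `2ε‖x‖` is small with `ε`. -/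
theorem conjugateDomain_subset_closure {n : ℕ} {f : RSpace n → ℝ} (hf : ConvexOn ℝ univ f) :
    conjugateDomain f ⊆ closure (⋃ x, subdiff f x) := by
  rintro y ⟨c, hc⟩
  have hcont : Continuous f := hf.locallyLipschitz.continuous
  rw [Metric.mem_closure_iff]
  intro δ hδ
  set M : ℝ := f 0 - c with hM
  have hM0 : 0 ≤ M := by have := hc 0; simp at this; linarith
  obtain ⟨ε, hε, hεδ⟩ : ∃ ε : ℝ, 0 < ε ∧ 4 * ε * (M + 1) < δ ^ 2 := by
    refine ⟨δ ^ 2 / (8 * (M + 1)), by positivity, ?_⟩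
    have : 4 * (δ ^ 2 / (8 * (M + 1))) * (M + 1) = δ ^ 2 / 2 := by field_simp; ring
    rw [this]; have := pow_pos hδ 2; linarith
  set k : RSpace n → ℝ := fun x => f x - inner ℝ y x + ε * ‖x‖ ^ 2 with hk
  have hkc : Continuous k := by fun_prop
  obtain ⟨x, hx⟩ : ∃ x, ∀ z, k x ≤ k z := by
    apply hkc.exists_forall_le
    have h1 : Tendsto (fun x : RSpace n => c + ε * ‖x‖ ^ 2) (cocompact _) atTop := by
      apply tendsto_atTop_add_const_left
      apply Tendsto.const_mul_atTop hε
      exact (tendsto_pow_atTop two_ne_zero).comp (tendsto_norm_cocompact_atTop)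
    exact tendsto_atTop_mono (fun z => by have := hc z; simp only [hk]; linarith) h1
  refine ⟨y - (2 * ε) • x, mem_iUnion.2 ⟨x, ?_⟩, ?_⟩
  · apply mem_subdiff_of_quadratic hf (ε := ε)
    intro z
    have h1 := hx z
    simp only [hk] at h1
    have h2 : ‖z‖ ^ 2 = ‖x‖ ^ 2 + 2 * inner ℝ x (z - x) + ‖z - x‖ ^ 2 := by
      rw [← norm_add_sq_real]; simp
    rw [inner_sub_left, real_inner_smul_left]
    rw [h2] at h1
    have h3 : inner ℝ y (z - x) = inner ℝ y z - inner ℝ y x := inner_sub_right _ _ _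
    nlinarith
  · rw [dist_eq_norm]
    simp only [sub_sub_cancel, norm_smul, Real.norm_eq_abs, abs_of_pos (show 0 < 2 * ε by positivity)]
    have h1 := hx 0
    have h2 := hc x
    simp only [hk, inner_zero_right, norm_zero] at h1
    have h3 : ε * ‖x‖ ^ 2 ≤ M := by rw [hM]; nlinarith
    have h4 : (2 * ε * ‖x‖) ^ 2 < δ ^ 2 := by nlinarith
    exact lt_of_pow_lt_pow_left₀ 2 hδ.le h4

/-- A small ball around `y` contains `y ± r e_i`, and the lower bounds for these slopes control
every `|x i|`, hence the norm. -/
theorem coercive_of_mem_interior {n : ℕ} {f : RSpace n → ℝ} {y : RSpace n}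
    (hy : y ∈ interior (conjugateDomain f)) :
    ∃ ε > 0, ∃ c : ℝ, ∀ x, ε * ‖x‖ + c ≤ f x - inner ℝ y x := by
  obtain ⟨r, hr, hball⟩ := Metric.nhds_basis_closedBall.mem_iff.1 (mem_interior_iff_mem_nhds.1 hy)
  have key : ∀ (i : Fin n) (σ : ℝ), |σ| ≤ r → ∃ c : ℝ, ∀ x : RSpace n,
      σ * x i + c ≤ f x - inner ℝ y x := by
    intro i σ hσ
    obtain ⟨c, hc⟩ := hball (show y + EuclideanSpace.single i σ ∈ _ by
      simpa [Metric.mem_closedBall, dist_eq_norm] using hσ)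
    refine ⟨c, fun x => ?_⟩
    have := hc x
    rw [inner_add_left, EuclideanSpace.inner_single_left] at this
    simp at this
    linarith
  obtain ⟨c0, hc0⟩ := interior_subset hy
  choose c1 hc1 using fun i => key i r (by rw [abs_of_pos hr])
  choose c2 hc2 using fun i => key i (-r) (by rw [abs_neg, abs_of_pos hr])
  obtain ⟨c, hc⟩ : ∃ c : ℝ, c ≤ c0 ∧ ∀ i, c ≤ c1 i ∧ c ≤ c2 i := by
    refine ⟨-(|c0| + ∑ i, |c1 i| + ∑ i, |c2 i|), ?_, fun i => ⟨?_, ?_⟩⟩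
    all_goals
      have h1 : 0 ≤ ∑ i, |c1 i| := Finset.sum_nonneg fun i _ => abs_nonneg _
      have h2 : 0 ≤ ∑ i, |c2 i| := Finset.sum_nonneg fun i _ => abs_nonneg _
      have h3 := neg_abs_le c0
      have h4 := abs_nonneg c0
    · linarith
    · have h5 := Finset.single_le_sum (f := fun i => |c1 i|) (fun i _ => abs_nonneg _)
        (Finset.mem_univ i)
      have := neg_abs_le (c1 i)
      linarith
    · have h5 := Finset.single_le_sum (f := fun i => |c2 i|) (fun i _ => abs_nonneg _)
        (Finset.mem_univ i)
      have := neg_abs_le (c2 i)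
      linarith
  have hcoord : ∀ x : RSpace n, ∀ i, r * |x i| + c ≤ f x - inner ℝ y x := by
    intro x i
    rcases abs_cases (x i) with h | h <;> rw [h.1]
    · linarith [hc1 i x, (hc.2 i).1]
    · have := hc2 i x; linarith [(hc.2 i).2]
  refine ⟨r / (n + 1), by positivity, c, fun x => ?_⟩
  have hnorm : ‖x‖ ≤ ∑ i, |x i| := by
    calc ‖x‖ = ‖∑ i, EuclideanSpace.single i (x i)‖ := by
            congr 1
            ext j
            simp
      _ ≤ ∑ i, ‖EuclideanSpace.single i (x i)‖ := norm_sum_le _ _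
      _ = ∑ i, |x i| := by simp
  have hsum : ∑ i : Fin n, (r * |x i|) ≤ n * (f x - inner ℝ y x - c) := by
    have := Finset.sum_le_card_nsmul (Finset.univ : Finset (Fin n)) (fun i => r * |x i|)
      (f x - inner ℝ y x - c) (fun i _ => by linarith [hcoord x i])
    simpa using this
  rw [← Finset.mul_sum] at hsum
  have h1 : r * ‖x‖ ≤ n * (f x - inner ℝ y x - c) :=
    (mul_le_mul_of_nonneg_left hnorm hr.le).trans hsum
  have h0 : 0 ≤ f x - inner ℝ y x - c := by linarith [hc0 x, hc.1]
  have h2 : r / (n + 1) * ‖x‖ ≤ f x - inner ℝ y x - c := by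
    rw [div_mul_eq_mul_div, div_le_iff₀ (by positivity)]
    nlinarith
  linarith

theorem exists_mem_subdiff {n : ℕ} {f : RSpace n → ℝ} (hf : Continuous f) {y : RSpace n}
    (hy : y ∈ interior (conjugateDomain f)) : ∃ x, y ∈ subdiff f x := by
  obtain ⟨ε, hε, c, hc⟩ := coercive_of_mem_interior hy
  have hk : Continuous fun x => f x - inner ℝ y x := by fun_prop
  obtain ⟨x, hx⟩ := hk.exists_forall_le (tendsto_atTop_mono hc
    (tendsto_atTop_add_const_right _ _ ((tendsto_norm_cocompact_atTop).const_mul_atTop hε)))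
  exact ⟨x, mem_subdiff_of_isMin hx⟩

/-- In finite dimension a convex set has nonempty interior exactly when it spans affinely, and the
affine span, being closed, does not notice the closure. -/
theorem interior_closure_eq_of_convex {n : ℕ} {D : Set (RSpace n)} (hD : Convex ℝ D) :
    interior (closure D) ⊆ interior D := by
  rcases (interior (closure D)).eq_empty_or_nonempty with h | h
  · simp [h]
  · rw [hD.interior_closure_eq_interior_of_nonempty_interior]
    rw [hD.interior_nonempty_iff_affineSpan_eq_top]
    have h1 := hD.closure.interior_nonempty_iff_affineSpan_eq_top.1 h
    rw [eq_top_iff, ← h1, affineSpan_le]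
    exact closure_minimal (subset_affineSpan ℝ D) (AffineSubspace.closed_of_finiteDimensional _)

theorem interior_subset_interior_conjugateDomain {n : ℕ} {f : RSpace n → ℝ} {P : Set (RSpace n)}
    (hP : closure (⋃ x, subdiff f x) = P) : interior P ⊆ interior (conjugateDomain f) := by
  refine subset_trans (interior_mono ?_) (interior_closure_eq_of_convex (convex_conjugateDomain f))
  rw [← hP]
  exact closure_mono (iUnion_subdiff_subset_conjugateDomain f)

/-- The set of subgradients itself need not be convex, but it has the same closure as the convex set
`conjugateDomain f`. -/
theorem convex_closure_subdiff {n : ℕ} {f : RSpace n → ℝ} (hf : ConvexOn ℝ univ f) :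
    Convex ℝ (closure (⋃ x, subdiff f x)) := by
  have : closure (⋃ x, subdiff f x) = closure (conjugateDomain f) :=
    (closure_mono (iUnion_subdiff_subset_conjugateDomain f)).antisymm
      (closure_minimal (conjugateDomain_subset_closure hf) isClosed_closure)
  rw [this]
  exact (convex_conjugateDomain f).closure

/-! ### Differentiable convex functions -/

theorem inner_gradient {n : ℕ} (f : RSpace n → ℝ) (x v : RSpace n) :
    inner ℝ (gradient f x) v = fderiv ℝ f x v := by
  simp [gradient]

theorem subdiff_eq_gradient {n : ℕ} {f : RSpace n → ℝ} {x y : RSpace n}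
    (hf : DifferentiableAt ℝ f x) (hy : y ∈ subdiff f x) : y = gradient f x := by
  have hmin : IsLocalMin (fun z => f z - inner ℝ y z) x := by
    refine Filter.Eventually.of_forall fun z => ?_
    have := hy z
    rw [inner_sub_right] at this
    show f x - _ ≤ f z - _
    linarith
  have hd : HasFDerivAt (fun z => f z - inner ℝ y z) (fderiv ℝ f x - innerSL ℝ y) x :=
    hf.hasFDerivAt.sub (innerSL ℝ y).hasFDerivAt
  have h0 := hmin.hasFDerivAt_eq_zero hd
  refine ext_inner_right ℝ fun v => ?_
  have := congrArg (fun L : RSpace n →L[ℝ] ℝ => L v) h0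
  simp at this
  rw [inner_gradient]
  linarith

theorem gradient_mem_subdiff {n : ℕ} {f : RSpace n → ℝ} {x : RSpace n}
    (h : ∀ z, f x + fderiv ℝ f x (z - x) ≤ f z) : gradient f x ∈ subdiff f x := by
  intro z
  rw [inner_gradient]
  exact h z

theorem iUnion_subdiff_eq_range {n : ℕ} {f : RSpace n → ℝ} (hd : Differentiable ℝ f)
    (h : ∀ x z, f x + fderiv ℝ f x (z - x) ≤ f z) : (⋃ x, subdiff f x) = range (gradient f) := by
  ext y
  simp only [mem_iUnion, mem_range]
  constructor
  · rintro ⟨x, hx⟩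
    exact ⟨x, (subdiff_eq_gradient (hd x) hx).symm⟩
  · rintro ⟨x, rfl⟩
    exact ⟨x, gradient_mem_subdiff (h x)⟩

/-- The first order condition for convexity, along a segment. -/
theorem ConvexOn.add_fderiv_le {E : Type*} [NormedAddCommGroup E] [NormedSpace ℝ E] {S : Set E}
    {f : E → ℝ} (hf : ConvexOn ℝ S f) {x z : E} (hx : x ∈ S) (hz : z ∈ S) {L : E →L[ℝ] ℝ}
    (hL : HasFDerivWithinAt f L S x) : f x + L (z - x) ≤ f z := by
  have hseg : ∀ t ∈ Icc (0 : ℝ) 1, x + t • (z - x) ∈ S := fun t ht =>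
    hf.1.add_smul_sub_mem hx hz ht
  have hc : ConvexOn ℝ (Icc (0 : ℝ) 1) (fun t : ℝ => f (x + t • (z - x))) := by
    refine ⟨convex_Icc 0 1, fun t ht r hr a b ha hb hab => ?_⟩
    have := hf.2 (hseg t ht) (hseg r hr) ha hb hab
    convert this using 2
    rw [show a • (x + t • (z - x)) + b • (x + r • (z - x))
      = (a + b) • x + (a * t + b * r) • (z - x) by module, hab, one_smul]
    simp
  have hline : HasDerivWithinAt (fun t : ℝ => x + t • (z - x)) (z - x) (Icc 0 1) 0 := by
    simpa using (((hasDerivAt_id (0 : ℝ)).smul_const (z - x)).const_add x).hasDerivWithinAt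
  have hd : HasDerivWithinAt (fun t : ℝ => f (x + t • (z - x))) (L (z - x)) (Icc 0 1) 0 := by
    refine HasFDerivWithinAt.comp_hasDerivWithinAt (t := S) (0 : ℝ) ?_ hline hseg
    simpa using hL
  have := hc.le_slope_of_hasDerivWithinAt (left_mem_Icc.2 zero_le_one)
    (right_mem_Icc.2 zero_le_one) zero_lt_one hd
  simp [slope_def_field] at this
  rw [map_sub]
  linarith

/-- Any family of supporting affine functions suffices; `L` is not required to be the derivative.
Supporting at the convex combination `m`, the linear terms cancel on averaging. -/
theorem convexOn_of_add_fderiv_le {E : Type*} [NormedAddCommGroup E] [NormedSpace ℝ E]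
    {f : E → ℝ} {L : E → E →L[ℝ] ℝ} (h : ∀ x z, f x + L x (z - x) ≤ f z) :
    ConvexOn ℝ univ f := by
  refine ⟨convex_univ, fun x _ z _ a b ha hb hab => ?_⟩
  set m := a • x + b • z with hm
  have h1 := mul_le_mul_of_nonneg_left (h m x) ha
  have h2 := mul_le_mul_of_nonneg_left (h m z) hb
  have h3 : a * L m (x - m) + b * L m (z - m) = 0 := by
    rw [← smul_eq_mul, ← smul_eq_mul, ← map_smul, ← map_smul, ← map_add]
    have : a • (x - m) + b • (z - m) = m - (a + b) • m := by rw [hm]; module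
    rw [this, hab, one_smul, sub_self, map_zero]
  have h4 : f m = a * f m + b * f m := by rw [← add_mul, hab, one_mul]
  simp only [smul_eq_mul]
  linarith

theorem strictConvexOn_of_add_fderiv_lt {E : Type*} [NormedAddCommGroup E] [NormedSpace ℝ E]
    {f : E → ℝ} {L : E → E →L[ℝ] ℝ} (h : ∀ x z, x ≠ z → f x + L x (z - x) < f z) :
    StrictConvexOn ℝ univ f := by
  refine ⟨convex_univ, fun x _ z _ hxz a b ha hb hab => ?_⟩
  set m := a • x + b • z with hm
  have hmx : m - x = b • (z - x) := by
    rw [hm, show a = 1 - b by linarith]; module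
  have hmz : m - z = a • (x - z) := by
    rw [hm, show b = 1 - a by linarith]; module
  have h1 := mul_lt_mul_of_pos_left (h m x (sub_ne_zero.1 (by
    rw [hmx]; exact smul_ne_zero hb.ne' (sub_ne_zero.2 hxz.symm)))) ha
  have h2 := mul_lt_mul_of_pos_left (h m z (sub_ne_zero.1 (by
    rw [hmz]; exact smul_ne_zero ha.ne' (sub_ne_zero.2 hxz)))) hb
  have h3 : a * L m (x - m) + b * L m (z - m) = 0 := by
    rw [← smul_eq_mul, ← smul_eq_mul, ← map_smul, ← map_smul, ← map_add]
    have : a • (x - m) + b • (z - m) = m - (a + b) • m := by rw [hm]; module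
    rw [this, hab, one_smul, sub_self, map_zero]
  have h4 : f m = a * f m + b * f m := by rw [← add_mul, hab, one_mul]
  simp only [smul_eq_mul]
  linarith

theorem add_fderiv_lt_of_hessian_pos {n : ℕ} {f : RSpace n → ℝ} (hf : ContDiff ℝ ∞ f)
    (hpos : ∀ x v, v ≠ 0 → 0 < fderiv ℝ (fderiv ℝ f) x v v) {x z : RSpace n} (hxz : x ≠ z) :
    f x + fderiv ℝ f x (z - x) < f z := by
  have hd : Differentiable ℝ f := hf.differentiable (by simp)
  have hd2 : Differentiable ℝ (fderiv ℝ f) :=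
    (hf.fderiv_right (m := ∞) (by simp)).differentiable (by simp)
  have hline : ∀ t : ℝ, HasDerivAt (fun t : ℝ => x + t • (z - x)) (z - x) t := fun t => by
    simpa using ((hasDerivAt_id t).smul_const (z - x)).const_add x
  have h1 : ∀ t : ℝ, HasDerivAt (fun t : ℝ => f (x + t • (z - x)))
      (fderiv ℝ f (x + t • (z - x)) (z - x)) t := fun t =>
    (hd _).hasFDerivAt.comp_hasDerivAt t (hline t)
  have h2 : ∀ t : ℝ, HasDerivAt (fun t : ℝ => fderiv ℝ f (x + t • (z - x)) (z - x))
      (fderiv ℝ (fderiv ℝ f) (x + t • (z - x)) (z - x) (z - x)) t := fun t =>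
    (ContinuousLinearMap.apply ℝ ℝ (z - x)).hasFDerivAt.comp_hasDerivAt t
      ((hd2 _).hasFDerivAt.comp_hasDerivAt t (hline t))
  have hsc : StrictConvexOn ℝ univ (fun t : ℝ => f (x + t • (z - x))) := by
    apply strictConvexOn_univ_of_deriv2_pos
    · exact continuous_iff_continuousAt.2 fun t => (h1 t).continuousAt
    · intro t
      have : deriv (fun t : ℝ => f (x + t • (z - x)))
        = fun t : ℝ => fderiv ℝ f (x + t • (z - x)) (z - x) := funext fun t => (h1 t).deriv
      simp only [Function.iterate_succ, Function.iterate_zero, Function.comp, id, this]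
      rw [(h2 t).deriv]
      exact hpos _ _ (sub_ne_zero.2 hxz.symm)
  have := hsc.lt_slope_of_hasDerivAt (mem_univ 0) (mem_univ 1) zero_lt_one (h1 0)
  simp [slope_def_field] at this
  rw [map_sub]
  linarith

/-! ### Positive bilinear forms -/

theorem isInvertible_of_injective {V W : Type*} [NormedAddCommGroup V] [NormedSpace ℝ V]
    [FiniteDimensional ℝ V] [NormedAddCommGroup W] [NormedSpace ℝ W] [FiniteDimensional ℝ W]
    (hdim : Module.finrank ℝ V = Module.finrank ℝ W) {B : V →L[ℝ] W}
    (hB : ∀ v, B v = 0 → v = 0) : B.IsInvertible := by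
  have hinj : Function.Injective (B : V →ₗ[ℝ] W) := (injective_iff_map_eq_zero _).2 hB
  exact ⟨(LinearEquiv.ofInjectiveOfFinrankEq (B : V →ₗ[ℝ] W) hinj hdim).toContinuousLinearEquiv,
    by ext v; rfl⟩

theorem isInvertible_of_posDef {V : Type*} [NormedAddCommGroup V] [NormedSpace ℝ V]
    [FiniteDimensional ℝ V] {B : V →L[ℝ] V →L[ℝ] ℝ} (hB : ∀ v, v ≠ 0 → 0 < B v v) :
    B.IsInvertible := by
  apply isInvertible_of_injective
  · rw [← (LinearMap.toContinuousLinearMap : (V →ₗ[ℝ] ℝ) ≃ₗ[ℝ] (V →L[ℝ] ℝ)).finrank_eq]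
    exact (Subspace.dual_finrank_eq (K := ℝ) (V := V)).symm
  · intro v hv
    by_contra h
    have := hB v h
    rw [hv] at this
    simp at this

theorem contDiff_inverse_apply {X V W : Type*} [NormedAddCommGroup X] [NormedSpace ℝ X]
    [NormedAddCommGroup V] [NormedSpace ℝ V] [FiniteDimensional ℝ V] [NormedAddCommGroup W]
    [NormedSpace ℝ W] {B : X → V →L[ℝ] W} {b : X → W} (hB : ContDiff ℝ ∞ B) (hb : ContDiff ℝ ∞ b)
    (hinv : ∀ x, (B x).IsInvertible) : ContDiff ℝ ∞ (fun x => (B x).inverse (b x)) := by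
  have : CompleteSpace V := FiniteDimensional.complete ℝ V
  refine ContDiff.clm_apply (contDiff_iff_contDiffAt.2 fun x => ?_) hb
  exact (hinv x).contDiffAt_map_inverse.comp x hB.contDiffAt

/-! ### Cauchy data -/

/-- The Euclidean velocity of the characteristic that starts at `x` is the opposite of this vector. -/
def charVelocity {n : ℕ} (ψ₀ ψ₁ : RSpace n → ℝ) (x : RSpace n) : RSpace n :=
  (fderiv ℝ (fderiv ℝ ψ₀) x).inverse (fderiv ℝ ψ₁ x)

namespace IsCauchyData

variable {n : ℕ} {P : Set (RSpace n)} {ψ₀ ψ₁ : RSpace n → ℝ}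

theorem differentiable (hd : IsCauchyData P ψ₀ ψ₁) : Differentiable ℝ ψ₀ :=
  hd.smooth.differentiable (by simp)

theorem contDiff_fderiv (hd : IsCauchyData P ψ₀ ψ₁) : ContDiff ℝ ∞ (fderiv ℝ ψ₀) :=
  hd.smooth.fderiv_right (m := ∞) (by simp)

theorem contDiff_fderiv_fderiv (hd : IsCauchyData P ψ₀ ψ₁) :
    ContDiff ℝ ∞ (fderiv ℝ (fderiv ℝ ψ₀)) :=
  hd.contDiff_fderiv.fderiv_right (m := ∞) (by simp)

theorem hasFDerivAt_fderiv (hd : IsCauchyData P ψ₀ ψ₁) (x : RSpace n) :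
    HasFDerivAt (fderiv ℝ ψ₀) (fderiv ℝ (fderiv ℝ ψ₀) x) x :=
  (hd.contDiff_fderiv.differentiable (by simp) x).hasFDerivAt

theorem hessian_symm (hd : IsCauchyData P ψ₀ ψ₁) (x v w : RSpace n) :
    fderiv ℝ (fderiv ℝ ψ₀) x v w = fderiv ℝ (fderiv ℝ ψ₀) x w v :=
  (hd.smooth.contDiffAt.isSymmSndFDerivAt (by
    simpa using ENat.LEInfty.out)) v w

theorem isInvertible (hd : IsCauchyData P ψ₀ ψ₁) (x : RSpace n) :
    (fderiv ℝ (fderiv ℝ ψ₀) x).IsInvertible :=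
  isInvertible_of_posDef (hd.hessian_pos x)

theorem hessian_charVelocity (hd : IsCauchyData P ψ₀ ψ₁) (x : RSpace n) :
    fderiv ℝ (fderiv ℝ ψ₀) x (charVelocity ψ₀ ψ₁ x) = fderiv ℝ ψ₁ x :=
  (hd.isInvertible x).self_apply_inverse _

theorem contDiff_charVelocity (hd : IsCauchyData P ψ₀ ψ₁) :
    ContDiff ℝ ∞ (charVelocity ψ₀ ψ₁) :=
  contDiff_inverse_apply hd.contDiff_fderiv_fderiv (hd.smooth_deriv.fderiv_right (m := ∞) (by simp))
    hd.isInvertible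

theorem add_fderiv_lt (hd : IsCauchyData P ψ₀ ψ₁) {x z : RSpace n} (h : x ≠ z) :
    ψ₀ x + fderiv ℝ ψ₀ x (z - x) < ψ₀ z :=
  add_fderiv_lt_of_hessian_pos hd.smooth hd.hessian_pos h

theorem add_fderiv_le (hd : IsCauchyData P ψ₀ ψ₁) (x z : RSpace n) :
    ψ₀ x + fderiv ℝ ψ₀ x (z - x) ≤ ψ₀ z := by
  rcases eq_or_ne x z with rfl | h
  · simp
  · exact (hd.add_fderiv_lt h).le

theorem convexOn (hd : IsCauchyData P ψ₀ ψ₁) : ConvexOn ℝ univ ψ₀ :=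
  convexOn_of_add_fderiv_le hd.add_fderiv_le

theorem gradient_injective (hd : IsCauchyData P ψ₀ ψ₁) : Function.Injective (gradient ψ₀) := by
  intro x z hxz
  by_contra hne
  have h1 := hd.add_fderiv_lt hne
  have h2 := hd.add_fderiv_lt (Ne.symm hne)
  have h3 : fderiv ℝ ψ₀ z (x - z) = - fderiv ℝ ψ₀ x (z - x) := by
    rw [← inner_gradient, ← inner_gradient, hxz, ← inner_neg_right, neg_sub]
  linarith

theorem closure_iUnion_subdiff (hd : IsCauchyData P ψ₀ ψ₁) : closure (⋃ x, subdiff ψ₀ x) = P := by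
  rw [iUnion_subdiff_eq_range hd.differentiable hd.add_fderiv_le, hd.closure_range]

theorem convex (hd : IsCauchyData P ψ₀ ψ₁) : Convex ℝ P := by
  rw [← hd.closure_iUnion_subdiff]
  exact convex_closure_subdiff hd.convexOn

/-- The gradient is the differential followed by the Riesz isomorphism, so its derivative `e`
represents the Hessian in the inner product and is invertible. This is what the inverse function
theorem needs. -/
theorem hasStrictFDerivAt_gradient (hd : IsCauchyData P ψ₀ ψ₁) (x : RSpace n) :
    ∃ e : RSpace n ≃L[ℝ] RSpace n, HasStrictFDerivAt (gradient ψ₀) (e : RSpace n →L[ℝ] RSpace n) x ∧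
      ∀ v w, inner ℝ (e v) w = fderiv ℝ (fderiv ℝ ψ₀) x v w := by
  obtain ⟨e, he⟩ := hd.isInvertible x
  have h1 : HasStrictFDerivAt (fderiv ℝ ψ₀) (e : RSpace n →L[ℝ] _) x := by
    rw [he]
    exact hd.contDiff_fderiv.contDiffAt.hasStrictFDerivAt (by simp)
  obtain ⟨j, hj⟩ : (innerSL ℝ : RSpace n →L[ℝ] RSpace n →L[ℝ] ℝ).IsInvertible :=
    isInvertible_of_posDef fun v hv => by
      rw [innerSL_apply_apply]
      exact real_inner_self_pos.2 hv
  have hj' : ∀ L w, inner ℝ (j.symm L) w = L w := fun L w => by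
    rw [← innerSL_apply_apply ℝ, ← hj, ContinuousLinearEquiv.coe_coe, j.apply_symm_apply]
  have hg : gradient ψ₀ = fun x => j.symm (fderiv ℝ ψ₀ x) := by
    funext z
    exact ext_inner_right ℝ fun v => by rw [inner_gradient, hj']
  refine ⟨e.trans j.symm, ?_, fun v w => ?_⟩
  · rw [hg]
    exact (j.symm : _ →L[ℝ] RSpace n).hasStrictFDerivAt.comp x h1
  · rw [← he]
    exact hj' _ _

/-- The range is open by the inverse function theorem, hence inside the interior of its closure.
Conversely, slopes interior to `P` are interior to the conjugate domain, where coercivity makes the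
Legendre supremum attained. -/
theorem range_gradient (hd : IsCauchyData P ψ₀ ψ₁) : range (gradient ψ₀) = interior P := by
  apply Subset.antisymm
  · apply interior_maximal
    · rw [← hd.closure_range]
      exact subset_closure
    · rw [isOpen_iff_mem_nhds]
      rintro _ ⟨x, rfl⟩
      obtain ⟨e, he, -⟩ := hd.hasStrictFDerivAt_gradient x
      rw [← he.map_nhds_eq_of_equiv]
      exact range_mem_map
  · intro y hy
    obtain ⟨x, hx⟩ := exists_mem_subdiff hd.differentiable.continuous
      (interior_subset_interior_conjugateDomain hd.closure_iUnion_subdiff hy)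
    exact ⟨x, (subdiff_eq_gradient (hd.differentiable x) hx).symm⟩

theorem gradient_mem (hd : IsCauchyData P ψ₀ ψ₁) (x : RSpace n) : gradient ψ₀ x ∈ interior P :=
  hd.range_gradient ▸ mem_range_self x

theorem invFun_gradient (hd : IsCauchyData P ψ₀ ψ₁) (x : RSpace n) :
    Function.invFun (gradient ψ₀) (gradient ψ₀ x) = x :=
  Function.leftInverse_invFun hd.gradient_injective x

theorem momentVelocity_gradient (hd : IsCauchyData P ψ₀ ψ₁) (x : RSpace n) :
    momentVelocity ψ₀ ψ₁ (gradient ψ₀ x) = ψ₁ x := by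
  rw [momentVelocity, hd.invFun_gradient]

theorem legendre_gradient (hd : IsCauchyData P ψ₀ ψ₁) (x : RSpace n) :
    legendre ψ₀ (gradient ψ₀ x) = fderiv ℝ ψ₀ x x - ψ₀ x := by
  have hle : ∀ z, inner ℝ z (gradient ψ₀ x) - ψ₀ z ≤ fderiv ℝ ψ₀ x x - ψ₀ x := by
    intro z
    have := hd.add_fderiv_le x z
    rw [real_inner_comm, inner_gradient]
    rw [map_sub] at this
    linarith
  apply le_antisymm (ciSup_le hle)
  refine le_trans (le_of_eq ?_) (le_ciSup ⟨_, forall_mem_range.2 hle⟩ x)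
  rw [real_inner_comm, inner_gradient]

theorem hasFDerivAt_invFun (hd : IsCauchyData P ψ₀ ψ₁) (x : RSpace n) :
    ∃ e : RSpace n →L[ℝ] RSpace n, HasFDerivAt (Function.invFun (gradient ψ₀)) e (gradient ψ₀ x) ∧
      ∀ v w, fderiv ℝ (fderiv ℝ ψ₀) x (e v) w = inner ℝ v w := by
  obtain ⟨e, he, he'⟩ := hd.hasStrictFDerivAt_gradient x
  refine ⟨e.symm, (he.to_local_left_inverse (Eventually.of_forall hd.invFun_gradient)).hasFDerivAt,
    fun v w => ?_⟩
  rw [← he']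
  simp

/-- By the chain rule the gradient is the inverse Hessian applied to `∇ψ₁`. Together with
`hasFDerivAt_legendre`, this identifies the gradient of `ψ₀⋆ - s u` at `∇ψ₀(x)` with the
characteristic `charFlow ψ₀ ψ₁ (s, x)`. -/
theorem hasFDerivAt_momentVelocity (hd : IsCauchyData P ψ₀ ψ₁) (x : RSpace n) :
    HasFDerivAt (momentVelocity ψ₀ ψ₁) (innerSL ℝ (charVelocity ψ₀ ψ₁ x)) (gradient ψ₀ x) := by
  obtain ⟨e, he, he'⟩ := hd.hasFDerivAt_invFun x
  have h1 : HasFDerivAt ψ₁ (fderiv ℝ ψ₁ x) (Function.invFun (gradient ψ₀) (gradient ψ₀ x)) := by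
    rw [hd.invFun_gradient]
    exact (hd.smooth_deriv.differentiable (by simp) x).hasFDerivAt
  refine (h1.comp _ he).congr_fderiv (ContinuousLinearMap.ext fun v => ?_)
  rw [ContinuousLinearMap.comp_apply, ← hd.hessian_charVelocity, hd.hessian_symm, he', innerSL_apply_apply,
    real_inner_comm]

/-- Near `∇ψ₀(x)` the supremum is attained at `(∇ψ₀)⁻¹(y)`; when the resulting formula is
differentiated, the two terms containing the derivative of `(∇ψ₀)⁻¹` cancel. -/
theorem hasFDerivAt_legendre (hd : IsCauchyData P ψ₀ ψ₁) (x : RSpace n) :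
    HasFDerivAt (legendre ψ₀) (innerSL ℝ x) (gradient ψ₀ x) := by
  obtain ⟨e, he, he'⟩ := hd.hasFDerivAt_invFun x
  have h1 : HasFDerivAt ψ₀ (fderiv ℝ ψ₀ x) (Function.invFun (gradient ψ₀) (gradient ψ₀ x)) := by
    rw [hd.invFun_gradient]
    exact (hd.differentiable x).hasFDerivAt
  have h2 := (he.inner ℝ (hasFDerivAt_id (gradient ψ₀ x))).sub (h1.comp _ he)
  have h3 : legendre ψ₀ =ᶠ[𝓝 (gradient ψ₀ x)] fun y =>
      inner ℝ (Function.invFun (gradient ψ₀) y) y - ψ₀ (Function.invFun (gradient ψ₀) y) := by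
    filter_upwards [isOpen_interior.mem_nhds (hd.gradient_mem x)] with y hy
    rw [← hd.range_gradient] at hy
    obtain ⟨z, rfl⟩ := hy
    rw [hd.legendre_gradient, hd.invFun_gradient, real_inner_comm, inner_gradient]
  refine HasFDerivAt.congr_of_eventuallyEq ?_ h3
  refine h2.congr_fderiv (ContinuousLinearMap.ext fun v => ?_)
  simp [hd.invFun_gradient]

end IsCauchyData

/-! ### Weak solutions are affine in time after the Legendre transform -/

/-- Minus the Legendre transform in the space variable. -/
def sliceInf {n : ℕ} (ψ : ℝ × RSpace n → ℝ) (y : RSpace n) (s : ℝ) : ℝ :=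
  ⨅ x, (ψ (s, x) - inner ℝ y x)

theorem sliceInf_eq {n : ℕ} {ψ : ℝ × RSpace n → ℝ} {x y : RSpace n} {s : ℝ}
    (h : y ∈ subdiff (fun z => ψ (s, z)) x) : sliceInf ψ y s = ψ (s, x) - inner ℝ y x := by
  have hle : ∀ z, ψ (s, x) - inner ℝ y x ≤ ψ (s, z) - inner ℝ y z := by
    intro z
    have := h z
    rw [inner_sub_right] at this
    linarith
  exact le_antisymm (ciInf_le ⟨_, forall_mem_range.2 hle⟩ x) (le_ciInf hle)

theorem sliceInf_le {n : ℕ} {ψ : ℝ × RSpace n → ℝ} {x y : RSpace n} {s : ℝ}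
    (h : y ∈ subdiff (fun z => ψ (s, z)) x) (z : RSpace n) :
    sliceInf ψ y s ≤ ψ (s, z) - inner ℝ y z := by
  rw [sliceInf_eq h]
  have := h z
  rw [inner_sub_right] at this
  linarith

/-- The slopes of the supporting lines of a convex function of one variable that is not affine
contain an interval. -/
theorem exists_Ioo_subset_slopes {I : Set ℝ} {h : ℝ → ℝ} (hh : ConvexOn ℝ I h) {s₁ s₂ s₃ : ℝ}
    (h1 : s₁ ∈ interior I) (h3 : s₃ ∈ interior I) (h12 : s₁ < s₂) (h23 : s₂ < s₃)
    (hne : (s₃ - s₁) * h s₂ ≠ (s₃ - s₂) * h s₁ + (s₂ - s₁) * h s₃) :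
    ∃ a b : ℝ, a < b ∧ ∀ τ ∈ Ioo a b, ∃ s ∈ interior I, ∀ r ∈ I, h s + τ * (r - s) ≤ h r := by
  have hIint : Convex ℝ (interior I) := hh.1.interior
  have hsub : Icc s₁ s₃ ⊆ interior I := hIint.ordConnected.out h1 h3
  have hlt : (s₃ - s₁) * h s₂ < (s₃ - s₂) * h s₁ + (s₂ - s₁) * h s₃ := by
    refine lt_of_le_of_ne ?_ hne
    have h0 : 0 < s₃ - s₁ := by linarith
    have := hh.2 (interior_subset h1) (interior_subset h3)
      (show 0 ≤ (s₃ - s₂) / (s₃ - s₁) from div_nonneg (by linarith) h0.le)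
      (show 0 ≤ (s₂ - s₁) / (s₃ - s₁) from div_nonneg (by linarith) h0.le)
      (by field_simp; ring)
    have he : ((s₃ - s₂) / (s₃ - s₁)) • s₁ + ((s₂ - s₁) / (s₃ - s₁)) • s₃ = s₂ := by
      simp only [smul_eq_mul]; field_simp; ring
    rw [he] at this
    simp only [smul_eq_mul] at this
    calc (s₃ - s₁) * h s₂ ≤ (s₃ - s₁) * ((s₃ - s₂) / (s₃ - s₁) * h s₁
          + (s₂ - s₁) / (s₃ - s₁) * h s₃) := mul_le_mul_of_nonneg_left this h0.le
      _ = _ := by field_simp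
  refine ⟨(h s₂ - h s₁) / (s₂ - s₁), (h s₃ - h s₂) / (s₃ - s₂), ?_, ?_⟩
  · rw [div_lt_div_iff₀ (by linarith) (by linarith)]
    nlinarith
  · rintro τ ⟨hτ1, hτ2⟩
    rw [div_lt_iff₀ (by linarith)] at hτ1
    rw [lt_div_iff₀ (by linarith)] at hτ2
    set k : ℝ → ℝ := fun s => h s - τ * s with hk
    have hkc : ConvexOn ℝ I k := by
      refine hh.sub ⟨hh.1, fun x _ z _ a b _ _ _ => ?_⟩
      simp only [smul_eq_mul]
      exact le_of_eq (by ring)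
    have hcont : ContinuousOn k (Icc s₁ s₃) := hkc.continuousOn_interior.mono hsub
    -- Since `τ` lies strictly between the two chord slopes, `k` is smaller at `s₂` than at `s₁` and
    -- `s₃`. Its minimum on the segment is therefore at an inner point, and by convexity it is a
    -- minimum on all of `I`.
    obtain ⟨s, hs, hmin⟩ := isCompact_Icc.exists_isMinOn ⟨s₂, h12.le, h23.le⟩ hcont
    have hs2 := hmin (show s₂ ∈ Icc s₁ s₃ from ⟨h12.le, h23.le⟩)
    simp only [mem_ofPred_eq, hk] at hs2
    have hsne1 : s ≠ s₁ := by rintro rfl; nlinarith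
    have hsne3 : s ≠ s₃ := by rintro rfl; nlinarith
    have hloc : IsLocalMinOn k I s := by
      apply IsLocalMin.on
      exact hmin.isLocalMin (Icc_mem_nhds (lt_of_le_of_ne hs.1 hsne1.symm)
        (lt_of_le_of_ne hs.2 hsne3))
    have hglob := IsMinOn.of_isLocalMinOn_of_convexOn (interior_subset (hsub hs)) hloc hkc
    refine ⟨s, hsub hs, fun r hr => ?_⟩
    have := hglob hr
    simp only [mem_ofPred_eq, hk] at this
    linarith

/-- Near a nondegenerate minimum, a small bounded perturbation moves the minimal value to first order
by its value at the minimum. -/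
theorem eventually_le_perturbed_min {E : Type*} [NormedAddCommGroup E] [NormedSpace ℝ E]
    [ProperSpace E] {k q : E → ℝ} (hk : ConvexOn ℝ univ k) (hkc : Continuous k) {x₀ : E}
    (h0 : k x₀ = 0) (hpos : ∀ x, x ≠ x₀ → 0 < k x) (hq : Continuous q) {C : ℝ}
    (hC : ∀ x, |q x| ≤ C) {ε : ℝ} (hε : 0 < ε) :
    ∀ᶠ r in 𝓝[>] (0 : ℝ), ∀ x, r * (q x₀ - ε) ≤ k x + r * q x := by
  obtain ⟨ρ, hρ, hball⟩ := Metric.continuousAt_iff.1 hq.continuousAt ε hε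
  obtain ⟨m, hm, hsph⟩ : ∃ m > 0, ∀ x ∈ Metric.sphere x₀ (ρ / 2), m ≤ k x := by
    rcases (Metric.sphere x₀ (ρ / 2)).eq_empty_or_nonempty with he | hne
    · exact ⟨1, one_pos, by simp [he]⟩
    · obtain ⟨x, hx, hmin⟩ := (isCompact_sphere x₀ (ρ / 2)).exists_isMinOn hne hkc.continuousOn
      refine ⟨k x, hpos x ?_, fun z hz => hmin hz⟩
      rintro rfl
      simp at hx
      linarith
  -- Convexity along the ray from `x₀`, where `k` vanishes, propagates the bound on the sphere
  -- outward.
  have hout : ∀ x, ρ / 2 ≤ ‖x - x₀‖ → m ≤ k x := by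
    intro x hx
    have hnx : 0 < ‖x - x₀‖ := by linarith
    set t : ℝ := (ρ / 2) / ‖x - x₀‖ with ht
    have ht0 : 0 < t := by positivity
    have ht1 : t ≤ 1 := by rw [ht, div_le_one hnx]; exact hx
    have h1 := hk.2 (mem_univ x₀) (mem_univ x) (sub_nonneg.2 ht1) ht0.le (by ring)
    have h2 := hsph ((1 - t) • x₀ + t • x) (by
      rw [mem_sphere_iff_norm, show (1 - t) • x₀ + t • x - x₀ = t • (x - x₀) by module, norm_smul,
        Real.norm_eq_abs, abs_of_pos ht0, ht]
      field_simp)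
    rw [h0, smul_zero, zero_add, smul_eq_mul] at h1
    nlinarith
  have hC0 : 0 ≤ C := (abs_nonneg _).trans (hC x₀)
  -- For such `r` the barrier `m` exceeds `2 C r`, the largest possible change of `r q`; inside the
  -- ball continuity of `q` is used instead.
  have hsmall : Ioo 0 (m / (2 * C + 1)) ∈ 𝓝[>] (0 : ℝ) := Ioo_mem_nhdsGT (by positivity)
  filter_upwards [hsmall] with r hr x
  have hr' : r * (2 * C + 1) < m := (lt_div_iff₀ (by positivity)).1 hr.2
  have hx0 := abs_le.1 (hC x₀)
  have hx1 := abs_le.1 (hC x)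
  have hr0 := hr.1
  rcases lt_or_ge ‖x - x₀‖ (ρ / 2) with h | h
  · have h1 := hball (show dist x x₀ < ρ by rw [dist_eq_norm]; linarith)
    rw [Real.dist_eq] at h1
    have h2 := (abs_lt.1 h1).1
    have h3 : 0 ≤ k x := by
      rcases eq_or_ne x x₀ with rfl | hne
      · rw [h0]
      · exact (hpos x hne).le
    nlinarith
  · have := hout x h
    nlinarith

namespace IsAdmissibleSolution

variable {n : ℕ} {P : Set (RSpace n)} {I : Set ℝ} {ψ₀ ψ₁ : RSpace n → ℝ} {ψ : ℝ × RSpace n → ℝ}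

theorem continuous_slice (hψ : IsAdmissibleSolution P I ψ₀ ψ₁ ψ) {s : ℝ} (hs : s ∈ I) :
    Continuous fun x => ψ (s, x) :=
  (hψ.strictConvex s hs).convexOn.locallyLipschitz.continuous

theorem exists_mem_subdiff (hψ : IsAdmissibleSolution P I ψ₀ ψ₁ ψ) {s : ℝ} (hs : s ∈ I)
    {y : RSpace n} (hy : y ∈ interior P) : ∃ x, y ∈ subdiff (fun z => ψ (s, z)) x :=
  _root_.exists_mem_subdiff (hψ.continuous_slice hs)
    (interior_subset_interior_conjugateDomain (hψ.closure_image s hs) hy)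

/-- Partial minimization of a jointly convex function is convex. The infima are attained because `y`
is interior to `P`. -/
theorem convexOn_sliceInf (hψ : IsAdmissibleSolution P I ψ₀ ψ₁ ψ) (hI : Convex ℝ I)
    {y : RSpace n} (hy : y ∈ interior P) : ConvexOn ℝ I (sliceInf ψ y) := by
  refine ⟨hI, fun s hs r hr a b ha hb hab => ?_⟩
  obtain ⟨x, hx⟩ := hψ.exists_mem_subdiff hs hy
  obtain ⟨z, hz⟩ := hψ.exists_mem_subdiff hr hy
  obtain ⟨w, hw⟩ := hψ.exists_mem_subdiff (hI hs hr ha hb hab) hy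
  rw [sliceInf_eq hx, sliceInf_eq hz]
  refine (sliceInf_le hw (a • x + b • z)).trans ?_
  have h1 := hψ.convex.2 (show (s, x) ∈ I ×ˢ univ from ⟨hs, mem_univ _⟩)
    (show (r, z) ∈ I ×ˢ univ from ⟨hr, mem_univ _⟩) ha hb hab
  simp only [Prod.smul_mk, Prod.mk_add_mk] at h1
  rw [inner_add_right, real_inner_smul_right, real_inner_smul_right]
  simp only [smul_eq_mul] at h1 ⊢
  linarith

theorem concaveOn_sliceInf (hψ : IsAdmissibleSolution P I ψ₀ ψ₁ ψ) (hP : Convex ℝ P) {s : ℝ}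
    (hs : s ∈ I) : ConcaveOn ℝ (interior P) (fun y => sliceInf ψ y s) := by
  refine ⟨hP.interior, fun y hy z hz a b ha hb hab => ?_⟩
  obtain ⟨w, hw⟩ := hψ.exists_mem_subdiff hs (hP.interior hy hz ha hb hab)
  obtain ⟨u, hu⟩ := hψ.exists_mem_subdiff hs hy
  obtain ⟨v, hv⟩ := hψ.exists_mem_subdiff hs hz
  simp only [smul_eq_mul]
  rw [sliceInf_eq hw, inner_add_left, real_inner_smul_left, real_inner_smul_left]
  have h1 := mul_le_mul_of_nonneg_left (sliceInf_le hu w) ha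
  have h2 := mul_le_mul_of_nonneg_left (sliceInf_le hv w) hb
  have h3 : ψ (s, w) = a * ψ (s, w) + b * ψ (s, w) := by rw [← add_mul, hab, one_mul]
  linarith

/-- A supporting slope of `sliceInf ψ y` at time `s`, paired with `y`, supports `ψ` itself at the
point where the infimum at time `s` is attained. -/
theorem mem_subdiffOn_of_slope (hψ : IsAdmissibleSolution P I ψ₀ ψ₁ ψ) {y : RSpace n}
    (hy : y ∈ interior P) {s τ : ℝ} (hs : s ∈ interior I)
    (hτ : ∀ r ∈ I, sliceInf ψ y s + τ * (r - s) ≤ sliceInf ψ y r) :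
    (τ, y) ∈ ⋃ s ∈ interior I, ⋃ x : RSpace n, subdiffOn I ψ s x := by
  obtain ⟨x, hx⟩ := hψ.exists_mem_subdiff (interior_subset hs) hy
  simp only [mem_iUnion]
  refine ⟨s, hs, x, fun r hr z => ?_⟩
  obtain ⟨w, hw⟩ := hψ.exists_mem_subdiff hr hy
  have h1 := hτ r hr
  have h2 := sliceInf_le hw z
  rw [sliceInf_eq hx] at h1
  simp only [inner_sub_right]
  linarith

/-- Fubini with the `y` variable outside: for almost every `y` the set of `τ` with `(τ, y)` in the
subdifferential image is null. Failure of affinity would put an interval of slopes into it. -/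
theorem ae_affine (hψ : IsAdmissibleSolution P I ψ₀ ψ₁ ψ) (hI : Convex ℝ I) :
    ∀ᵐ y : RSpace n, y ∈ interior P → ∀ s₁ ∈ interior I, ∀ s₃ ∈ interior I, ∀ s₂, s₁ < s₂ → s₂ < s₃ →
      (s₃ - s₁) * sliceInf ψ y s₂ = (s₃ - s₂) * sliceInf ψ y s₁ + (s₂ - s₁) * sliceInf ψ y s₃ := by
  have hnull := hψ.weak
  unfold IsAlexandrovSolution at hnull
  rw [Measure.volume_eq_prod] at hnull
  have hswap := (Measure.measurePreserving_swap (μ := (volume : Measure (RSpace n)))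
    (ν := (volume : Measure ℝ))).quasiMeasurePreserving.preimage_null hnull
  filter_upwards [Measure.measure_ae_null_of_prod_null hswap] with y hy hyP s₁ h1 s₃ h3 s₂ h12 h23
  by_contra hne
  obtain ⟨a, b, hab, hτ⟩ := exists_Ioo_subset_slopes (hψ.convexOn_sliceInf hI hyP) h1 h3 h12 h23 hne
  have hsub : Ioo a b ⊆ Prod.mk y ⁻¹' (Prod.swap ⁻¹'
      (⋃ s ∈ interior I, ⋃ x : RSpace n, subdiffOn I ψ s x)) := by
    intro τ hτ'
    obtain ⟨s, hs, hs'⟩ := hτ τ hτ'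
    exact hψ.mem_subdiffOn_of_slope hyP hs hs'
  have h0 := measure_mono_null hsub hy
  rw [Real.volume_Ioo, ENNReal.ofReal_eq_zero] at h0
  linarith

/-- Each `sliceInf ψ · s` is concave, hence continuous, on the interior of `P`. The set where the
identity fails is thus open as well as null, and so empty. -/
theorem affine (hψ : IsAdmissibleSolution P I ψ₀ ψ₁ ψ) (hI : Convex ℝ I) (hP : Convex ℝ P)
    {y : RSpace n} (hy : y ∈ interior P) {s₁ s₂ s₃ : ℝ} (h1 : s₁ ∈ interior I) (h3 : s₃ ∈ interior I)
    (h12 : s₁ < s₂) (h23 : s₂ < s₃) :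
    (s₃ - s₁) * sliceInf ψ y s₂ = (s₃ - s₂) * sliceInf ψ y s₁ + (s₂ - s₁) * sliceInf ψ y s₃ := by
  have h2 : s₂ ∈ interior I := hI.interior.ordConnected.out h1 h3 ⟨h12.le, h23.le⟩
  have hc : ∀ s ∈ interior I, ContinuousOn (fun y => sliceInf ψ y s) (interior P) := fun s hs =>
    (hψ.concaveOn_sliceInf hP (interior_subset hs)).continuousOn isOpen_interior
  set d : RSpace n → ℝ := fun y => (s₃ - s₁) * sliceInf ψ y s₂ -
    ((s₃ - s₂) * sliceInf ψ y s₁ + (s₂ - s₁) * sliceInf ψ y s₃) with hd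
  have hdc : ContinuousOn d (interior P) :=
    (continuousOn_const.mul (hc s₂ h2)).sub
      ((continuousOn_const.mul (hc s₁ h1)).add (continuousOn_const.mul (hc s₃ h3)))
  have hopen : IsOpen (interior P ∩ d ⁻¹' {0}ᶜ) :=
    hdc.isOpen_inter_preimage isOpen_interior isOpen_compl_singleton
  have hzero : volume (interior P ∩ d ⁻¹' {0}ᶜ) = 0 := by
    refine measure_mono_null ?_ (ae_iff.1 (hψ.ae_affine hI))
    rintro z ⟨hz, hz'⟩ hall
    exact hz' (sub_eq_zero.2 (hall hz s₁ h1 s₃ h3 s₂ h12 h23))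
  have hempty := hopen.measure_eq_zero_iff volume |>.1 hzero
  by_contra hne
  have : y ∈ interior P ∩ d ⁻¹' {0}ᶜ := ⟨hy, fun h => hne (sub_eq_zero.1 h)⟩
  rw [hempty] at this
  exact this

theorem sliceInf_eq_affine (hψ : IsAdmissibleSolution P I ψ₀ ψ₁ ψ) (hd : IsCauchyData P ψ₀ ψ₁)
    (hI : Convex ℝ I) (h0 : 0 ∈ I) (hIpos : I ⊆ Ici 0) (x₀ : RSpace n) {s : ℝ}
    (hs : s ∈ interior I) :
    sliceInf ψ (gradient ψ₀ x₀) s = ψ₀ x₀ - fderiv ℝ ψ₀ x₀ x₀ + s * ψ₁ x₀ := by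
  set y := gradient ψ₀ x₀ with hy
  have hyP : y ∈ interior P := hd.gradient_mem x₀
  have hspos : 0 < s := by
    have := interior_mono hIpos hs
    rwa [interior_Ici] at this
  have hsI : Icc 0 s ⊆ I := hI.ordConnected.out h0 (interior_subset hs)
  have hint : Ioc 0 s ⊆ interior I := by
    intro r hr
    rcases hr.2.lt_or_eq with h | rfl
    · exact mem_interior.2 ⟨Ioo 0 s, fun t ht => hsI ⟨ht.1.le, ht.2.le⟩, isOpen_Ioo, hr.1, h⟩
    · exact hs
  set h : ℝ → ℝ := sliceInf ψ y with hh
  set c0 : ℝ := ψ₀ x₀ - fderiv ℝ ψ₀ x₀ x₀ with hc0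
  -- The line through the values at `s / 2` and `s`. Time `0` is not an interior time, so the
  -- intercept has to be found from the initial conditions as a limit.
  obtain ⟨α, β, hlin⟩ : ∃ α β : ℝ, ∀ r ∈ Ioc 0 s, h r = α + β * r := by
    refine ⟨2 * h (s / 2) - h s, (h s - h (s / 2)) / (s / 2), fun r hr => ?_⟩
    have hhalf : s / 2 ∈ interior I := hint ⟨by linarith, by linarith⟩
    rcases lt_trichotomy r (s / 2) with hlt | heq | hgt
    · have := hψ.affine hI hd.convex hyP (hint hr) hs hlt (by linarith)
      rw [← hh] at this
      field_simp
      nlinarith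
    · rw [heq]; field_simp; ring
    · rcases hr.2.lt_or_eq with hlt | heq
      · have := hψ.affine hI hd.convex hyP hhalf hs hgt hlt
        rw [← hh] at this
        field_simp
        nlinarith
      · rw [heq]; field_simp; ring
  have hfd : ∀ z, fderiv ℝ ψ₀ x₀ z = inner ℝ y z := fun z => (inner_gradient ψ₀ x₀ z).symm
  -- The infimum is tested at `x₀`, using only the initial velocity there.
  have hupper : ∀ ε > 0, ∀ᶠ r in 𝓝[>] (0 : ℝ), h r ≤ c0 + r * (ψ₁ x₀ + ε) := by
    intro ε hε
    have h1 := (hasDerivWithinAt_iff_isLittleO.1 (hψ.initial_deriv x₀)).def hε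
    have h2 : 𝓝[>] (0 : ℝ) ≤ 𝓝[I] 0 := by
      rw [← nhdsWithin_Ioc_eq_nhdsGT hspos]
      exact nhdsWithin_mono _ (Ioc_subset_Icc_self.trans hsI)
    filter_upwards [h2 h1, Ioc_mem_nhdsGT hspos] with r hr hr'
    rw [hψ.initial, sub_zero, smul_eq_mul, Real.norm_eq_abs, Real.norm_eq_abs, abs_of_pos hr'.1] at hr
    obtain ⟨w, hw⟩ := hψ.exists_mem_subdiff (hsI ⟨hr'.1.le, hr'.2⟩) hyP
    have h3 := sliceInf_le hw x₀
    have h4 := (abs_le.1 hr).2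
    rw [hc0, hfd]
    change h r ≤ _ at h3
    linarith
  -- Convexity in time gives `ψ(r,·) ≥ ψ₀ + r ψ₁` everywhere. Since `x₀` is the strict minimum of
  -- `ψ₀ - ⟨y,·⟩` and `ψ₁` is bounded, the perturbed minimum is controlled to first order.
  have hlower : ∀ ε > 0, ∀ᶠ r in 𝓝[>] (0 : ℝ), c0 + r * (ψ₁ x₀ - ε) ≤ h r := by
    intro ε hε
    obtain ⟨C, hC⟩ := hd.bounded_deriv
    have hkconv : ConvexOn ℝ univ (fun x => ψ₀ x - inner ℝ y x - c0) := by
      have h1 : ConvexOn ℝ univ (fun x : RSpace n => -inner ℝ y x - c0) := by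
        refine ⟨convex_univ, fun u _ v _ a b _ _ hab => ?_⟩
        simp only [inner_add_right, real_inner_smul_right, smul_eq_mul]
        have : c0 = a * c0 + b * c0 := by rw [← add_mul, hab, one_mul]
        exact le_of_eq (by linarith)
      refine (hd.convexOn.add h1).congr fun x _ => ?_
      simp only [Pi.add_apply]
      ring
    have := eventually_le_perturbed_min (x₀ := x₀) hkconv
      (by have := hd.smooth.continuous; fun_prop) (by rw [hc0, hfd]; ring)
      (fun x hx => by
        have h1 := hd.add_fderiv_lt hx.symm
        rw [map_sub, hfd, hfd] at h1
        rw [hc0, hfd]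
        linarith) hd.smooth_deriv.continuous hC hε
    filter_upwards [this, Ioc_mem_nhdsGT hspos] with r hr hr'
    obtain ⟨w, hw⟩ := hψ.exists_mem_subdiff (hsI ⟨hr'.1.le, hr'.2⟩) hyP
    rw [hh, sliceInf_eq hw]
    have htime : ConvexOn ℝ I (fun t => ψ (t, w)) := by
      refine ⟨hI, fun t ht u hu a b ha hb hab => ?_⟩
      have := hψ.convex.2 (show (t, w) ∈ I ×ˢ univ from ⟨ht, mem_univ _⟩)
        (show (u, w) ∈ I ×ˢ univ from ⟨hu, mem_univ _⟩) ha hb hab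
      simpa only [Prod.smul_mk, Prod.mk_add_mk, ← add_smul, hab, one_smul] using this
    have h1 := htime.le_slope_of_hasDerivWithinAt h0 (hsI ⟨hr'.1.le, hr'.2⟩) hr'.1
      (hψ.initial_deriv w)
    rw [slope_def_field, sub_zero, le_div_iff₀ hr'.1, hψ.initial] at h1
    have h2 := hr w
    linarith
  have hlimh : ∀ ε > 0, |α - c0| ≤ ε := by
    intro ε hε
    have hL : Tendsto (fun r : ℝ => α - c0 + r * (β - ψ₁ x₀)) (𝓝[>] 0) (𝓝 (α - c0 + 0 * (β - ψ₁ x₀))) := by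
      apply tendsto_nhdsWithin_of_tendsto_nhds
      apply Continuous.tendsto
      fun_prop
    rw [zero_mul, add_zero] at hL
    refine le_of_tendsto hL.abs ?_
    filter_upwards [hupper 1 one_pos, hlower 1 one_pos, Ioc_mem_nhdsGT hspos, Ioc_mem_nhdsGT hε]
      with r h1 h2 h3 h4
    rw [hlin r h3] at h1 h2
    rw [abs_le]
    constructor <;> linarith [h4.2]
  have hα : α = c0 := by
    by_contra hne
    have h1 := hlimh (|α - c0| / 2) (by have := abs_pos.2 (sub_ne_zero.2 hne); linarith)
    have := abs_pos.2 (sub_ne_zero.2 hne)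
    linarith
  have hβ : β = ψ₁ x₀ := by
    apply le_antisymm
    · refine le_of_forall_pos_le_add fun ε hε => ?_
      obtain ⟨r, h1, h2⟩ := ((hupper ε hε).and (Ioc_mem_nhdsGT hspos)).exists
      rw [hlin r h2, hα] at h1
      have : r * β ≤ r * (ψ₁ x₀ + ε) := by linarith
      exact le_of_mul_le_mul_left this h2.1
    · refine le_of_forall_pos_le_add fun ε hε => ?_
      obtain ⟨r, h1, h2⟩ := ((hlower ε hε).and (Ioc_mem_nhdsGT hspos)).exists
      rw [hlin r h2, hα] at h1
      have : r * (ψ₁ x₀ - ε) ≤ r * β := by linarith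
      have := le_of_mul_le_mul_left this h2.1
      linarith
  rw [hlin s ⟨hspos, le_rfl⟩, hα, hβ]
  ring

theorem sliceInf_eq_legendre (hψ : IsAdmissibleSolution P I ψ₀ ψ₁ ψ) (hd : IsCauchyData P ψ₀ ψ₁)
    (hI : Convex ℝ I) (h0 : 0 ∈ I) (hIpos : I ⊆ Ici 0) {s : ℝ} (hs : s ∈ interior I) {y : RSpace n}
    (hy : y ∈ interior P) :
    sliceInf ψ y s = -(legendre ψ₀ y - s * momentVelocity ψ₀ ψ₁ y) := by
  rw [← hd.range_gradient] at hy
  obtain ⟨x, rfl⟩ := hy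
  rw [hψ.sliceInf_eq_affine hd hI h0 hIpos x hs, hd.legendre_gradient, hd.momentVelocity_gradient]
  ring

/-- This is the obstruction behind the upper bound on both lifespans. It uses no smoothness of the
solution. -/
theorem convexOn_legendre_sub (hψ : IsAdmissibleSolution P I ψ₀ ψ₁ ψ) (hd : IsCauchyData P ψ₀ ψ₁)
    (hI : Convex ℝ I) (h0 : 0 ∈ I) (hIpos : I ⊆ Ici 0) {s : ℝ} (hs : s ∈ interior I) :
    ConvexOn ℝ (interior P) (fun y => legendre ψ₀ y - s * momentVelocity ψ₀ ψ₁ y) := by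
  refine (hψ.concaveOn_sliceInf hd.convex (interior_subset hs)).neg.congr fun y hy => ?_
  rw [Pi.neg_apply, hψ.sliceInf_eq_legendre hd hI h0 hIpos hs hy, neg_neg]

/-- A slice of an admissible solution is determined by its Legendre transform on the interior of the
polytope. -/
theorem le_of_sliceInf_le (hψ : IsAdmissibleSolution P I ψ₀ ψ₁ ψ) (hd : IsCauchyData P ψ₀ ψ₁)
    {χ : ℝ × RSpace n → ℝ} {s : ℝ} (hs : s ∈ I)
    (hχ : ∀ y ∈ interior P, ∀ x, sliceInf ψ y s ≤ χ (s, x) - inner ℝ y x) (x : RSpace n) :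
    ψ (s, x) ≤ χ (s, x) := by
  refine le_of_forall_lt fun a ha => ?_
  obtain ⟨a', haa', ha'⟩ := exists_between ha
  refine haa'.trans_le ?_
  have hconv : ConvexOn ℝ univ fun z => ψ (s, z) := (hψ.strictConvex s hs).convexOn
  -- An affine minorant that nearly touches at `x`. Its slope `y` belongs to `P`, but may lie on the
  -- boundary, where the hypothesis says nothing.
  obtain ⟨l, c, hl, hlx⟩ := hconv.exists_affine_le_of_lt (𝕜 := ℝ) (mem_univ x) ha' isClosed_univ
    ((hψ.continuous_slice hs).lowerSemicontinuous.lowerSemicontinuousOn univ)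
  have hl' : ∀ z, l z + c ≤ ψ (s, z) := fun z => hl ⟨z, mem_univ z⟩
  simp only [RCLike.re_to_real] at hlx
  obtain ⟨y, hy⟩ : ∃ y : RSpace n, ∀ z, l z = inner ℝ y z :=
    ⟨(InnerProductSpace.toDual ℝ (RSpace n)).symm l, fun z => by simp⟩
  have hyP : y ∈ P := by
    rw [← hψ.closure_image s hs]
    exact conjugateDomain_subset_closure hconv ⟨c, fun z => by have := hl' z; rw [hy] at this; linarith⟩
  obtain ⟨y₀, hy₀⟩ : ∃ y₀, y₀ ∈ interior P := ⟨_, hd.gradient_mem 0⟩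
  -- Moving the slope towards an interior `y₀` makes the hypothesis applicable; the loss is linear
  -- in `t` and disappears as `t` tends to `0`.
  have key : ∀ t ∈ Ioc (0 : ℝ) 1,
      (1 - t) * a' + t * (sliceInf ψ y₀ s + inner ℝ y₀ x) ≤ χ (s, x) := by
    intro t ht
    have hyt : (1 - t) • y + t • y₀ ∈ interior P := by
      have := hd.convex.combo_closure_interior_mem_interior (subset_closure hyP) hy₀
        (sub_nonneg.2 ht.2) ht.1 (by ring)
      exact this
    obtain ⟨w, hw⟩ := hψ.exists_mem_subdiff hs hyt
    obtain ⟨w₀, hw₀⟩ := hψ.exists_mem_subdiff hs hy₀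
    have h1 := hχ _ hyt x
    rw [sliceInf_eq hw] at h1
    have h2 := mul_le_mul_of_nonneg_left (hl' w) (sub_nonneg.2 ht.2)
    have h3 := mul_le_mul_of_nonneg_left (sliceInf_le hw₀ w) ht.1.le
    rw [hy] at h2 hlx
    simp only [inner_add_left, real_inner_smul_left] at h1
    have h4 : c = a' - inner ℝ y x := by linarith
    rw [h4] at h2
    nlinarith
  have hlim : Tendsto (fun t : ℝ => (1 - t) * a' + t * (sliceInf ψ y₀ s + inner ℝ y₀ x)) (𝓝[>] 0)
      (𝓝 ((1 - 0) * a' + 0 * (sliceInf ψ y₀ s + inner ℝ y₀ x))) := by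
    apply tendsto_nhdsWithin_of_tendsto_nhds
    apply Continuous.tendsto
    fun_prop
  simp only [sub_zero, one_mul, zero_mul, add_zero] at hlim
  refine le_of_tendsto hlim ?_
  filter_upwards [Ioc_mem_nhdsGT (zero_lt_one' ℝ)] with t ht using key t ht

theorem eq_of_mem_interior {χ : ℝ × RSpace n → ℝ} (hψ : IsAdmissibleSolution P I ψ₀ ψ₁ ψ)
    (hχ : IsAdmissibleSolution P I ψ₀ ψ₁ χ) (hd : IsCauchyData P ψ₀ ψ₁)
    (hI : Convex ℝ I) (h0 : 0 ∈ I) (hIpos : I ⊆ Ici 0) {s : ℝ} (hs : s ∈ interior I)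
    (x : RSpace n) : ψ (s, x) = χ (s, x) := by
  have hs' := interior_subset hs
  apply le_antisymm
  · refine hψ.le_of_sliceInf_le hd hs' (fun y hy z => ?_) x
    obtain ⟨w, hw⟩ := hχ.exists_mem_subdiff hs' hy
    rw [hψ.sliceInf_eq_legendre hd hI h0 hIpos hs hy, ← hχ.sliceInf_eq_legendre hd hI h0 hIpos hs hy]
    exact sliceInf_le hw z
  · refine hχ.le_of_sliceInf_le hd hs' (fun y hy z => ?_) x
    obtain ⟨w, hw⟩ := hψ.exists_mem_subdiff hs' hy
    rw [hχ.sliceInf_eq_legendre hd hI h0 hIpos hs hy, ← hψ.sliceInf_eq_legendre hd hI h0 hIpos hs hy]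
    exact sliceInf_le hw z

end IsAdmissibleSolution

/-! ### Global inverses of time-dependent local diffeomorphisms -/

/-- The range is open because the map is open and closed because it is proper; the space is
connected. -/
theorem surjective_of_map_nhds_of_proper {E : Type*} [NormedAddCommGroup E] [NormedSpace ℝ E]
    [FiniteDimensional ℝ E] {f : E → E} (hf : Continuous f) (hopen : ∀ x, map f (𝓝 x) = 𝓝 (f x))
    (hproper : ∀ R : ℝ, ∃ R' : ℝ, ∀ x, ‖f x‖ ≤ R → ‖x‖ ≤ R') : Function.Surjective f := by
  have : ProperSpace E := FiniteDimensional.proper ℝ E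
  have ht : Tendsto f (cocompact E) (cocompact E) := by
    rw [← Metric.cobounded_eq_cocompact, ← tendsto_norm_atTop_iff_cobounded, tendsto_atTop]
    intro R
    obtain ⟨R', hR'⟩ := hproper R
    have : ∀ᶠ x : E in Bornology.cobounded E, R' + 1 ≤ ‖x‖ :=
      tendsto_norm_cobounded_atTop.eventually_ge_atTop (R' + 1)
    filter_upwards [this] with x hx
    by_contra h
    have := hR' x (not_le.1 h).le
    linarith
  have hclosed : IsClosed (range f) := (isProperMap_iff_tendsto_cocompact.2 ⟨hf, ht⟩).isClosedMap.isClosed_range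
  have hop : IsOpen (range f) := by
    rw [isOpen_iff_mem_nhds]
    rintro _ ⟨x, rfl⟩
    rw [← hopen]
    exact range_mem_map
  rw [← range_eq_univ]
  exact IsClopen.eq_univ ⟨hclosed, hop⟩ (range_nonempty f)

theorem map_nhds_eq_of_isInvertible {E : Type*} [NormedAddCommGroup E] [NormedSpace ℝ E]
    [FiniteDimensional ℝ E] {f : E → E} (hf : ContDiff ℝ ∞ f) {x : E}
    (h : (fderiv ℝ f x).IsInvertible) : map f (𝓝 x) = 𝓝 (f x) := by
  have : CompleteSpace E := FiniteDimensional.complete ℝ E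
  obtain ⟨e, he⟩ := h
  have h1 : HasStrictFDerivAt f (e : E →L[ℝ] E) x := by
    rw [he]
    exact hf.contDiffAt.hasStrictFDerivAt (by simp)
  exact h1.map_nhds_eq_of_equiv

theorem fderiv_slice {E F : Type*} [NormedAddCommGroup E] [NormedSpace ℝ E] [NormedAddCommGroup F]
    [NormedSpace ℝ F] {Φ : ℝ × E → F} (hΦ : Differentiable ℝ Φ) (s : ℝ) (x v : E) :
    fderiv ℝ (fun z => Φ (s, z)) x v = fderiv ℝ Φ (s, x) (0, v) := by
  have h1 : HasFDerivAt (fun z : E => (s, z)) (ContinuousLinearMap.inr ℝ ℝ E) x :=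
    hasFDerivAt_prodMk_right s x
  have h2 := (hΦ (s, x)).hasFDerivAt.comp x h1
  rw [show (fun z => Φ (s, z)) = Φ ∘ (fun z => (s, z)) from rfl, h2.fderiv]
  simp

/-- The inverse function theorem is applied to `(s, x) ↦ (s, Φ (s, x))` on all of space-time. Its
local inverse agrees with the slicewise inverse at times in `I` by injectivity. As `Φ` is smooth for
all times, smoothness reaches the endpoints of `I`. -/
theorem contDiffOn_inverse_of_bijective {E : Type*} [NormedAddCommGroup E] [NormedSpace ℝ E]
    [FiniteDimensional ℝ E] {Φ : ℝ × E → E} (hΦ : ContDiff ℝ ∞ Φ) {I : Set ℝ}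
    (hinv : ∀ s ∈ I, ∀ x, (fderiv ℝ (fun z => Φ (s, z)) x).IsInvertible)
    (hbij : ∀ s ∈ I, Function.Bijective fun z => Φ (s, z)) :
    ∃ Ψ : ℝ × E → E, ContDiffOn ℝ ∞ Ψ (I ×ˢ univ) ∧ (∀ s ∈ I, ∀ x, Φ (s, Ψ (s, x)) = x) ∧
      ∀ s ∈ I, ∀ x, Ψ (s, Φ (s, x)) = x := by
  have : CompleteSpace E := FiniteDimensional.complete ℝ E
  set Ψ : ℝ × E → E := fun q => Function.invFun (fun z => Φ (q.1, z)) q.2 with hΨ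
  have hr : ∀ s ∈ I, ∀ x, Φ (s, Ψ (s, x)) = x := fun s hs x =>
    Function.rightInverse_invFun (hbij s hs).2 x
  have hl : ∀ s ∈ I, ∀ x, Ψ (s, Φ (s, x)) = x := fun s hs x =>
    Function.leftInverse_invFun (hbij s hs).1 x
  refine ⟨Ψ, ?_, hr, hl⟩
  rintro ⟨s, x⟩ ⟨hs, -⟩
  set z := Ψ (s, x) with hz
  have hΦz : Φ (s, z) = x := hr s hs x
  set F : ℝ × E → ℝ × E := fun q => (q.1, Φ q) with hF
  have hFc : ContDiff ℝ ∞ F := contDiff_fst.prodMk hΦ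
  have hFd : HasFDerivAt F ((ContinuousLinearMap.fst ℝ ℝ E).prod (fderiv ℝ Φ (s, z))) (s, z) :=
    hasFDerivAt_fst.prodMk (hΦ.differentiable (by simp) _).hasFDerivAt
  have hFinv : (fderiv ℝ F (s, z)).IsInvertible := by
    rw [hFd.fderiv]
    apply isInvertible_of_injective rfl
    rintro ⟨τ, v⟩ h
    simp only [ContinuousLinearMap.prod_apply, ContinuousLinearMap.coe_fst', Prod.mk_eq_zero] at h
    obtain ⟨rfl, h2⟩ := h
    rw [← fderiv_slice (hΦ.differentiable (by simp))] at h2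
    rw [(hinv s hs z).injective (h2.trans (map_zero _).symm)]
    rfl
  obtain ⟨e, he⟩ := hFinv
  have hFd' : HasFDerivAt F (e : ℝ × E →L[ℝ] ℝ × E) (s, z) := by
    rw [he]
    exact (hFc.differentiable (by simp) _).hasFDerivAt
  have hFs := hFc.contDiffAt.hasStrictFDerivAt' hFd' (by simp)
  have hg := hFc.contDiffAt.to_localInverse hFd' (by simp)
  set g := hFc.contDiffAt.localInverse hFd' (by simp) with hgdef
  have hFz : F (s, z) = (s, x) := by simp [hF, hΦz]
  rw [hFz] at hg
  have hright : ∀ᶠ q in 𝓝 (s, x), F (g q) = q := by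
    have := hFs.eventually_right_inverse
    rw [hFz] at this
    exact this
  have heq : ∀ q ∈ I ×ˢ univ, F (g q) = q → Ψ q = (g q).2 := by
    rintro ⟨t, w⟩ ⟨ht, -⟩ hq
    simp only [hF, Prod.mk.injEq] at hq
    obtain ⟨h1, h2⟩ := hq
    have h3 : Φ (t, (g (t, w)).2) = w := by
      have h4 : (t, (g (t, w)).2) = g (t, w) := Prod.ext h1.symm rfl
      rw [h4, h2]
    have h5 := hl t ht (g (t, w)).2
    rwa [h3] at h5
  have hmain : ContDiffWithinAt ℝ ∞ (fun q => (g q).2) (I ×ˢ univ) (s, x) :=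
    (contDiff_snd.contDiffAt.comp (s, x) hg).contDiffWithinAt
  refine hmain.congr_of_eventuallyEq ?_ ?_
  · filter_upwards [self_mem_nhdsWithin, nhdsWithin_le_nhds hright] with q hq h using heq q hq h
  · exact heq _ ⟨hs, mem_univ _⟩ hright.self_of_nhds

/-! ### Null images -/

/-- The easy case of Sard's theorem: everywhere vanishing Jacobian determinant makes the image null.
It yields the Alexandrov condition both for the envelope and for geodesic rays. -/
theorem volume_image_eq_zero_of_singular {n : ℕ} {S : Set (ℝ × RSpace n)}
    {f : ℝ × RSpace n → ℝ × RSpace n} {f' : ℝ × RSpace n → (ℝ × RSpace n →L[ℝ] ℝ × RSpace n)}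
    (hf : ∀ q ∈ S, HasFDerivWithinAt f (f' q) S q) (hker : ∀ q ∈ S, ∃ v, v ≠ 0 ∧ f' q v = 0) :
    volume (f '' S) = 0 := by
  have : (volume : Measure (ℝ × RSpace n)).IsAddHaarMeasure := by
    rw [Measure.volume_eq_prod]
    infer_instance
  refine addHaar_image_eq_zero_of_det_fderivWithin_eq_zero volume hf fun q hq => ?_
  obtain ⟨v, hv, hv0⟩ := hker q hq
  by_contra hdet
  have h1 : LinearMap.det (f' q : ℝ × RSpace n →ₗ[ℝ] ℝ × RSpace n) ≠ 0 := hdet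
  have h2 := LinearMap.bot_lt_ker_of_det_eq_zero (f := (f' q : ℝ × RSpace n →ₗ[ℝ] ℝ × RSpace n))
  have h3 := (LinearMap.equivOfDetNeZero (f' q : ℝ × RSpace n →ₗ[ℝ] ℝ × RSpace n) h1).injective
  exact hv (h3 (show (f' q) v = (f' q) 0 by rw [hv0, map_zero]))

/-- At an interior time the touching point is an unconstrained local minimum of the difference, so a
subgradient must equal the differential. -/
theorem subdiffOn_eq_of_hasFDerivAt {n : ℕ} {I : Set ℝ} {ψ : ℝ × RSpace n → ℝ} {s : ℝ}
    {x : RSpace n} (hs : s ∈ interior I) {L : ℝ × RSpace n →L[ℝ] ℝ} (hL : HasFDerivAt ψ L (s, x))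
    {q : ℝ × RSpace n} (hq : q ∈ subdiffOn I ψ s x) :
    q.1 = L (1, 0) ∧ ∀ v, inner ℝ q.2 v = L (0, v) := by
  set M : ℝ × RSpace n →L[ℝ] ℝ := q.1 • ContinuousLinearMap.fst ℝ ℝ (RSpace n) +
    (innerSL ℝ q.2).comp (ContinuousLinearMap.snd ℝ ℝ (RSpace n)) with hM
  have hmin : IsLocalMin (fun p => ψ p - M p) (s, x) := by
    have hI : ∀ᶠ p : ℝ × RSpace n in 𝓝 (s, x), p.1 ∈ I :=
      continuous_fst.continuousAt.eventually (mem_interior_iff_mem_nhds.1 hs)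
    filter_upwards [hI] with p hp
    have := hq p.1 hp p.2
    simp [hM, inner_sub_right] at this ⊢
    linarith
  have h0 := hmin.hasFDerivAt_eq_zero (hL.sub M.hasFDerivAt)
  have h1 : ∀ v, L v = M v := fun v => by
    have := congrArg (fun N : ℝ × RSpace n →L[ℝ] ℝ => N v) h0
    simp at this
    linarith
  constructor
  · rw [h1]; simp [hM]
  · intro v; rw [h1]; simp [hM]

/-! ### The solution by characteristics -/

/-- The flow along characteristics. -/
def charFlow {n : ℕ} (ψ₀ ψ₁ : RSpace n → ℝ) (q : ℝ × RSpace n) : RSpace n :=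
  q.2 - q.1 • charVelocity ψ₀ ψ₁ q.2

/-- The affine function on space-time that supports the solution along the characteristic from `x`. -/
def charSupport {n : ℕ} (ψ₀ ψ₁ : RSpace n → ℝ) (x : RSpace n) (q : ℝ × RSpace n) : ℝ :=
  ψ₀ x + q.1 * ψ₁ x + fderiv ℝ ψ₀ x (q.2 - x)

/-- The solution of the Cauchy problem as an envelope. -/
def envelope {n : ℕ} (ψ₀ ψ₁ : RSpace n → ℝ) (q : ℝ × RSpace n) : ℝ :=
  ⨆ x, charSupport ψ₀ ψ₁ x q

/-- `s` is a nonnegative time before the convex lifespan. -/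
def IsSubcritical {n : ℕ} (P : Set (RSpace n)) (ψ₀ ψ₁ : RSpace n → ℝ) (s : ℝ) : Prop :=
  0 ≤ s ∧ ∃ T, s < T ∧
    ConvexOn ℝ (interior P) (fun y => legendre ψ₀ y - T * momentVelocity ψ₀ ψ₁ y)

namespace IsCauchyData

variable {n : ℕ} {P : Set (RSpace n)} {ψ₀ ψ₁ : RSpace n → ℝ}

/-- This is the first-order convexity inequality for `ψ₀⋆ - T u` between the points `∇ψ₀(x)` and
`∇ψ₀(z)`, rewritten on the space side: the gradient at the first point is the endpoint of the
characteristic from `x`. -/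
theorem charSupport_le (hd : IsCauchyData P ψ₀ ψ₁) {T : ℝ}
    (hT : ConvexOn ℝ (interior P) (fun y => legendre ψ₀ y - T * momentVelocity ψ₀ ψ₁ y))
    (x z : RSpace n) : charSupport ψ₀ ψ₁ z (T, charFlow ψ₀ ψ₁ (T, x)) ≤
      charSupport ψ₀ ψ₁ x (T, charFlow ψ₀ ψ₁ (T, x)) := by
  have hL := ((hd.hasFDerivAt_legendre x).sub
    ((hd.hasFDerivAt_momentVelocity x).const_mul T)).hasFDerivWithinAt (s := interior P)
  have := hT.add_fderiv_le (hd.gradient_mem x) (hd.gradient_mem z) hL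
  rw [hd.legendre_gradient, hd.legendre_gradient, hd.momentVelocity_gradient,
    hd.momentVelocity_gradient] at this
  have h1 : ∀ v, inner ℝ v (gradient ψ₀ z) = fderiv ℝ ψ₀ z v := fun v => by
    rw [real_inner_comm, inner_gradient]
  have h2 : ∀ v, inner ℝ v (gradient ψ₀ x) = fderiv ℝ ψ₀ x v := fun v => by
    rw [real_inner_comm, inner_gradient]
  simp only [_root_.sub_apply, _root_.smul_apply, innerSL_apply_apply,
    inner_sub_right, h1, h2, smul_eq_mul] at this
  simp only [charSupport, charFlow, map_sub, map_smul, smul_eq_mul]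
  linarith

theorem charSupport_affine (s θ T : ℝ) (hs : s = θ * T) (x z : RSpace n) :
    charSupport ψ₀ ψ₁ z (s, charFlow ψ₀ ψ₁ (s, x)) =
      (1 - θ) * charSupport ψ₀ ψ₁ z (0, x) +
        θ * charSupport ψ₀ ψ₁ z (T, charFlow ψ₀ ψ₁ (T, x)) := by
  subst hs
  simp only [charSupport, charFlow, map_sub, map_smul, smul_eq_mul]
  ring

/-- Along the characteristic from `x` each supporting function is affine in time. The inequality is
strict at time `0` by strict convexity of `ψ₀` and weak at time `T`, so it is strict at every time
before `T`. -/
theorem charSupport_lt (hd : IsCauchyData P ψ₀ ψ₁) {s : ℝ} (hs : IsSubcritical P ψ₀ ψ₁ s)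
    {x z : RSpace n} (hxz : z ≠ x) : charSupport ψ₀ ψ₁ z (s, charFlow ψ₀ ψ₁ (s, x)) <
      charSupport ψ₀ ψ₁ x (s, charFlow ψ₀ ψ₁ (s, x)) := by
  obtain ⟨h0, T, hsT, hT⟩ := hs
  have hT0 : 0 < T := h0.trans_lt hsT
  have hθ : s = s / T * T := by field_simp
  have hθ0 : 0 ≤ s / T := by positivity
  have hθ1 : 0 < 1 - s / T := by rw [sub_pos, div_lt_one hT0]; exact hsT
  rw [charSupport_affine s (s / T) T hθ x z, charSupport_affine s (s / T) T hθ x x]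
  have h1 := mul_le_mul_of_nonneg_left (hd.charSupport_le hT x z) hθ0
  have h2 : charSupport ψ₀ ψ₁ z (0, x) < charSupport ψ₀ ψ₁ x (0, x) := by
    simpa [charSupport] using hd.add_fderiv_lt hxz
  have h3 := mul_lt_mul_of_pos_left h2 hθ1
  linarith

theorem charSupport_le_of_subcritical (hd : IsCauchyData P ψ₀ ψ₁) {s : ℝ}
    (hs : IsSubcritical P ψ₀ ψ₁ s) (x z : RSpace n) :
    charSupport ψ₀ ψ₁ z (s, charFlow ψ₀ ψ₁ (s, x)) ≤
      charSupport ψ₀ ψ₁ x (s, charFlow ψ₀ ψ₁ (s, x)) := by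
  rcases eq_or_ne z x with rfl | h
  · exact le_rfl
  · exact (hd.charSupport_lt hs h).le

/-- The starting point is the unique maximizer among the supporting functions at the endpoint. -/
theorem charFlow_injective (hd : IsCauchyData P ψ₀ ψ₁) {s : ℝ} (hs : IsSubcritical P ψ₀ ψ₁ s) :
    Function.Injective fun x => charFlow ψ₀ ψ₁ (s, x) := by
  intro x z hxz
  by_contra hne
  have h1 := hd.charSupport_lt hs (Ne.symm hne)
  have h2 := hd.charSupport_lt hs hne
  simp only at hxz
  rw [hxz] at h1
  exact lt_asymm h1 h2

theorem contDiff_charFlow (hd : IsCauchyData P ψ₀ ψ₁) : ContDiff ℝ ∞ (charFlow ψ₀ ψ₁) := by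
  have := hd.contDiff_charVelocity
  unfold charFlow
  exact contDiff_snd.sub (contDiff_fst.smul (this.comp contDiff_snd))

theorem hasFDerivAt_charFlow (hd : IsCauchyData P ψ₀ ψ₁) (s : ℝ) (x : RSpace n) :
    HasFDerivAt (fun z => charFlow ψ₀ ψ₁ (s, z))
      (ContinuousLinearMap.id ℝ (RSpace n) - s • fderiv ℝ (charVelocity ψ₀ ψ₁) x) x :=
  (hasFDerivAt_id x).sub
    ((hd.contDiff_charVelocity.differentiable (by simp) x).hasFDerivAt.const_smul s)

/-- The linearized flow is positive with respect to the Hessian. -/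
theorem hessian_fderiv_charFlow_nonneg (hd : IsCauchyData P ψ₀ ψ₁) {T : ℝ}
    (hT : ConvexOn ℝ (interior P) (fun y => legendre ψ₀ y - T * momentVelocity ψ₀ ψ₁ y))
    (x v : RSpace n) : 0 ≤ fderiv ℝ (fderiv ℝ ψ₀) x v
      (v - T • fderiv ℝ (charVelocity ψ₀ ψ₁) x v) := by
  have hline : HasDerivAt (fun t : ℝ => x + t • v) v 0 := by
    simpa using ((hasDerivAt_id (0 : ℝ)).smul_const v).const_add x
  have h1 : HasDerivAt (fun t : ℝ => fderiv ℝ ψ₀ (x + t • v)) (fderiv ℝ (fderiv ℝ ψ₀) x v) 0 := by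
    exact (hd.hasFDerivAt_fderiv x).comp_hasDerivAt_of_eq (0 : ℝ) hline (by simp)
  have h2 : HasDerivAt (fun t : ℝ => charFlow ψ₀ ψ₁ (T, x + t • v))
      (v - T • fderiv ℝ (charVelocity ψ₀ ψ₁) x v) 0 :=
    (hd.hasFDerivAt_charFlow T x).comp_hasDerivAt_of_eq (0 : ℝ) hline (by simp)
  have h1' := h1.tendsto_slope_zero
  have h2' := h2.tendsto_slope_zero
  simp only [zero_add, zero_smul, add_zero] at h1' h2'
  have hap : Continuous fun p : (RSpace n →L[ℝ] ℝ) × RSpace n => p.1 p.2 :=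
    continuous_fst.clm_apply continuous_snd
  have h3 := (hap.tendsto _).comp (Filter.Tendsto.prodMk_nhds h1' h2')
  refine ge_of_tendsto h3 (Eventually.of_forall fun t => ?_)
  -- The two comparisons between `x` and `x + t v` add up to a monotonicity inequality for the
  -- increments of `∇ψ₀` and of the flow; dividing by `t²` gives the difference quotients.
  have h4 := hd.charSupport_le hT x (x + t • v)
  have h5 := hd.charSupport_le hT (x + t • v) x
  simp only [charSupport] at h4 h5
  show 0 ≤ (t⁻¹ • (fderiv ℝ ψ₀ (x + t • v) - fderiv ℝ ψ₀ x))
    (t⁻¹ • (charFlow ψ₀ ψ₁ (T, x + t • v) - charFlow ψ₀ ψ₁ (T, x)))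
  rw [_root_.smul_apply, _root_.sub_apply, map_smul, map_smul, smul_eq_mul, ← smul_sub, smul_eq_mul,
    ← mul_assoc]
  refine mul_nonneg (mul_self_nonneg _) ?_
  simp only [map_sub] at h4 h5 ⊢
  linarith

/-- The linearized flow is affine in time: the identity at `0`, nonnegative at `T`. Interpolation
leaves the factor `1 - s / T`. -/
theorem hessian_fderiv_charFlow_ge (hd : IsCauchyData P ψ₀ ψ₁) {s : ℝ}
    (hs : IsSubcritical P ψ₀ ψ₁ s) : ∃ c > 0, ∀ x v, c * fderiv ℝ (fderiv ℝ ψ₀) x v v ≤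
      fderiv ℝ (fderiv ℝ ψ₀) x v (v - s • fderiv ℝ (charVelocity ψ₀ ψ₁) x v) := by
  obtain ⟨h0, T, hsT, hT⟩ := hs
  have hT0 : 0 < T := h0.trans_lt hsT
  refine ⟨1 - s / T, by rw [gt_iff_lt, sub_pos, div_lt_one hT0]; exact hsT, fun x v => ?_⟩
  have h1 := mul_nonneg (show 0 ≤ s / T by positivity) (hd.hessian_fderiv_charFlow_nonneg hT x v)
  simp only [map_sub, map_smul, smul_eq_mul] at h1 ⊢
  have : s / T * (T * fderiv ℝ (fderiv ℝ ψ₀) x v (fderiv ℝ (charVelocity ψ₀ ψ₁) x v))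
    = s * fderiv ℝ (fderiv ℝ ψ₀) x v (fderiv ℝ (charVelocity ψ₀ ψ₁) x v) := by field_simp
  linarith

theorem isInvertible_fderiv_charFlow (hd : IsCauchyData P ψ₀ ψ₁) {s : ℝ}
    (hs : IsSubcritical P ψ₀ ψ₁ s) (x : RSpace n) :
    (fderiv ℝ (fun z => charFlow ψ₀ ψ₁ (s, z)) x).IsInvertible := by
  apply isInvertible_of_injective rfl
  intro v hv
  rw [(hd.hasFDerivAt_charFlow s x).fderiv] at hv
  obtain ⟨c, hc, h⟩ := hd.hessian_fderiv_charFlow_ge hs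
  by_contra hne
  have h1 := h x v
  have h2 := mul_pos hc (hd.hessian_pos x v hne)
  simp only [_root_.sub_apply, ContinuousLinearMap.id_apply,
    _root_.smul_apply] at hv
  rw [hv, map_zero] at h1
  linarith

/-- The characteristic velocity may be unbounded for general data, so properness uses convexity.
Writing `X_s = (1 - θ) x + θ X_T`, the inequality at `T` and the boundedness of `P` and `ψ₁` bound
`(∇ψ₀(z) - ∇ψ₀(x))·x` from below in terms of `‖X_s‖`, for `z` in the unit ball. Convexity of `ψ₀`
bounds it from above. Taking `∇ψ₀(z) = ∇ψ₀(0) + ρ x/‖x‖` gains `ρ‖x‖` over `z = 0`, which must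
therefore be bounded. -/
theorem charFlow_proper (hd : IsCauchyData P ψ₀ ψ₁) (hP : Bornology.IsBounded P) {s : ℝ}
    (hs : IsSubcritical P ψ₀ ψ₁ s) (R : ℝ) :
    ∃ R' : ℝ, ∀ x, ‖charFlow ψ₀ ψ₁ (s, x)‖ ≤ R → ‖x‖ ≤ R' := by
  obtain ⟨h0, T, hsT, hT⟩ := hs
  have hT0 : 0 < T := h0.trans_lt hsT
  set θ : ℝ := s / T with hθ
  have hθs : s = θ * T := by rw [hθ]; field_simp
  have hθ0 : 0 ≤ θ := by positivity
  have hθ1 : 0 < 1 - θ := by rw [sub_pos, hθ, div_lt_one hT0]; exact hsT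
  obtain ⟨D, hD⟩ := hP.exists_norm_le
  have hgD : ∀ x, ‖gradient ψ₀ x‖ ≤ D := fun x => hD _ (interior_subset (hd.gradient_mem x))
  obtain ⟨C, hC⟩ := hd.bounded_deriv
  have hC0 : 0 ≤ C := (abs_nonneg _).trans (hC 0)
  obtain ⟨K, hK⟩ : ∃ K : ℝ, ∀ x ∈ Metric.closedBall (0 : RSpace n) 1,
      fderiv ℝ ψ₀ x x - ψ₀ x ≤ K := by
    have hc : Continuous fun x => fderiv ℝ ψ₀ x x - ψ₀ x :=
      (hd.contDiff_fderiv.continuous.clm_apply continuous_id).sub hd.smooth.continuous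
    obtain ⟨K, hK⟩ := (isCompact_closedBall (0 : RSpace n) 1).bddAbove_image hc.continuousOn
    exact ⟨K, fun x hx => hK (mem_image_of_mem _ hx)⟩
  obtain ⟨ρ, hρ, hball⟩ : ∃ ρ > 0, Metric.closedBall (gradient ψ₀ 0) ρ ⊆
      gradient ψ₀ '' Metric.closedBall 0 1 := by
    obtain ⟨e, he, -⟩ := hd.hasStrictFDerivAt_gradient 0
    have h1 : gradient ψ₀ '' Metric.closedBall 0 1 ∈ 𝓝 (gradient ψ₀ 0) := by
      rw [← he.map_nhds_eq_of_equiv]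
      exact image_mem_map (Metric.closedBall_mem_nhds _ one_pos)
    exact Metric.nhds_basis_closedBall.mem_iff.1 h1
  set K₁ : ℝ := |K + ψ₀ 0| with hK1
  set K₂ : ℝ := K₁ + 2 * T * C with hK2
  have hup : ∀ x z, z ∈ Metric.closedBall (0 : RSpace n) 1 →
      fderiv ℝ ψ₀ z x - fderiv ℝ ψ₀ x x ≤ K₁ := by
    intro x z hz
    have h1 := hd.add_fderiv_le z x
    have h2 := hd.add_fderiv_le x 0
    have h3 := hK z hz
    have h4 := le_abs_self (K + ψ₀ 0)
    rw [map_sub] at h1 h2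
    rw [map_zero] at h2
    linarith
  have hlow : ∀ x z, z ∈ Metric.closedBall (0 : RSpace n) 1 → ‖charFlow ψ₀ ψ₁ (s, x)‖ ≤ R →
      -(2 * D * R + K₂) ≤ (1 - θ) * (fderiv ℝ ψ₀ z x - fderiv ℝ ψ₀ x x) := by
    intro x z hz hR
    set XT := charFlow ψ₀ ψ₁ (T, x) with hXT
    set X := charFlow ψ₀ ψ₁ (s, x) with hX
    have hcomb : X = (1 - θ) • x + θ • XT := by
      rw [hX, hXT, charFlow, charFlow, hθs]
      simp only
      module
    have h1 := hd.charSupport_le hT x z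
    have h2 := hd.add_fderiv_le x 0
    have h3 := hK z hz
    have h4 := le_abs_self (K + ψ₀ 0)
    have h5 := abs_le.1 (hC x)
    have h6 := abs_le.1 (hC z)
    rw [map_sub, map_zero] at h2
    simp only [charSupport, map_sub, ← hXT] at h1
    have h7 : fderiv ℝ ψ₀ z XT - fderiv ℝ ψ₀ x XT ≤ K₂ := by
      rw [hK2, hK1]; nlinarith
    have h8 : |fderiv ℝ ψ₀ z X - fderiv ℝ ψ₀ x X| ≤ 2 * D * R := by
      rw [← inner_gradient, ← inner_gradient, ← inner_sub_left]
      refine (abs_real_inner_le_norm _ _).trans ?_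
      have h9 : ‖gradient ψ₀ z - gradient ψ₀ x‖ ≤ 2 * D :=
        (norm_sub_le _ _).trans (by linarith [hgD z, hgD x])
      exact mul_le_mul h9 hR (norm_nonneg _) ((norm_nonneg _).trans h9)
    have h9 : fderiv ℝ ψ₀ z X - fderiv ℝ ψ₀ x X = (1 - θ) * (fderiv ℝ ψ₀ z x - fderiv ℝ ψ₀ x x) +
        θ * (fderiv ℝ ψ₀ z XT - fderiv ℝ ψ₀ x XT) := by
      rw [hcomb]
      simp only [map_add, map_smul, smul_eq_mul]
      ring
    have h10 := (abs_le.1 h8).1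
    have hK20 : 0 ≤ K₂ := by rw [hK2]; positivity
    have h11 : θ * (fderiv ℝ ψ₀ z XT - fderiv ℝ ψ₀ x XT) ≤ K₂ := by
      have := mul_le_mul_of_nonneg_left h7 hθ0
      nlinarith
    linarith
  refine ⟨(K₁ + (2 * D * R + K₂) / (1 - θ)) / ρ, fun x hx => ?_⟩
  rw [le_div_iff₀ hρ]
  have h1 := hlow x 0 (Metric.mem_closedBall_self zero_le_one) hx
  have h2 : -((2 * D * R + K₂) / (1 - θ)) ≤ fderiv ℝ ψ₀ 0 x - fderiv ℝ ψ₀ x x := by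
    rw [← neg_div, div_le_iff₀ hθ1]
    linarith
  rcases eq_or_ne x 0 with rfl | hx0
  · have := hup 0 0 (Metric.mem_closedBall_self zero_le_one)
    simp at this h2 ⊢
    linarith
  have hnx : 0 < ‖x‖ := norm_pos_iff.2 hx0
  obtain ⟨z, hz, hzv⟩ := hball (show gradient ψ₀ 0 + (ρ / ‖x‖) • x ∈ _ by
    rw [Metric.mem_closedBall, dist_eq_norm, add_sub_cancel_left, norm_smul, Real.norm_eq_abs,
      abs_of_pos (by positivity)]
    field_simp
    exact le_rfl)
  have h3 := hup x z hz
  have h4 : fderiv ℝ ψ₀ z x = fderiv ℝ ψ₀ 0 x + ρ * ‖x‖ := by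
    rw [← inner_gradient, ← inner_gradient, hzv, inner_add_left, real_inner_smul_left,
      real_inner_self_eq_norm_sq]
    field_simp
  linarith

theorem charFlow_bijective (hd : IsCauchyData P ψ₀ ψ₁) (hP : Bornology.IsBounded P) {s : ℝ}
    (hs : IsSubcritical P ψ₀ ψ₁ s) : Function.Bijective fun x => charFlow ψ₀ ψ₁ (s, x) := by
  have hc : ContDiff ℝ ∞ fun x => charFlow ψ₀ ψ₁ (s, x) :=
    hd.contDiff_charFlow.comp (contDiff_const.prodMk contDiff_id)
  exact ⟨hd.charFlow_injective hs, surjective_of_map_nhds_of_proper hc.continuous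
    (fun x => map_nhds_eq_of_isInvertible hc (hd.isInvertible_fderiv_charFlow hs x))
    (hd.charFlow_proper hP hs)⟩

theorem envelope_charFlow (hd : IsCauchyData P ψ₀ ψ₁) {s : ℝ} (hs : IsSubcritical P ψ₀ ψ₁ s)
    (x : RSpace n) : envelope ψ₀ ψ₁ (s, charFlow ψ₀ ψ₁ (s, x)) =
      charSupport ψ₀ ψ₁ x (s, charFlow ψ₀ ψ₁ (s, x)) := by
  have hle := hd.charSupport_le_of_subcritical hs x
  exact le_antisymm (ciSup_le hle) (le_ciSup ⟨_, forall_mem_range.2 hle⟩ x)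

/-- The supremum is a true upper bound only when the family is bounded above; surjectivity of the
flow guarantees this by placing a maximizer over every point. -/
theorem charSupport_le_envelope (hd : IsCauchyData P ψ₀ ψ₁) (hP : Bornology.IsBounded P) {s : ℝ}
    (hs : IsSubcritical P ψ₀ ψ₁ s) (x z : RSpace n) :
    charSupport ψ₀ ψ₁ z (s, x) ≤ envelope ψ₀ ψ₁ (s, x) := by
  obtain ⟨w, rfl⟩ := (hd.charFlow_bijective hP hs).2 x
  rw [hd.envelope_charFlow hs]
  exact hd.charSupport_le_of_subcritical hs w z

theorem charFlow_zero (x : RSpace n) : charFlow ψ₀ ψ₁ (0, x) = x := by simp [charFlow]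

theorem contDiff_charSupport (hd : IsCauchyData P ψ₀ ψ₁) :
    ContDiff ℝ ∞ fun p : RSpace n × (ℝ × RSpace n) => charSupport ψ₀ ψ₁ p.1 p.2 := by
  have h1 := hd.smooth
  have h2 := hd.smooth_deriv
  have h3 := hd.contDiff_fderiv
  unfold charSupport
  exact ((h1.comp contDiff_fst).add ((contDiff_fst.comp contDiff_snd).mul (h2.comp contDiff_fst))).add
    ((h3.comp contDiff_fst).clm_apply ((contDiff_snd.comp contDiff_snd).sub contDiff_fst))

/-- The differential of the supporting functions vanishes in the direction of the parameter along the
characteristic. -/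
theorem hasFDerivAt_charSupport (hd : IsCauchyData P ψ₀ ψ₁) (s : ℝ) (x : RSpace n) :
    HasFDerivAt (fun p : RSpace n × (ℝ × RSpace n) => charSupport ψ₀ ψ₁ p.1 p.2)
      (((ψ₁ x) • ContinuousLinearMap.fst ℝ ℝ (RSpace n) +
        (fderiv ℝ ψ₀ x).comp (ContinuousLinearMap.snd ℝ ℝ (RSpace n))).comp
          (ContinuousLinearMap.snd ℝ (RSpace n) (ℝ × RSpace n)))
      (x, (s, charFlow ψ₀ ψ₁ (s, x))) := by
  set p₀ : RSpace n × (ℝ × RSpace n) := (x, (s, charFlow ψ₀ ψ₁ (s, x))) with hp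
  have hf1 : HasFDerivAt (fun p : RSpace n × (ℝ × RSpace n) => p.1)
    (ContinuousLinearMap.fst ℝ (RSpace n) (ℝ × RSpace n)) p₀ := hasFDerivAt_fst
  have hf2 : HasFDerivAt (fun p : RSpace n × (ℝ × RSpace n) => p.2)
    (ContinuousLinearMap.snd ℝ (RSpace n) (ℝ × RSpace n)) p₀ := hasFDerivAt_snd
  have hs1 : HasFDerivAt (fun p : RSpace n × (ℝ × RSpace n) => p.2.1)
    ((ContinuousLinearMap.fst ℝ ℝ (RSpace n)).comp
      (ContinuousLinearMap.snd ℝ (RSpace n) (ℝ × RSpace n))) p₀ := hf2.fst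
  have hs2 : HasFDerivAt (fun p : RSpace n × (ℝ × RSpace n) => p.2.2)
    ((ContinuousLinearMap.snd ℝ ℝ (RSpace n)).comp
      (ContinuousLinearMap.snd ℝ (RSpace n) (ℝ × RSpace n))) p₀ := hf2.snd
  have h0 := (hd.differentiable p₀.1).hasFDerivAt.comp p₀ hf1
  have h1 := (hd.smooth_deriv.differentiable (by simp) p₀.1).hasFDerivAt.comp p₀ hf1
  have h2 := (hd.hasFDerivAt_fderiv p₀.1).comp p₀ hf1
  refine ((h0.add (hs1.mul h1)).add (h2.clm_apply (hs2.sub hf1))).congr_fderiv ?_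
  refine ContinuousLinearMap.ext fun ⟨w, τ, v⟩ => ?_
  have h3 := hd.hessian_symm x w (charVelocity ψ₀ ψ₁ x)
  rw [hd.hessian_charVelocity] at h3
  simp [hp, charFlow, h3]
  ring

theorem exists_inverse_charFlow (hd : IsCauchyData P ψ₀ ψ₁) (hP : Bornology.IsBounded P) {I : Set ℝ}
    (hI : ∀ s ∈ I, IsSubcritical P ψ₀ ψ₁ s) :
    ∃ Ψ : ℝ × RSpace n → RSpace n, ContDiffOn ℝ ∞ Ψ (I ×ˢ univ) ∧
      (∀ s ∈ I, ∀ x, charFlow ψ₀ ψ₁ (s, Ψ (s, x)) = x) ∧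
      ∀ s ∈ I, ∀ x, Ψ (s, charFlow ψ₀ ψ₁ (s, x)) = x :=
  contDiffOn_inverse_of_bijective hd.contDiff_charFlow
    (fun s hs x => hd.isInvertible_fderiv_charFlow (hI s hs) x)
    (fun s hs => hd.charFlow_bijective hP (hI s hs))

theorem contDiffOn_envelope (hd : IsCauchyData P ψ₀ ψ₁) (hP : Bornology.IsBounded P) {I : Set ℝ}
    (hI : ∀ s ∈ I, IsSubcritical P ψ₀ ψ₁ s) : ContDiffOn ℝ ∞ (envelope ψ₀ ψ₁) (I ×ˢ univ) := by
  obtain ⟨Ψ, hΨ, hr, -⟩ := hd.exists_inverse_charFlow hP hI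
  have h1 : ContDiffOn ℝ ∞ (fun q => charSupport ψ₀ ψ₁ (Ψ q) q) (I ×ˢ univ) :=
    hd.contDiff_charSupport.comp_contDiffOn (hΨ.prodMk contDiffOn_id)
  refine h1.congr ?_
  rintro ⟨s, x⟩ ⟨hs, -⟩
  have := hd.envelope_charFlow (hI s hs) (Ψ (s, x))
  rwa [hr s hs] at this

/-- The differential of the envelope is transported by the characteristics. -/
theorem hasFDerivWithinAt_envelope (hd : IsCauchyData P ψ₀ ψ₁) (hP : Bornology.IsBounded P)
    {I : Set ℝ} (hI : ∀ s ∈ I, IsSubcritical P ψ₀ ψ₁ s) {s : ℝ} (hs : s ∈ I) (x : RSpace n) :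
    HasFDerivWithinAt (envelope ψ₀ ψ₁) ((ψ₁ x) • ContinuousLinearMap.fst ℝ ℝ (RSpace n) +
        (fderiv ℝ ψ₀ x).comp (ContinuousLinearMap.snd ℝ ℝ (RSpace n))) (I ×ˢ univ)
      (s, charFlow ψ₀ ψ₁ (s, x)) := by
  obtain ⟨Ψ, hΨ, hr, hl⟩ := hd.exists_inverse_charFlow hP hI
  set q₀ : ℝ × RSpace n := (s, charFlow ψ₀ ψ₁ (s, x)) with hq
  have hmem : q₀ ∈ I ×ˢ univ := ⟨hs, mem_univ _⟩
  have hΨq : Ψ q₀ = x := hl s hs x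
  have h1 := ((hΨ q₀ hmem).differentiableWithinAt (by simp)).hasFDerivWithinAt
  have h2 := h1.prodMk (hasFDerivWithinAt_id q₀ (I ×ˢ univ))
  have h3 := hd.hasFDerivAt_charSupport s x
  rw [show (x, (s, charFlow ψ₀ ψ₁ (s, x))) = (Ψ q₀, id q₀) by rw [hΨq]; rfl] at h3
  have h4 := HasFDerivAt.comp_hasFDerivWithinAt (f := fun q => (Ψ q, id q)) q₀ h3 h2
  have heq : ∀ q ∈ I ×ˢ univ, envelope ψ₀ ψ₁ q = charSupport ψ₀ ψ₁ (Ψ q) q := by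
    rintro ⟨t, z⟩ ⟨ht, -⟩
    have := hd.envelope_charFlow (hI t ht) (Ψ (t, z))
    rwa [hr t ht] at this
  refine (h4.congr heq (heq q₀ hmem)).congr_fderiv ?_
  refine ContinuousLinearMap.ext fun v => ?_
  simp

theorem hasFDerivAt_envelope_slice (hd : IsCauchyData P ψ₀ ψ₁) (hP : Bornology.IsBounded P)
    {s : ℝ} (hs : IsSubcritical P ψ₀ ψ₁ s) (x : RSpace n) :
    HasFDerivAt (fun z => envelope ψ₀ ψ₁ (s, z)) (fderiv ℝ ψ₀ x) (charFlow ψ₀ ψ₁ (s, x)) := by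
  have h1 := hd.hasFDerivWithinAt_envelope hP (I := {s}) (by rintro _ rfl; exact hs) rfl x
  have h2 : HasFDerivWithinAt (fun z : RSpace n => (s, z)) (ContinuousLinearMap.inr ℝ ℝ (RSpace n))
    univ (charFlow ψ₀ ψ₁ (s, x)) := (hasFDerivAt_prodMk_right s _).hasFDerivWithinAt
  have h3 := h1.comp (charFlow ψ₀ ψ₁ (s, x)) h2 (fun z _ => ⟨rfl, mem_univ _⟩)
  rw [hasFDerivWithinAt_univ] at h3
  refine h3.congr_fderiv ?_
  refine ContinuousLinearMap.ext fun v => ?_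
  simp

theorem envelope_zero (hd : IsCauchyData P ψ₀ ψ₁) (h0 : IsSubcritical P ψ₀ ψ₁ 0) (x : RSpace n) :
    envelope ψ₀ ψ₁ (0, x) = ψ₀ x := by
  have := hd.envelope_charFlow h0 x
  rw [charFlow_zero] at this
  rw [this]
  simp [charSupport]

/-- All conditions follow from the characteristics: convexity because the supporting functions are
affine on space-time, strictness from the unique maximizer, and the gradient image of a slice
because `∇ψ₀` is merely transported. -/
theorem isAdmissibleSolution_envelope (hd : IsCauchyData P ψ₀ ψ₁) (hP : Bornology.IsBounded P)
    {I : Set ℝ} (hI : ∀ s ∈ I, IsSubcritical P ψ₀ ψ₁ s) (hIc : Convex ℝ I) (h0 : 0 ∈ I) :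
    IsAdmissibleSolution P I ψ₀ ψ₁ (envelope ψ₀ ψ₁) where
  convex := by
    refine ⟨hIc.prod convex_univ, ?_⟩
    rintro ⟨s, x⟩ ⟨hs, -⟩ ⟨r, z⟩ ⟨hr, -⟩ a b ha hb hab
    simp only [Prod.smul_mk, Prod.mk_add_mk]
    have ht := hIc hs hr ha hb hab
    obtain ⟨w, hw⟩ := (hd.charFlow_bijective hP (hI _ ht)).2 (a • x + b • z)
    simp only at hw
    rw [← hw, hd.envelope_charFlow (hI _ ht), hw]
    have h1 := mul_le_mul_of_nonneg_left (hd.charSupport_le_envelope hP (hI _ hs) x w) ha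
    have h2 := mul_le_mul_of_nonneg_left (hd.charSupport_le_envelope hP (hI _ hr) z w) hb
    have h3 : charSupport ψ₀ ψ₁ w (a • s + b • r, a • x + b • z) =
        a * charSupport ψ₀ ψ₁ w (s, x) + b * charSupport ψ₀ ψ₁ w (r, z) := by
      obtain rfl : a = 1 - b := by linarith
      simp only [charSupport, map_sub, map_add, map_smul, smul_eq_mul]
      ring
    simp only [smul_eq_mul] at h3 ⊢
    linarith
  initial := hd.envelope_zero (hI 0 h0)
  initial_deriv := by
    intro x
    have h1 := hd.hasFDerivWithinAt_envelope hP hI h0 x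
    rw [charFlow_zero] at h1
    have h2 : HasDerivWithinAt (fun s : ℝ => (s, x)) ((1 : ℝ), (0 : RSpace n)) I 0 :=
      (hasDerivWithinAt_id _ _).prodMk (hasDerivWithinAt_const _ _ _)
    have h3 := h1.comp_hasDerivWithinAt (0 : ℝ) h2
      (fun t ht => (⟨ht, mem_univ _⟩ : (t, x) ∈ I ×ˢ univ))
    exact h3.congr_deriv (by simp)
  strictConvex := by
    intro s hs
    obtain ⟨Ψ, hΨ, hr, hl⟩ := hd.exists_inverse_charFlow hP hI
    refine strictConvexOn_of_add_fderiv_lt (L := fun x => fderiv ℝ ψ₀ (Ψ (s, x))) fun x z hxz => ?_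
    have h1 := hd.envelope_charFlow (hI s hs) (Ψ (s, x))
    have h2 := hd.envelope_charFlow (hI s hs) (Ψ (s, z))
    have hne : Ψ (s, x) ≠ Ψ (s, z) := fun h => hxz (by rw [← hr s hs x, h, hr s hs z])
    have h3 := hd.charSupport_lt (hI s hs) hne
    rw [hr s hs] at h1 h2 h3
    rw [h1, h2]
    refine lt_of_eq_of_lt ?_ h3
    simp only [charSupport, map_sub]
    ring
  closure_image := by
    intro s hs
    obtain ⟨Ψ, hΨ, hr, hl⟩ := hd.exists_inverse_charFlow hP hI
    have hder : ∀ x, HasFDerivAt (fun z => envelope ψ₀ ψ₁ (s, z)) (fderiv ℝ ψ₀ (Ψ (s, x))) x := by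
      intro x
      have := hd.hasFDerivAt_envelope_slice hP (hI s hs) (Ψ (s, x))
      rwa [hr s hs] at this
    rw [iUnion_subdiff_eq_range (fun x => (hder x).differentiableAt), ← hd.closure_range]
    · congr 1
      have hg : ∀ x, gradient (fun z => envelope ψ₀ ψ₁ (s, z)) x = gradient ψ₀ (Ψ (s, x)) := by
        intro x
        refine ext_inner_right ℝ fun v => ?_
        rw [inner_gradient, inner_gradient, (hder x).fderiv]
      ext y
      constructor
      · rintro ⟨x, rfl⟩
        exact ⟨_, (hg x).symm⟩
      · rintro ⟨x, rfl⟩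
        exact ⟨charFlow ψ₀ ψ₁ (s, x), by rw [hg, hl s hs]⟩
    · intro x z
      have h1 := hd.envelope_charFlow (hI s hs) (Ψ (s, x))
      have h2 := hd.charSupport_le_envelope hP (hI s hs) z (Ψ (s, x))
      rw [hr s hs] at h1
      rw [h1, (hder x).fderiv]
      refine le_trans (le_of_eq ?_) h2
      simp only [charSupport, map_sub]
      ring
  weak := by
    -- The differential of the envelope takes only the values `(ψ₁, ∇ψ₀)`. Viewed as a map on
    -- space-time independent of time, this pair has `(1, 0)` in the kernel of its derivative.
    have hnull : volume ((fun q : ℝ × RSpace n => (ψ₁ q.2, gradient ψ₀ q.2)) '' univ) = 0 := by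
      choose e he _ using hd.hasStrictFDerivAt_gradient
      apply volume_image_eq_zero_of_singular (f' := fun q =>
        ((fderiv ℝ ψ₁ q.2).prod (e q.2 : RSpace n →L[ℝ] RSpace n)).comp
          (ContinuousLinearMap.snd ℝ ℝ (RSpace n)))
      · intro q _
        have h1 := (hd.smooth_deriv.differentiable (by simp) q.2).hasFDerivAt.prodMk
          (he q.2).hasFDerivAt
        exact (h1.comp q hasFDerivAt_snd).hasFDerivWithinAt
      · intro q _
        exact ⟨(1, 0), by simp, by simp⟩
    refine measure_mono_null ?_ hnull
    intro q hq
    simp only [mem_iUnion] at hq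
    obtain ⟨s, hs, x, hq⟩ := hq
    have hsI := interior_subset hs
    obtain ⟨w, hw⟩ := (hd.charFlow_bijective hP (hI s hsI)).2 x
    simp only at hw
    have h1 := hd.hasFDerivWithinAt_envelope hP hI hsI w
    rw [hw] at h1
    have h2 := h1.hasFDerivAt (prod_mem_nhds (mem_interior_iff_mem_nhds.1 hs) univ_mem)
    obtain ⟨h3, h4⟩ := subdiffOn_eq_of_hasFDerivAt hs h2 hq
    refine ⟨(0, w), mem_univ _, Prod.ext ?_ ?_⟩
    · simp [h3]
    · refine ext_inner_right ℝ fun v => ?_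
      rw [inner_gradient, h4]
      simp

end IsCauchyData

/-! ### Division of smooth functions -/

theorem hasFDerivAt_intervalIntegral {X V : Type} [NormedAddCommGroup X] [NormedSpace ℝ X]
    [FiniteDimensional ℝ X] [NormedAddCommGroup V] [NormedSpace ℝ V] [FiniteDimensional ℝ V]
    {f : X × ℝ → V} (hf : ContDiff ℝ ∞ f) (x : X) :
    HasFDerivAt (fun x => ∫ t in (0 : ℝ)..1, f (x, t))
      (∫ t in (0 : ℝ)..1, (fderiv ℝ f (x, t)).comp (ContinuousLinearMap.inl ℝ X ℝ)) x := by
  have : ProperSpace X := FiniteDimensional.proper ℝ X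
  have hf' : Continuous fun q => (fderiv ℝ f q).comp (ContinuousLinearMap.inl ℝ X ℝ) :=
    ((hf.continuous_fderiv (by simp)).clm_comp continuous_const)
  obtain ⟨C, hC⟩ := ((isCompact_closedBall x 1).prod (isCompact_Icc (a := (0 : ℝ)) (b := 1))
    ).exists_bound_of_continuousOn hf'.continuousOn
  refine (intervalIntegral.hasFDerivAt_integral_of_dominated_of_fderiv_le (𝕜 := ℝ)
    (F := fun x t => f (x, t))
    (F' := fun x t => (fderiv ℝ f (x, t)).comp (ContinuousLinearMap.inl ℝ X ℝ))
    (s := Metric.ball x 1) (bound := fun _ => C) (Metric.ball_mem_nhds x one_pos) ?_ ?_ ?_ ?_ ?_ ?_)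
  · refine Eventually.of_forall fun z => Continuous.aestronglyMeasurable ?_
    exact hf.continuous.comp (by fun_prop)
  · exact Continuous.intervalIntegrable (hf.continuous.comp (by fun_prop)) _ _
  · exact Continuous.aestronglyMeasurable (hf'.comp (by fun_prop))
  · refine Eventually.of_forall fun t ht z hz => hC (z, t) ⟨Metric.ball_subset_closedBall hz, ?_⟩
    rw [uIoc_of_le zero_le_one] at ht
    exact Ioc_subset_Icc_self ht
  · exact intervalIntegrable_const
  · refine Eventually.of_forall fun t _ z _ => ?_
    exact (hf.differentiable (by simp) (z, t)).hasFDerivAt.comp z (hasFDerivAt_prodMk_left z t)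

/-- The target `V` is quantified inside the induction, since the derivative is an integral of the
same kind with values in linear maps. -/
theorem contDiff_nat_intervalIntegral {X : Type} [NormedAddCommGroup X] [NormedSpace ℝ X]
    [FiniteDimensional ℝ X] (k : ℕ) : ∀ {V : Type} [NormedAddCommGroup V] [NormedSpace ℝ V]
    [FiniteDimensional ℝ V] {f : X × ℝ → V} (_ : ContDiff ℝ ∞ f),
    ContDiff ℝ k (fun x => ∫ t in (0 : ℝ)..1, f (x, t)) := by
  induction k with
  | zero =>
    intro V _ _ _ f hf
    rw [Nat.cast_zero, contDiff_zero]
    exact continuous_iff_continuousAt.2 fun x => (hasFDerivAt_intervalIntegral hf x).continuousAt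
  | succ k ih =>
    intro V _ _ _ f hf
    push_cast
    rw [contDiff_succ_iff_hasFDerivAt]
    refine ⟨_, ih (f := fun q => (fderiv ℝ f q).comp (ContinuousLinearMap.inl ℝ X ℝ)) ?_,
      hasFDerivAt_intervalIntegral hf⟩
    exact (hf.fderiv_right (m := ∞) (by simp)).clm_comp contDiff_const

theorem contDiff_intervalIntegral {X V : Type} [NormedAddCommGroup X] [NormedSpace ℝ X]
    [FiniteDimensional ℝ X] [NormedAddCommGroup V] [NormedSpace ℝ V] [FiniteDimensional ℝ V]
    {f : X × ℝ → V} (hf : ContDiff ℝ ∞ f) : ContDiff ℝ ∞ (fun x => ∫ t in (0 : ℝ)..1, f (x, t)) :=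
  contDiff_infty.2 fun k => contDiff_nat_intervalIntegral k hf

theorem eq_zero_of_eq_neg {V : Type*} [AddCommGroup V] [Module ℝ V] {a : V} (h : a = -a) : a = 0 := by
  have h2 : (2 : ℝ) • a = 0 := by
    rw [two_smul]
    nth_rewrite 1 [h]
    simp
  exact (smul_eq_zero.1 h2).resolve_left two_ne_zero

/-- Hadamard's lemma in one variable, with parameters. -/
theorem exists_contDiff_eq_smul {X V : Type} [NormedAddCommGroup X] [NormedSpace ℝ X]
    [FiniteDimensional ℝ X] [NormedAddCommGroup V] [NormedSpace ℝ V] [FiniteDimensional ℝ V]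
    {f : X × ℝ → V} (hf : ContDiff ℝ ∞ f) (h0 : ∀ x, f (x, 0) = 0) :
    ∃ g : X × ℝ → V, ContDiff ℝ ∞ g ∧ ∀ x r, f (x, r) = r • g (x, r) := by
  have : CompleteSpace V := FiniteDimensional.complete ℝ V
  set f' : X × ℝ → V := fun q => fderiv ℝ f q (0, 1) with hf'
  have hf'c : ContDiff ℝ ∞ f' := (hf.fderiv_right (m := ∞) (by simp)).clm_apply contDiff_const
  refine ⟨fun q => ∫ t in (0 : ℝ)..1, f' (q.1, t * q.2), ?_, fun x r => ?_⟩
  · apply contDiff_intervalIntegral (f := fun q : (X × ℝ) × ℝ => f' (q.1.1, q.2 * q.1.2))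
    exact hf'c.comp ((contDiff_fst.comp contDiff_fst).prodMk
      (contDiff_snd.mul (contDiff_snd.comp contDiff_fst)))
  · have hder : ∀ t : ℝ, HasDerivAt (fun t : ℝ => f (x, t * r)) (r • f' (x, t * r)) t := by
      intro t
      have h1 : HasDerivAt (fun t : ℝ => (x, t * r)) ((0 : X), r) t := by
        refine (hasDerivAt_const t x).prodMk ?_
        simpa using (hasDerivAt_id t).mul_const r
      have h2 := (hf.differentiable (by simp) (x, t * r)).hasFDerivAt.comp_hasDerivAt t h1
      refine h2.congr_deriv ?_
      rw [hf', ← map_smul]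
      simp
    have hint := intervalIntegral.integral_eq_sub_of_hasDerivAt (a := 0) (b := 1)
      (fun t _ => hder t) (Continuous.intervalIntegrable
        (((hf'c.continuous.comp (by fun_prop)).const_smul r)) _ _)
    rw [intervalIntegral.integral_smul] at hint
    simp only [one_mul, zero_mul, h0, sub_zero] at hint
    exact hint.symm

theorem fderiv_even {X V : Type} [NormedAddCommGroup X] [NormedSpace ℝ X] [NormedAddCommGroup V]
    [NormedSpace ℝ V] {f : X × ℝ → V} (hf : ContDiff ℝ ∞ f) (he : ∀ x r, f (x, -r) = f (x, r))
    (x : X) (r : ℝ) (v : X) (τ : ℝ) : fderiv ℝ f (x, -r) (v, τ) = fderiv ℝ f (x, r) (v, -τ) := by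
  set N : X × ℝ →L[ℝ] X × ℝ := (ContinuousLinearMap.fst ℝ X ℝ).prod (-ContinuousLinearMap.snd ℝ X ℝ)
    with hN
  have h1 := (hf.differentiable (by simp) (N (x, -r))).hasFDerivAt.comp (x, -r) N.hasFDerivAt
  have h2 : f ∘ N = f := by
    funext ⟨y, t⟩
    simp [hN, he]
  rw [h2] at h1
  rw [h1.fderiv]
  simp [hN]

/-- The derivative of `f (x, ‖w‖)` for `f` even in the second variable. -/
theorem hasFDerivAt_comp_norm {X V W : Type} [NormedAddCommGroup X] [NormedSpace ℝ X]
    [NormedAddCommGroup V] [NormedSpace ℝ V] [NormedAddCommGroup W] [InnerProductSpace ℝ W]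
    {f : X × ℝ → V} (hf : ContDiff ℝ ∞ f) {g : X × ℝ → V}
    (hg : ∀ x r, fderiv ℝ f (x, r) (0, 1) = r • g (x, r)) (x : X) (w : W) :
    HasFDerivAt (fun q : X × W => f (q.1, ‖q.2‖))
      (((fderiv ℝ f (x, ‖w‖)).comp (ContinuousLinearMap.inl ℝ X ℝ)).comp
        (ContinuousLinearMap.fst ℝ X W) +
        ((innerSL ℝ w).comp (ContinuousLinearMap.snd ℝ X W)).smulRight (g (x, ‖w‖))) (x, w) := by
  rcases eq_or_ne w 0 with rfl | hw
  · have h1 := (hf.differentiable (by simp) (x, ‖(0 : W)‖)).hasFDerivAt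
    -- At `w = 0` the norm is not differentiable, but the radial derivative of `f` vanishes there,
    -- so the first-order expansion of `f` still gives a derivative.
    have h2 : ∀ v τ, fderiv ℝ f (x, ‖(0 : W)‖) (v, τ) = fderiv ℝ f (x, ‖(0 : W)‖) (v, 0) := by
      intro v τ
      have h3 := hg x 0
      rw [zero_smul] at h3
      rw [show (v, τ) = (v, 0) + τ • ((0 : X), (1 : ℝ)) by simp, map_add, map_smul, norm_zero, h3,
        smul_zero, add_zero]
    rw [hasFDerivAt_iff_isLittleO_nhds_zero] at h1 ⊢
    have ht : Tendsto (fun h : X × W => (h.1, ‖h.2‖)) (𝓝 0) (𝓝 (0 : X × ℝ)) := by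
      have : Continuous fun h : X × W => (h.1, ‖h.2‖) := by fun_prop
      rw [show (0 : X × ℝ) = ((0 : X × W).1, ‖(0 : X × W).2‖) by simp; rfl]
      exact this.tendsto 0
    have h3 := h1.comp_tendsto ht
    refine (h3.congr_left fun h => ?_).trans_isBigO (Asymptotics.IsBigO.of_bound 1
      (Eventually.of_forall fun h => ?_))
    · simp only [Function.comp_apply, Prod.mk_add_mk, norm_zero, zero_add, Prod.fst_add, Prod.snd_add]
      rw [norm_zero] at h2
      rw [h2]
      simp
    · simp [Prod.norm_def]
  · have h1 : HasFDerivAt (fun q : X × W => ‖q.2‖)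
        ((‖w‖⁻¹ • innerSL ℝ w).comp (ContinuousLinearMap.snd ℝ X W)) (x, w) := by
      have h0 : HasFDerivAt (fun w : W => ‖w‖) (‖w‖⁻¹ • innerSL ℝ w) w := by
        have h2 : HasFDerivAt (fun w : W => √(‖w‖ ^ 2)) _ w :=
          (hasStrictFDerivAt_norm_sq w).hasFDerivAt.sqrt (by simpa using hw)
        simp only [Real.sqrt_sq (norm_nonneg _)] at h2
        refine h2.congr_fderiv (ContinuousLinearMap.ext fun v => ?_)
        have : ‖w‖ ≠ 0 := norm_ne_zero_iff.2 hw
        simp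
        field_simp
      exact HasFDerivAt.comp (x, w) (g := fun w : W => ‖w‖) h0 hasFDerivAt_snd
    have h2 : HasFDerivAt (fun q : X × W => (q.1, ‖q.2‖)) _ (x, w) := hasFDerivAt_fst.prodMk h1
    have h3 := HasFDerivAt.comp (f := fun q : X × W => (q.1, ‖q.2‖)) (x, w)
      (hf.differentiable (by simp) (x, ‖w‖)).hasFDerivAt h2
    refine h3.congr_fderiv (ContinuousLinearMap.ext fun ⟨v, u⟩ => ?_)
    have h4 : ∀ τ : ℝ, fderiv ℝ f (x, ‖w‖) (v, τ) =
        fderiv ℝ f (x, ‖w‖) (v, 0) + τ • ‖w‖ • g (x, ‖w‖) := by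
      intro τ
      rw [← hg, ← map_smul, ← map_add]
      simp
    have hn : ‖w‖ ≠ 0 := norm_ne_zero_iff.2 hw
    show fderiv ℝ f (x, ‖w‖) (v, ‖w‖⁻¹ • inner ℝ w u) =
      fderiv ℝ f (x, ‖w‖) (v, 0) + inner ℝ w u • g (x, ‖w‖)
    rw [h4, smul_smul]
    congr 2
    rw [smul_eq_mul]
    field_simp

/-- The radial derivative of an even function is odd, hence vanishes at `0` and is divisible by `r`
with an even quotient. -/
theorem exists_even_quotient {X V : Type} [NormedAddCommGroup X] [NormedSpace ℝ X]
    [FiniteDimensional ℝ X] [NormedAddCommGroup V] [NormedSpace ℝ V] [FiniteDimensional ℝ V]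
    {f : X × ℝ → V} (hf : ContDiff ℝ ∞ f) (he : ∀ x r, f (x, -r) = f (x, r)) :
    ∃ g : X × ℝ → V, ContDiff ℝ ∞ g ∧ (∀ x r, g (x, -r) = g (x, r)) ∧
      ∀ x r, fderiv ℝ f (x, r) (0, 1) = r • g (x, r) := by
  have hc : ContDiff ℝ ∞ fun q : X × ℝ => fderiv ℝ f q (0, 1) :=
    (hf.fderiv_right (m := ∞) (by simp)).clm_apply contDiff_const
  have hodd : ∀ x r, fderiv ℝ f (x, -r) (0, 1) = -fderiv ℝ f (x, r) (0, 1) := by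
    intro x r
    rw [fderiv_even hf he, ← map_neg]
    simp
  obtain ⟨g, hg, hfg⟩ := exists_contDiff_eq_smul hc (fun x => by
    have := hodd x 0
    rw [neg_zero] at this
    exact eq_zero_of_eq_neg this)
  refine ⟨g, hg, fun x r => ?_, hfg⟩
  rcases eq_or_ne r 0 with rfl | hr
  · rw [neg_zero]
  · have := hodd x r
    rw [hfg, hfg, neg_smul, neg_inj] at this
    exact smul_right_injective V hr this

/-- The derivative is again built from even functions of the norm, namely the parameter derivative
and the even quotient, so the induction closes. -/
theorem contDiff_nat_comp_norm {X W : Type} [NormedAddCommGroup X] [NormedSpace ℝ X]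
    [FiniteDimensional ℝ X] [NormedAddCommGroup W] [InnerProductSpace ℝ W] (k : ℕ) :
    ∀ {V : Type} [NormedAddCommGroup V] [NormedSpace ℝ V] [FiniteDimensional ℝ V] {f : X × ℝ → V}
      (_ : ContDiff ℝ ∞ f) (_ : ∀ x r, f (x, -r) = f (x, r)),
      ContDiff ℝ k (fun q : X × W => f (q.1, ‖q.2‖)) := by
  induction k with
  | zero =>
    intro V _ _ _ f hf he
    rw [Nat.cast_zero, contDiff_zero]
    exact hf.continuous.comp (by fun_prop)
  | succ k ih =>
    intro V _ _ _ f hf he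
    obtain ⟨g, hg, hge, hfg⟩ := exists_even_quotient hf he
    push_cast
    rw [contDiff_succ_iff_hasFDerivAt]
    refine ⟨_, ?_, fun q => hasFDerivAt_comp_norm hf hfg q.1 q.2⟩
    have h1 := ih (f := fun q => (fderiv ℝ f q).comp (ContinuousLinearMap.inl ℝ X ℝ))
      ((hf.fderiv_right (m := ∞) (by simp)).clm_comp contDiff_const) (fun x r => by
        refine ContinuousLinearMap.ext fun v => ?_
        simp [fderiv_even hf he])
    refine (h1.clm_comp contDiff_const).add (ContDiff.smulRight ?_ (ih hg hge))
    exact ((innerSL ℝ).contDiff.comp contDiff_snd).clm_comp contDiff_const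

/-- A smooth even function of a real variable defines a smooth radial function. -/
theorem contDiff_comp_norm {X V W : Type} [NormedAddCommGroup X] [NormedSpace ℝ X]
    [FiniteDimensional ℝ X] [NormedAddCommGroup V] [NormedSpace ℝ V] [FiniteDimensional ℝ V]
    [NormedAddCommGroup W] [InnerProductSpace ℝ W] {f : X × ℝ → V} (hf : ContDiff ℝ ∞ f)
    (he : ∀ x r, f (x, -r) = f (x, r)) : ContDiff ℝ ∞ (fun q : X × W => f (q.1, ‖q.2‖)) :=
  contDiff_infty.2 fun k => contDiff_nat_comp_norm k hf he

/-- If a smooth function of the form `w * ξ` has a radial real factor `ξ`, then `ξ` is smooth. -/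
theorem exists_contDiff_radial_factor {X : Type} [NormedAddCommGroup X] [NormedSpace ℝ X]
    [FiniteDimensional ℝ X] {v : X × ℂ → ℂ} (hv : ContDiff ℝ ∞ v) {D : Set X} (hD : Dense D)
    {ξ : X × ℂ → ℝ} (hξ : ∀ x ∈ D, ∀ w, w ≠ 0 → v (x, w) = w * ξ (x, w))
    (hrad : ∀ x ∈ D, ∀ w, w ≠ 0 → ξ (x, w) = ξ (x, (‖w‖ : ℂ))) :
    ∃ η : X × ℂ → ℝ, ContDiff ℝ ∞ η ∧ (∀ x ∈ D, ∀ w, w ≠ 0 → η (x, w) = ξ (x, w)) ∧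
      ∀ x w, v (x, w) = w * η (x, w) := by
  -- Restricted to real `w`, the product `w ξ` is odd because `ξ` depends only on `‖w‖`. Hadamard's
  -- lemma divides by `r`, and the even quotient evaluated at `‖w‖` is the smooth factor.
  set f : X × ℝ → ℂ := fun q => v (q.1, (q.2 : ℂ)) with hf
  have hfc : ContDiff ℝ ∞ f :=
    hv.comp (contDiff_fst.prodMk (Complex.ofRealCLM.contDiff.comp contDiff_snd))
  have hoddD : ∀ x ∈ D, ∀ r, f (x, -r) = -f (x, r) := by
    have hne : ∀ x ∈ D, ∀ r : ℝ, r ≠ 0 → f (x, -r) = -f (x, r) := by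
      intro x hx r hr
      have hr' : (r : ℂ) ≠ 0 := by exact_mod_cast hr
      simp only [hf]
      push_cast
      rw [hξ x hx _ hr', hξ x hx _ (neg_ne_zero.2 hr'), hrad x hx _ hr',
        hrad x hx _ (neg_ne_zero.2 hr'), norm_neg]
      ring
    intro x hx
    have hc1 : Continuous fun r : ℝ => f (x, -r) := hfc.continuous.comp (by fun_prop)
    have hc2 : Continuous fun r : ℝ => -f (x, r) := (hfc.continuous.comp (by fun_prop)).neg
    have := Continuous.ext_on (dense_compl_singleton (0 : ℝ)) hc1 hc2 (fun r hr => hne x hx r hr)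
    exact fun r => congrFun this r
  have hodd : ∀ x r, f (x, -r) = -f (x, r) := by
    intro x r
    have hc1 : Continuous fun x => f (x, -r) := hfc.continuous.comp (by fun_prop)
    have hc2 : Continuous fun x => -f (x, r) := (hfc.continuous.comp (by fun_prop)).neg
    exact congrFun (Continuous.ext_on hD hc1 hc2 fun x hx => hoddD x hx r) x
  obtain ⟨g, hg, hfg⟩ := exists_contDiff_eq_smul hfc (fun x => by
    have := hodd x 0
    rw [neg_zero] at this
    exact eq_zero_of_eq_neg this)
  have hge : ∀ x r, g (x, -r) = g (x, r) := by
    intro x r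
    rcases eq_or_ne r 0 with rfl | hr
    · rw [neg_zero]
    · have := hodd x r
      rw [hfg, hfg, neg_smul, neg_inj] at this
      exact smul_right_injective ℂ hr this
  have hη : ∀ x ∈ D, ∀ w, w ≠ 0 → (g (x, ‖w‖)).re = ξ (x, w) := by
    intro x hx w hw
    have hn : (‖w‖ : ℂ) ≠ 0 := by simpa using hw
    have h1 := hfg x ‖w‖
    simp only [hf] at h1
    rw [hξ x hx _ hn, Complex.real_smul] at h1
    rw [← mul_left_cancel₀ hn h1, Complex.ofReal_re, hrad x hx w hw]
  have hηc : ContDiff ℝ ∞ fun q : X × ℂ => (g (q.1, ‖q.2‖)).re :=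
    Complex.reCLM.contDiff.comp (contDiff_comp_norm hg hge)
  refine ⟨fun q => (g (q.1, ‖q.2‖)).re, hηc, hη, ?_⟩
  have hdense : Dense (D ×ˢ ({0}ᶜ : Set ℂ)) := hD.prod (dense_compl_singleton 0)
  have := Continuous.ext_on hdense hv.continuous
    (continuous_snd.mul (Complex.continuous_ofReal.comp hηc.continuous)) (by
      rintro ⟨x, w⟩ ⟨hx, hw⟩
      show v (x, w) = w * (((g (x, ‖w‖)).re : ℝ) : ℂ)
      rw [hη x hx w hw, hξ x hx w hw])
  exact fun x w => congrFun this (x, w)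

/-! ### Logarithmic coordinates on the charts -/

/-- The linear parametrization of logarithmic space by the logarithmic coordinates of a chart. -/
def IsChartFrame {n : ℕ} (P : DelzantPolytope n) (p : Fin n → ℤ)
    (A : (Fin n → ℝ) ≃L[ℝ] RSpace n) : Prop :=
  ∀ t j, inner ℝ (intVec (P.edge p j)) (A t) = t j

/-- A vector orthogonal to all edges is orthogonal to the lattice they generate, in particular to
the standard basis, so the edge pairings are coordinates. -/
theorem exists_chartFrame {n : ℕ} (P : DelzantPolytope n) {p : Fin n → ℤ} (hp : p ∈ P.vertices) :
    ∃ A, IsChartFrame P p A := by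
  set B : RSpace n →L[ℝ] (Fin n → ℝ) :=
    ContinuousLinearMap.pi fun j => innerSL ℝ (intVec (P.edge p j)) with hB
  have hinv : B.IsInvertible := by
    apply isInvertible_of_injective (by simp)
    intro x hx
    have h1 : ∀ j, inner ℝ (intVec (P.edge p j)) x = 0 := fun j => congrFun hx j
    have h2 : ∀ m : Fin n → ℤ, inner ℝ (intVec m) x = 0 := by
      intro m
      have hm : m ∈ Submodule.span ℤ (range (P.edge p)) := by rw [P.span_edge p hp]; trivial
      induction hm using Submodule.span_induction with
      | mem m hm =>
        obtain ⟨j, rfl⟩ := hm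
        exact h1 j
      | zero =>
        have : intVec (0 : Fin n → ℤ) = 0 := by ext i; simp [intVec]
        rw [this, inner_zero_left]
      | add a b _ _ ha hb =>
        have : intVec (a + b) = intVec a + intVec b := by ext i; simp [intVec]
        rw [this, inner_add_left, ha, hb, add_zero]
      | smul c a _ ha =>
        have : intVec (c • a) = (c : ℝ) • intVec a := by ext i; simp [intVec]
        rw [this, real_inner_smul_left, ha, mul_zero]
    ext i
    have := h2 (Pi.single i 1)
    have he : intVec (Pi.single i 1 : Fin n → ℤ) = EuclideanSpace.single i (1 : ℝ) := by
      ext k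
      rcases eq_or_ne k i with rfl | hk
      · simp [intVec]
      · simp [intVec, hk]
    rw [he, EuclideanSpace.inner_single_left] at this
    simpa using this
  obtain ⟨e, he⟩ := hinv
  refine ⟨e.symm, fun t j => ?_⟩
  have h : B (e.symm t) = t := by rw [← he]; simp
  exact congrFun h j

/-- The componentwise exponential, which parametrizes the open orbit of a chart. -/
def expPt {n : ℕ} (z : Fin n → ℂ) : Fin n → ℂ := fun j => Complex.exp (z j)

/-- The logarithmic coordinate of the point `expPt z`. -/
def logPt {n : ℕ} (A : (Fin n → ℝ) ≃L[ℝ] RSpace n) : (Fin n → ℂ) →L[ℝ] RSpace n :=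
  (A : (Fin n → ℝ) →L[ℝ] RSpace n).comp
    (ContinuousLinearMap.pi fun j => (2 : ℝ) • Complex.reCLM.comp (ContinuousLinearMap.proj j))

/-- The real section of `logPt`. -/
def logSection {n : ℕ} (A : (Fin n → ℝ) ≃L[ℝ] RSpace n) : RSpace n →L[ℝ] (Fin n → ℂ) :=
  ContinuousLinearMap.pi fun j => ((2 : ℝ)⁻¹ • Complex.ofRealCLM).comp
    ((ContinuousLinearMap.proj j).comp (A.symm : RSpace n →L[ℝ] (Fin n → ℝ)))

theorem logSection_apply {n : ℕ} (A : (Fin n → ℝ) ≃L[ℝ] RSpace n) (x : RSpace n) (j : Fin n) :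
    logSection A x j = (((A.symm x j) / 2 : ℝ) : ℂ) := by
  simp [logSection]
  ring

theorem logPt_apply {n : ℕ} (A : (Fin n → ℝ) ≃L[ℝ] RSpace n) (z : Fin n → ℂ) :
    logPt A z = A fun j => 2 * (z j).re := by
  simp only [logPt, ContinuousLinearMap.comp_apply]
  rfl

theorem logPt_logSection {n : ℕ} (A : (Fin n → ℝ) ≃L[ℝ] RSpace n) (x : RSpace n) :
    logPt A (logSection A x) = x := by
  rw [logPt_apply, ← A.eq_symm_apply]
  funext j
  rw [logSection_apply, Complex.ofReal_re]
  ring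

theorem logPt_I_smul_logSection {n : ℕ} (A : (Fin n → ℝ) ≃L[ℝ] RSpace n) (x : RSpace n) :
    logPt A (Complex.I • logSection A x) = 0 := by
  rw [logPt_apply, show (fun j => 2 * ((Complex.I • logSection A x) j).re) = 0 from ?_, map_zero]
  funext j
  rw [Pi.smul_apply, logSection_apply, smul_eq_mul, Complex.I_mul_re, Complex.ofReal_im]
  simp

theorem expPt_ne_zero {n : ℕ} (z : Fin n → ℂ) (j : Fin n) : expPt z j ≠ 0 := Complex.exp_ne_zero _

theorem exists_expPt {n : ℕ} {w : Fin n → ℂ} (hw : ∀ j, w j ≠ 0) : ∃ z, w = expPt z :=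
  ⟨fun j => Complex.log (w j), funext fun j => (Complex.exp_log (hw j)).symm⟩

theorem dense_range_expPt {n : ℕ} : DenseRange (expPt : (Fin n → ℂ) → Fin n → ℂ) := by
  have h : Dense (univ.pi fun _ : Fin n => ({0}ᶜ : Set ℂ)) :=
    dense_pi univ fun _ _ => dense_compl_singleton 0
  refine h.mono fun w hw => ?_
  obtain ⟨z, hz⟩ := exists_expPt fun j => hw j (mem_univ j)
  exact ⟨z, hz.symm⟩

section Chart

variable {n : ℕ} {P : DelzantPolytope n} {p : Fin n → ℤ} {A : (Fin n → ℝ) ≃L[ℝ] RSpace n}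

theorem overChart_expPt (hA : IsChartFrame P p A) (z : Fin n → ℂ) :
    OverChart P p (expPt z) (logPt A z) := by
  intro j
  rw [logPt_apply, hA, expPt, Complex.norm_exp, ← Real.exp_nat_mul]
  norm_num

theorem OverChart.exists_eq (hA : IsChartFrame P p A) {w : Fin n → ℂ} {x : RSpace n}
    (h : OverChart P p w x) : ∃ z, w = expPt z ∧ x = logPt A z := by
  have hw : ∀ j, w j ≠ 0 := by
    intro j hj
    have := h j
    rw [hj, norm_zero, zero_pow two_ne_zero] at this
    exact (Real.exp_pos _).ne this
  obtain ⟨z, hz⟩ := exists_expPt hw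
  refine ⟨z, hz, ?_⟩
  rw [logPt_apply, ← A.symm_apply_eq]
  funext j
  have h1 := h j
  have h2 : inner ℝ (intVec (P.edge p j)) x = A.symm x j := by
    conv_lhs => rw [← A.apply_symm_apply x]
    exact hA _ j
  rw [h2, hz, expPt, Complex.norm_exp, ← Real.exp_nat_mul] at h1
  have := Real.exp_injective h1
  push_cast at this
  exact this.symm

/-- The exponentials parametrize exactly the pairs in `OverChart`, so extension conditions can be
tested, and differentiated, in logarithmic coordinates. -/
theorem forall_overChart_iff (hA : IsChartFrame P p A) {F : (Fin n → ℂ) → ℝ} {f : RSpace n → ℝ} :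
    (∀ w x, OverChart P p w x → F w = f x) ↔ ∀ z, F (expPt z) = f (logPt A z) := by
  constructor
  · exact fun h z => h _ _ (overChart_expPt hA z)
  · intro h w x hwx
    obtain ⟨z, rfl, rfl⟩ := hwx.exists_eq hA
    exact h z

theorem contDiff_expPt : ContDiff ℝ ∞ (expPt : (Fin n → ℂ) → Fin n → ℂ) :=
  contDiff_pi.2 fun j => (Complex.contDiff_exp (𝕜 := ℝ)).comp (contDiff_apply ℝ ℂ j)

theorem hasDerivAt_expPt_line (z α : Fin n → ℂ) :
    HasDerivAt (fun t : ℝ => expPt (z + t • α)) (expPt z * α) 0 := by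
  rw [hasDerivAt_pi]
  intro j
  have h1 : HasDerivAt (fun t : ℝ => z j + t • α j) (α j) 0 := by
    simpa using ((hasDerivAt_id (0 : ℝ)).smul_const (α j)).const_add (z j)
  have h2 := (Complex.hasDerivAt_exp (z j)).comp_of_eq (0 : ℝ) h1 (by simp)
  exact h2

theorem hasDerivAt_line {E : Type*} [NormedAddCommGroup E] [NormedSpace ℝ E] (x v : E) :
    HasDerivAt (fun t : ℝ => x + t • v) v 0 := by
  simpa using ((hasDerivAt_id (0 : ℝ)).smul_const v).const_add x

variable {F : (Fin n → ℂ) → ℝ} {f : RSpace n → ℝ}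

theorem contDiff_of_chart (hF : ContDiff ℝ ∞ F) (h : ∀ z, F (expPt z) = f (logPt A z)) :
    ContDiff ℝ ∞ f := by
  have : f = fun x => F (expPt (logSection A x)) := by
    funext x
    rw [h, logPt_logSection]
  rw [this]
  exact hF.comp (contDiff_expPt.comp (logSection A).contDiff)

theorem fderiv_chart (hF : ContDiff ℝ ∞ F) (h : ∀ z, F (expPt z) = f (logPt A z))
    (z α : Fin n → ℂ) :
    fderiv ℝ F (expPt z) (expPt z * α) = fderiv ℝ f (logPt A z) (logPt A α) := by
  have hf := contDiff_of_chart hF h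
  have h1 : HasDerivAt (fun t : ℝ => F (expPt (z + t • α))) (fderiv ℝ F (expPt z) (expPt z * α)) 0 :=
    (hF.differentiable (by simp) (expPt z)).hasFDerivAt.comp_hasDerivAt_of_eq 0
      (hasDerivAt_expPt_line z α) (by simp)
  have h2 : HasDerivAt (fun t : ℝ => f (logPt A z + t • logPt A α))
      (fderiv ℝ f (logPt A z) (logPt A α)) 0 :=
    (hf.differentiable (by simp) (logPt A z)).hasFDerivAt.comp_hasDerivAt_of_eq 0
      (hasDerivAt_line _ _) (by simp)
  refine h1.unique (h2.congr_of_eventuallyEq (Eventually.of_forall fun t => ?_))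
  simp only
  rw [h, map_add, map_smul]

theorem fderiv_fderiv_chart (hF : ContDiff ℝ ∞ F) (h : ∀ z, F (expPt z) = f (logPt A z))
    (z α β : Fin n → ℂ) :
    fderiv ℝ (fderiv ℝ F) (expPt z) (expPt z * α) (expPt z * β) +
      fderiv ℝ F (expPt z) (expPt z * α * β) =
      fderiv ℝ (fderiv ℝ f) (logPt A z) (logPt A α) (logPt A β) := by
  have hf := contDiff_of_chart hF h
  have hF2 : Differentiable ℝ (fderiv ℝ F) :=
    (hF.fderiv_right (m := ∞) (by simp)).differentiable (by simp)
  have hf2 : Differentiable ℝ (fderiv ℝ f) :=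
    (hf.fderiv_right (m := ∞) (by simp)).differentiable (by simp)
  have h1 : HasDerivAt (fun t : ℝ => fderiv ℝ F (expPt (z + t • α)))
      (fderiv ℝ (fderiv ℝ F) (expPt z) (expPt z * α)) 0 :=
    (hF2 (expPt z)).hasFDerivAt.comp_hasDerivAt_of_eq 0 (hasDerivAt_expPt_line z α) (by simp)
  have h2 : HasDerivAt (fun t : ℝ => expPt (z + t • α) * β) (expPt z * α * β) 0 :=
    (hasDerivAt_expPt_line z α).mul_const β
  have h3 := h1.clm_apply h2
  have h4 : HasDerivAt (fun t : ℝ => fderiv ℝ f (logPt A z + t • logPt A α))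
      (fderiv ℝ (fderiv ℝ f) (logPt A z) (logPt A α)) 0 :=
    (hf2 (logPt A z)).hasFDerivAt.comp_hasDerivAt_of_eq 0 (hasDerivAt_line _ _) (by simp)
  have h5 := h4.clm_apply (hasDerivAt_const (0 : ℝ) (logPt A β))
  have h6 := h3.unique (h5.congr_of_eventuallyEq (Eventually.of_forall fun t => by
    simp only
    rw [fderiv_chart hF h, map_add, map_smul]))
  simpa using h6

/-- Second derivatives in logarithmic coordinates carry a first-order correction in the direction `w
α β`. Replacing `α, β` by `iα, iβ` flips its sign, so it cancels in the Levi form. -/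
theorem leviForm_chart (hF : ContDiff ℝ ∞ F) (h : ∀ z, F (expPt z) = f (logPt A z))
    (z α β : Fin n → ℂ) :
    leviForm F (expPt z) (expPt z * α) (expPt z * β) =
      (fderiv ℝ (fderiv ℝ f) (logPt A z) (logPt A α) (logPt A β) +
        fderiv ℝ (fderiv ℝ f) (logPt A z) (logPt A (Complex.I • α)) (logPt A (Complex.I • β))) / 4 := by
  have h1 := fderiv_fderiv_chart hF h z α β
  have h2 := fderiv_fderiv_chart hF h z (Complex.I • α) (Complex.I • β)
  have h3 : expPt z * (Complex.I • α) = Complex.I • (expPt z * α) := mul_smul_comm _ _ _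
  have h4 : expPt z * (Complex.I • β) = Complex.I • (expPt z * β) := mul_smul_comm _ _ _
  have h5 : expPt z * (Complex.I • α) * (Complex.I • β) = -(expPt z * α * β) := by
    rw [h3, smul_mul_smul_comm, Complex.I_mul_I, neg_one_smul]
  rw [h5, map_neg, h3, h4] at h2
  rw [leviForm, ← h1, ← h2]
  ring

theorem exists_mul_expPt (z v : Fin n → ℂ) : ∃ α, v = expPt z * α :=
  ⟨fun j => v j / expPt z j, funext fun j => by
    show v j = expPt z j * (v j / expPt z j)
    have := expPt_ne_zero z j
    field_simp⟩

end Chart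

/-! ### Toric Kähler potentials -/

theorem isCompact_carrier {n : ℕ} (P : DelzantPolytope n) : IsCompact P.carrier := by
  rw [P.carrier_eq]
  exact Set.Finite.isCompact_convexHull (𝕜 := ℝ) (P.vertices.finite_toSet.image _)

theorem vertex_mem_carrier {n : ℕ} (P : DelzantPolytope n) {p : Fin n → ℤ} (hp : p ∈ P.vertices) :
    intVec p ∈ P.carrier := by
  rw [P.carrier_eq]
  exact subset_convexHull _ _ (mem_image_of_mem _ hp)

theorem exists_vertex_max {n : ℕ} (P : DelzantPolytope n) (l : RSpace n →L[ℝ] ℝ) :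
    ∃ p ∈ P.vertices, ∀ y ∈ P.carrier, l y ≤ l (intVec p) := by
  obtain ⟨p, hp, hmax⟩ := P.vertices.exists_max_image (fun p => l (intVec p)) P.vertices_nonempty
  refine ⟨p, hp, fun y hy => ?_⟩
  rw [P.carrier_eq] at hy
  have hconv : Convex ℝ {y | l y ≤ l (intVec p)} :=
    convex_halfSpace_le (LinearMap.isLinear (l : RSpace n →ₗ[ℝ] ℝ)) _
  refine convexHull_min ?_ hconv hy
  rintro _ ⟨q, hq, rfl⟩
  exact hmax q hq

theorem apply_cone_nonpos {n : ℕ} (P : DelzantPolytope n) {l : RSpace n →L[ℝ] ℝ} {p : Fin n → ℤ}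
    (hp : p ∈ P.vertices) (hmax : ∀ y ∈ P.carrier, l y ≤ l (intVec p)) {a : Fin n → ℝ}
    (ha : ∀ j, 0 ≤ a j) : l (∑ j, a j • intVec (P.edge p j)) ≤ 0 := by
  have : (∑ j, a j • intVec (P.edge p j)) ∈ {v : RSpace n | ∃ a : Fin n → ℝ, (∀ j, 0 ≤ a j) ∧
      v = ∑ j, a j • intVec (P.edge p j)} := ⟨a, ha, rfl⟩
  rw [← P.cone_eq p hp] at this
  obtain ⟨t, ht, y, hy, hv⟩ := this
  rw [hv, map_smul, map_sub, smul_eq_mul]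
  exact mul_nonpos_of_nonneg_of_nonpos ht (by linarith [hmax y hy])

/-- The open orbit is covered by the unit polydiscs of the charts. -/
theorem exists_vertex_inner_nonpos {n : ℕ} (P : DelzantPolytope n) (x : RSpace n) :
    ∃ p ∈ P.vertices, ∀ j, inner ℝ (intVec (P.edge p j)) x ≤ 0 := by
  obtain ⟨p, hp, hmax⟩ := exists_vertex_max P (innerSL ℝ x)
  refine ⟨p, hp, fun j => ?_⟩
  have := apply_cone_nonpos P hp hmax (a := Pi.single j 1) (fun i => by
    rcases eq_or_ne i j with rfl | h
    · simp
    · simp [h])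
  rw [Finset.sum_eq_single j (by intro b _ hb; simp [hb]) (by simp)] at this
  simpa [real_inner_comm] using this

/-- A Delzant polytope is the intersection of its cones at the vertices. -/
theorem mem_carrier_of_forall_cone {n : ℕ} (P : DelzantPolytope n) {y : RSpace n}
    (h : ∀ p ∈ P.vertices, ∃ a : Fin n → ℝ, (∀ j, 0 ≤ a j) ∧
      y = intVec p + ∑ j, a j • intVec (P.edge p j)) : y ∈ P.carrier := by
  by_contra hy
  have hconv : Convex ℝ P.carrier := by rw [P.carrier_eq]; exact convex_convexHull ℝ _
  -- A separating functional is maximal on the polytope at some vertex and nonpositive on the edge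
  -- cone there, so it cannot separate a point of the shifted cone.
  obtain ⟨l, u, hl, hu⟩ := geometric_hahn_banach_closed_point hconv (isCompact_carrier P).isClosed hy
  obtain ⟨p, hp, hmax⟩ := exists_vertex_max P l
  obtain ⟨a, ha, rfl⟩ := h p hp
  have h1 := apply_cone_nonpos P hp hmax ha
  have h2 := hl _ (vertex_mem_carrier P hp)
  rw [map_add] at hu
  linarith

theorem hessian_sub_inner {n : ℕ} {ψ : RSpace n → ℝ} (hψ : ContDiff ℝ ∞ ψ) (y : RSpace n) :
    (∀ x, fderiv ℝ (fun x => ψ x - inner ℝ y x) x = fderiv ℝ ψ x - innerSL ℝ y) ∧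
      fderiv ℝ (fderiv ℝ (fun x => ψ x - inner ℝ y x)) = fderiv ℝ (fderiv ℝ ψ) := by
  have h1 : ∀ x, fderiv ℝ (fun x => ψ x - inner ℝ y x) x = fderiv ℝ ψ x - innerSL ℝ y := fun x =>
    ((hψ.differentiable (by simp) x).hasFDerivAt.sub (innerSL ℝ y).hasFDerivAt).fderiv
  refine ⟨h1, ?_⟩
  funext x
  rw [show fderiv ℝ (fun x => ψ x - inner ℝ y x) = fun x => fderiv ℝ ψ x - innerSL ℝ y from funext h1,
    fderiv_sub_const]

/-! ### Local potentials and the moment map -/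

section LocalPotential

variable {n : ℕ} {P : DelzantPolytope n} {p : Fin n → ℤ} {A : (Fin n → ℝ) ≃L[ℝ] RSpace n}
  {F : (Fin n → ℂ) → ℝ} {ψ : RSpace n → ℝ}

theorem isLocalPotential_iff (hA : IsChartFrame P p A) :
    IsLocalPotential P p ψ F ↔ ∀ z, F (expPt z) = ψ (logPt A z) - inner ℝ (intVec p) (logPt A z) :=
  forall_overChart_iff (f := fun x => ψ x - inner ℝ (intVec p) x) hA

theorem IsLocalPotential.contDiff (hA : IsChartFrame P p A) (hF : ContDiff ℝ ∞ F)
    (h : IsLocalPotential P p ψ F) : ContDiff ℝ ∞ ψ := by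
  have h1 := contDiff_of_chart (f := fun x => ψ x - inner ℝ (intVec p) x) hF
    ((isLocalPotential_iff hA).1 h)
  have h2 : ψ = fun x => (ψ x - inner ℝ (intVec p) x) + innerSL ℝ (intVec p) x := by
    funext x; simp
  rw [h2]
  exact h1.add (innerSL ℝ (intVec p)).contDiff

theorem IsLocalPotential.leviForm_eq (hA : IsChartFrame P p A) (hF : ContDiff ℝ ∞ F)
    (h : IsLocalPotential P p ψ F) (z α β : Fin n → ℂ) :
    leviForm F (expPt z) (expPt z * α) (expPt z * β) =
      (fderiv ℝ (fderiv ℝ ψ) (logPt A z) (logPt A α) (logPt A β) +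
        fderiv ℝ (fderiv ℝ ψ) (logPt A z) (logPt A (Complex.I • α)) (logPt A (Complex.I • β))) / 4 := by
  rw [leviForm_chart (f := fun x => ψ x - inner ℝ (intVec p) x) hF ((isLocalPotential_iff hA).1 h),
    (hessian_sub_inner (h.contDiff hA hF) (intVec p)).2]

theorem IsLocalPotential.fderiv_eq (hA : IsChartFrame P p A) (hF : ContDiff ℝ ∞ F)
    (h : IsLocalPotential P p ψ F) (z α : Fin n → ℂ) :
    fderiv ℝ F (expPt z) (expPt z * α) =
      fderiv ℝ ψ (logPt A z) (logPt A α) - inner ℝ (intVec p) (logPt A α) := by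
  rw [fderiv_chart (f := fun x => ψ x - inner ℝ (intVec p) x) hF ((isLocalPotential_iff hA).1 h),
    (hessian_sub_inner (h.contDiff hA hF) (intVec p)).1]
  simp

theorem IsLocalPotential.hessian_pos (hA : IsChartFrame P p A) (hF : ContDiff ℝ ∞ F)
    (h : IsLocalPotential P p ψ F) (hpos : ∀ w v, v ≠ 0 → 0 < leviForm F w v v) (x v : RSpace n)
    (hv : v ≠ 0) : 0 < fderiv ℝ (fderiv ℝ ψ) x v v := by
  set z := logSection A x with hz
  set α := logSection A v with hα
  have h1 := h.leviForm_eq hA hF z α α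
  rw [hz, hα, logPt_logSection, logPt_logSection, logPt_I_smul_logSection, map_zero, add_zero] at h1
  have h2 : expPt z * α ≠ 0 := by
    intro h0
    apply hv
    have : α = 0 := by
      funext j
      have := congrFun h0 j
      simp only [Pi.mul_apply, Pi.zero_apply, mul_eq_zero] at this
      exact this.resolve_left (expPt_ne_zero z j)
    rw [← logPt_logSection A v, ← hα, this, map_zero]
  have h3 := hpos (expPt z) _ h2
  rw [← hz, ← hα] at h1
  rw [h1] at h3
  linarith

/-- The components of the moment map in the frame of a vertex. -/
theorem gradient_eq_add_sum (hA : IsChartFrame P p A) (ψ : RSpace n → ℝ) (x : RSpace n) :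
    gradient ψ x = intVec p + ∑ j, (fderiv ℝ ψ x (A (Pi.single j 1)) -
      inner ℝ (intVec p) (A (Pi.single j 1))) • intVec (P.edge p j) := by
  refine ext_inner_right ℝ fun v => ?_
  obtain ⟨t, rfl⟩ := A.surjective v
  rw [inner_gradient, inner_add_left, sum_inner]
  simp only [real_inner_smul_left, hA t]
  have h1 : ∀ L : RSpace n →L[ℝ] ℝ, L (A t) = ∑ j, L (A (Pi.single j 1)) * t j := by
    intro L
    conv_lhs => rw [pi_eq_sum_univ' t, map_sum, map_sum]
    refine Finset.sum_congr rfl fun j _ => ?_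
    rw [map_smul, map_smul, smul_eq_mul, mul_comm]
  have h2 := h1 (fderiv ℝ ψ x)
  have h3 := h1 (innerSL ℝ (intVec p))
  simp only [innerSL_apply_apply] at h3
  simp only [sub_mul, Finset.sum_sub_distrib]
  rw [h2, h3]
  ring

/-- Moving in the direction `-A e_j` keeps the point in a fixed polydisc, where the local potential
is bounded. A negative component would force linear growth there by convexity. -/
theorem IsLocalPotential.moment_nonneg (hA : IsChartFrame P p A) (hF : ContDiff ℝ ∞ F)
    (h : IsLocalPotential P p ψ F) (hconv : ∀ x z, ψ x + fderiv ℝ ψ x (z - x) ≤ ψ z) (x : RSpace n)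
    (j : Fin n) : 0 ≤ fderiv ℝ ψ x (A (Pi.single j 1)) - inner ℝ (intVec p) (A (Pi.single j 1)) := by
  set w := expPt (logSection A x) with hw
  obtain ⟨C, hC⟩ := (isCompact_closedBall (0 : Fin n → ℂ) ‖w‖).exists_bound_of_continuousOn
    hF.continuous.continuousOn
  by_contra hneg
  rw [not_le] at hneg
  set m := fderiv ℝ ψ x (A (Pi.single j 1)) - inner ℝ (intVec p) (A (Pi.single j 1)) with hm
  have key : ∀ s : ℝ, 0 ≤ s → ψ x - inner ℝ (intVec p) x - s * m ≤ C := by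
    intro s hs
    have h1 := hconv x (x - s • A (Pi.single j 1))
    have h2 := (isLocalPotential_iff hA).1 h (logSection A (x - s • A (Pi.single j 1)))
    rw [logPt_logSection] at h2
    have h3 := hC (expPt (logSection A (x - s • A (Pi.single j 1)))) (by
      rw [mem_closedBall_zero_iff, pi_norm_le_iff_of_nonneg (norm_nonneg _)]
      intro i
      refine le_trans ?_ (norm_le_pi_norm w i)
      rw [hw, expPt, expPt, Complex.norm_exp, Complex.norm_exp, Real.exp_le_exp, logSection_apply,
        logSection_apply, Complex.ofReal_re, Complex.ofReal_re, map_sub, map_smul,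
        A.symm_apply_apply]
      have : (0 : ℝ) ≤ s * (Pi.single j 1 : Fin n → ℝ) i := by
        rcases eq_or_ne i j with rfl | hij
        · simpa using hs
        · simp [hij]
      simp only [Pi.sub_apply, Pi.smul_apply, smul_eq_mul]
      linarith)
    rw [Real.norm_eq_abs] at h3
    have h4 := (abs_le.1 h3).2
    rw [h2] at h4
    rw [sub_sub_cancel_left, map_neg, map_smul, smul_eq_mul] at h1
    rw [inner_sub_right, real_inner_smul_right] at h4
    rw [hm]
    linarith
  have h1 := key ((|C - (ψ x - inner ℝ (intVec p) x)| + 1) / -m) (div_nonneg (by positivity)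
    (by linarith))
  have h2 : (|C - (ψ x - inner ℝ (intVec p) x)| + 1) / -m * m
    = -(|C - (ψ x - inner ℝ (intVec p) x)| + 1) := by
    have : m ≠ 0 := hneg.ne
    field_simp
  rw [h2] at h1
  have := le_abs_self (C - (ψ x - inner ℝ (intVec p) x))
  linarith

/-- As the point tends to the origin of the chart, the components of the moment map are derivatives
of the smooth potential in directions `w β` that tend to zero. -/
theorem IsLocalPotential.vertex_mem_closure (hA : IsChartFrame P p A) (hF : ContDiff ℝ ∞ F)
    (h : IsLocalPotential P p ψ F) : intVec p ∈ closure (range (gradient ψ)) := by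
  set x : ℕ → RSpace n := fun k => A fun _ => -(k : ℝ) with hx
  set c : ℕ → ℂ := fun k => ((Real.exp (-(k : ℝ) / 2) : ℝ) : ℂ) with hc
  have hw : ∀ k, expPt (logSection A (x k)) = fun _ => c k := by
    intro k
    funext j
    rw [expPt, logSection_apply, hx, hc]
    simp
  have hclim : Tendsto c atTop (𝓝 0) := by
    rw [← Complex.ofReal_zero]
    refine (Complex.continuous_ofReal.tendsto 0).comp (Real.tendsto_exp_atBot.comp ?_)
    have : Tendsto (fun k : ℕ => (k : ℝ) / 2) atTop atTop :=
      tendsto_natCast_atTop_atTop.atTop_div_const two_pos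
    simp only [neg_div]
    exact tendsto_neg_atTop_atBot.comp this
  have ha : ∀ j, Tendsto (fun k => fderiv ℝ ψ (x k) (A (Pi.single j 1)) -
      inner ℝ (intVec p) (A (Pi.single j 1))) atTop (𝓝 0) := by
    intro j
    set β := logSection A (A (Pi.single j 1)) with hβ
    have h1 : ∀ k, fderiv ℝ ψ (x k) (A (Pi.single j 1)) - inner ℝ (intVec p) (A (Pi.single j 1)) =
        fderiv ℝ F (fun _ => c k) ((fun _ => c k) * β) := by
      intro k
      rw [← hw, h.fderiv_eq hA hF, hβ, logPt_logSection, logPt_logSection]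
    simp only [h1]
    have h2 : Continuous fun c : ℂ => fderiv ℝ F (fun _ => c) ((fun _ => c) * β) := by
      refine ((hF.continuous_fderiv (by simp)).comp (by fun_prop)).clm_apply ?_
      exact (continuous_pi fun _ => continuous_id).mul continuous_const
    have h3 := (h2.tendsto 0).comp hclim
    have h4 : (fun _ : Fin n => (0 : ℂ)) * β = 0 := by funext i; simp
    rw [h4, map_zero] at h3
    exact h3
  refine mem_closure_of_tendsto (f := fun k => gradient ψ (x k)) (b := atTop) ?_
    (Eventually.of_forall fun k => mem_range_self _)
  simp only [fun k => gradient_eq_add_sum hA ψ (x k)]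
  have h5 : Tendsto (fun k => ∑ j, (fderiv ℝ ψ (x k) (A (Pi.single j 1)) -
      inner ℝ (intVec p) (A (Pi.single j 1))) • intVec (P.edge p j)) atTop
      (𝓝 (∑ j, (0 : ℝ) • intVec (P.edge p j))) :=
    tendsto_finsetSum _ fun j _ => (ha j).smul_const _
  simpa using h5.const_add (intVec p)

end LocalPotential

namespace IsToricKahlerPotential

variable {n : ℕ} {P : DelzantPolytope n} {ψ : RSpace n → ℝ}

theorem contDiff (hψ : IsToricKahlerPotential P ψ) : ContDiff ℝ ∞ ψ := by
  obtain ⟨p, hp⟩ := P.vertices_nonempty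
  obtain ⟨F, hF, h, -⟩ := hψ p hp
  obtain ⟨A, hA⟩ := exists_chartFrame P hp
  exact h.contDiff hA hF

theorem hessian_pos (hψ : IsToricKahlerPotential P ψ) (x v : RSpace n) (hv : v ≠ 0) :
    0 < fderiv ℝ (fderiv ℝ ψ) x v v := by
  obtain ⟨p, hp⟩ := P.vertices_nonempty
  obtain ⟨F, hF, h, hpos⟩ := hψ p hp
  obtain ⟨A, hA⟩ := exists_chartFrame P hp
  exact h.hessian_pos hA hF hpos x v hv

theorem add_fderiv_lt (hψ : IsToricKahlerPotential P ψ) {x z : RSpace n} (h : x ≠ z) :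
    ψ x + fderiv ℝ ψ x (z - x) < ψ z :=
  add_fderiv_lt_of_hessian_pos hψ.contDiff hψ.hessian_pos h

theorem add_fderiv_le (hψ : IsToricKahlerPotential P ψ) (x z : RSpace n) :
    ψ x + fderiv ℝ ψ x (z - x) ≤ ψ z := by
  rcases eq_or_ne x z with rfl | h
  · simp
  · exact (hψ.add_fderiv_lt h).le

/-- The closure of the image of the moment map is the polytope. -/
theorem closure_range_gradient (hψ : IsToricKahlerPotential P ψ) :
    closure (range (gradient ψ)) = P.carrier := by
  apply Subset.antisymm
  · refine closure_minimal ?_ (isCompact_carrier P).isClosed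
    rintro _ ⟨x, rfl⟩
    refine mem_carrier_of_forall_cone P fun p hp => ?_
    obtain ⟨F, hF, h, -⟩ := hψ p hp
    obtain ⟨A, hA⟩ := exists_chartFrame P hp
    exact ⟨_, fun j => h.moment_nonneg hA hF hψ.add_fderiv_le x j, gradient_eq_add_sum hA ψ x⟩
  -- The closure of the gradient image is convex, so it suffices that it contains the vertices.
  · rw [← iUnion_subdiff_eq_range (hψ.contDiff.differentiable (by simp)) hψ.add_fderiv_le,
      P.carrier_eq]
    refine convexHull_min ?_ (convex_closure_subdiff (convexOn_of_add_fderiv_le hψ.add_fderiv_le))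
    rintro _ ⟨p, hp, rfl⟩
    rw [iUnion_subdiff_eq_range (hψ.contDiff.differentiable (by simp)) hψ.add_fderiv_le]
    obtain ⟨F, hF, h, -⟩ := hψ p hp
    obtain ⟨A, hA⟩ := exists_chartFrame P hp
    exact h.vertex_mem_closure hA hF

end IsToricKahlerPotential

/-! ### The Levi form as a bilinear form -/

/-- Multiplication by the imaginary unit. -/
def mulI (n : ℕ) : (Fin n → ℂ) →L[ℝ] (Fin n → ℂ) := ContinuousLinearMap.lsmul ℝ ℂ Complex.I

theorem mulI_apply {n : ℕ} (v : Fin n → ℂ) : mulI n v = Complex.I • v := rfl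

/-- The Levi form as a continuous bilinear form. -/
def leviCLM {n : ℕ} (F : (Fin n → ℂ) → ℝ) (w : Fin n → ℂ) :
    (Fin n → ℂ) →L[ℝ] (Fin n → ℂ) →L[ℝ] ℝ :=
  (4 : ℝ)⁻¹ • (fderiv ℝ (fderiv ℝ F) w + ContinuousLinearMap.flipₗᵢ ℝ (Fin n → ℂ) (Fin n → ℂ) ℝ
    ((ContinuousLinearMap.flipₗᵢ ℝ (Fin n → ℂ) (Fin n → ℂ) ℝ
      ((fderiv ℝ (fderiv ℝ F) w).comp (mulI n))).comp (mulI n)))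

theorem leviCLM_apply {n : ℕ} (F : (Fin n → ℂ) → ℝ) (w v u : Fin n → ℂ) :
    leviCLM F w v u = leviForm F w v u := by
  simp [leviCLM, leviForm, mulI_apply]
  ring

theorem contDiff_leviCLM {n : ℕ} {F : (Fin n → ℂ) → ℝ} (hF : ContDiff ℝ ∞ F) :
    ContDiff ℝ ∞ (leviCLM F) := by
  have h : ContDiff ℝ ∞ (fderiv ℝ (fderiv ℝ F)) :=
    (hF.fderiv_right (m := ∞) (by simp)).fderiv_right (m := ∞) (by simp)
  have hflip : ContDiff ℝ ∞ fun B : (Fin n → ℂ) →L[ℝ] (Fin n → ℂ) →L[ℝ] ℝ =>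
      ContinuousLinearMap.flipₗᵢ ℝ (Fin n → ℂ) (Fin n → ℂ) ℝ B :=
    LinearIsometryEquiv.contDiff _
  exact (h.add (hflip.comp
    ((hflip.comp (h.clm_comp contDiff_const)).clm_comp contDiff_const))).const_smul (4 : ℝ)⁻¹

theorem leviForm_symm {n : ℕ} {F : (Fin n → ℂ) → ℝ} (hF : ContDiff ℝ ∞ F) (w v u : Fin n → ℂ) :
    leviForm F w v u = leviForm F w u v := by
  have h := hF.contDiffAt.isSymmSndFDerivAt (x := w) (by simpa using ENat.LEInfty.out)
  rw [leviForm, leviForm, h v u, h (Complex.I • v) (Complex.I • u)]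

theorem continuous_leviForm {n : ℕ} {X : Type*} [TopologicalSpace X] {F : (Fin n → ℂ) → ℝ}
    (hF : ContDiff ℝ ∞ F) {w v u : X → Fin n → ℂ} (hw : Continuous w) (hv : Continuous v)
    (hu : Continuous u) : Continuous fun x => leviForm F (w x) (v x) (u x) := by
  simp only [← leviCLM_apply]
  exact (((contDiff_leviCLM hF).continuous.comp hw).clm_apply hv).clm_apply hu

theorem eq_of_eq_on_expPt {n : ℕ} {Y : Type*} [TopologicalSpace Y] [T2Space Y] {f g : (Fin n → ℂ) → Y}
    (hf : Continuous f) (hg : Continuous g) (h : ∀ z, f (expPt z) = g (expPt z)) (w : Fin n → ℂ) :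
    f w = g w :=
  congrFun (dense_range_expPt.equalizer hf hg (funext h)) w

theorem le_of_le_on_expPt {n : ℕ} {f g : (Fin n → ℂ) → ℝ} (hf : Continuous f) (hg : Continuous g)
    (h : ∀ z, f (expPt z) ≤ g (expPt z)) (w : Fin n → ℂ) : f w ≤ g w :=
  dense_range_expPt.induction_on (p := fun w => f w ≤ g w) w (isClosed_le hf hg) h

/-! ### Charts with toric Cauchy data -/

/-- A real vector as a complex vector. -/
def cvec {n : ℕ} : (Fin n → ℝ) →L[ℝ] (Fin n → ℂ) :=
  ContinuousLinearMap.pi fun j => Complex.ofRealCLM.comp (ContinuousLinearMap.proj j)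

theorem cvec_apply {n : ℕ} (a : Fin n → ℝ) (j : Fin n) : cvec a j = (a j : ℂ) := rfl

theorem two_smul_logSection {n : ℕ} (A : (Fin n → ℝ) ≃L[ℝ] RSpace n) (x : RSpace n) :
    (2 : ℝ) • logSection A x = cvec (A.symm x) := by
  funext j
  rw [Pi.smul_apply, logSection_apply, cvec_apply, Complex.real_smul]
  push_cast
  ring

theorem logPt_cvec {n : ℕ} (A : (Fin n → ℝ) ≃L[ℝ] RSpace n) (x : RSpace n) :
    logPt A (cvec (A.symm x)) = (2 : ℝ) • x := by
  rw [← two_smul_logSection, map_smul, logPt_logSection]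

theorem logPt_I_smul_cvec {n : ℕ} (A : (Fin n → ℝ) ≃L[ℝ] RSpace n) (a : Fin n → ℝ) :
    logPt A (Complex.I • cvec a) = 0 := by
  rw [logPt_apply, show (fun j => 2 * ((Complex.I • cvec a) j).re) = 0 from ?_, map_zero]
  funext j
  rw [Pi.smul_apply, cvec_apply, smul_eq_mul, Complex.I_mul_re, Complex.ofReal_im]
  simp

/-- The chart at a vertex together with the smooth extensions of Cauchy data, and of the velocity of
the characteristics in logarithmic coordinates. -/
structure ToricChart {n : ℕ} (P : DelzantPolytope n) (ψ₀ ψ₁ : RSpace n → ℝ) (p : Fin n → ℤ) where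
  frame : (Fin n → ℝ) ≃L[ℝ] RSpace n
  isChartFrame : IsChartFrame P p frame
  potential : (Fin n → ℂ) → ℝ
  contDiff_potential : ContDiff ℝ ∞ potential
  isLocalPotential : IsLocalPotential P p ψ₀ potential
  levi_pos : ∀ w v, v ≠ 0 → 0 < leviForm potential w v v
  speed : (Fin n → ℂ) → ℝ
  contDiff_speed : ContDiff ℝ ∞ speed
  speed_eq : ∀ z, speed (expPt z) = ψ₁ (logPt frame z)
  vel : (Fin n → ℂ) → (Fin n → ℝ)
  contDiff_vel : ContDiff ℝ ∞ vel
  vel_eq : ∀ z, vel (expPt z) = frame.symm (charVelocity ψ₀ ψ₁ (logPt frame z))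
  levi_vel : ∀ w u, leviForm potential w (w * cvec (vel w)) u = fderiv ℝ speed w u / 2

/-- The gradient of the speed with respect to the initial metric is smooth on the whole chart. On
the open orbit its components are `w_k` times a real torus-invariant function, so the division lemma
for radial factors extends the logarithmic velocity across the hyperplanes `w_k = 0`. -/
theorem exists_toricChart {n : ℕ} {P : DelzantPolytope n} {ψ₀ ψ₁ : RSpace n → ℝ}
    (hd : IsToricCauchyData P ψ₀ ψ₁) {p : Fin n → ℤ} (hp : p ∈ P.vertices) :
    Nonempty (ToricChart P ψ₀ ψ₁ p) := by
  obtain ⟨A, hA⟩ := exists_chartFrame P hp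
  obtain ⟨F, hF, hloc, hpos⟩ := hd.kahler p hp
  obtain ⟨S, hS, hS'⟩ := hd.smooth_toric p hp
  have hSz := (forall_overChart_iff hA).1 hS'
  have hposCLM : ∀ w v, v ≠ 0 → 0 < leviCLM F w v v := fun w v hv => by
    rw [leviCLM_apply]
    exact hpos w v hv
  have hinv : ∀ w, (leviCLM F w).IsInvertible := fun w => isInvertible_of_posDef (hposCLM w)
  set v : (Fin n → ℂ) → (Fin n → ℂ) := fun w => (leviCLM F w).inverse ((2 : ℝ)⁻¹ • fderiv ℝ S w)
    with hv
  have hvc : ContDiff ℝ ∞ v := by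
    have hS1 : ContDiff ℝ ∞ fun w => (2 : ℝ)⁻¹ • fderiv ℝ S w :=
      (hS.fderiv_right (m := ∞) (by simp)).const_smul _
    exact contDiff_inverse_apply (contDiff_leviCLM hF) hS1 hinv
  have hlevi : ∀ w u, leviForm F w (v w) u = fderiv ℝ S w u / 2 := by
    intro w u
    rw [← leviCLM_apply, hv]
    simp only
    rw [(hinv w).self_apply_inverse]
    simp
    ring
  -- Both sides are compared through the invertible Levi form. A real vector `cvec a` has vanishing
  -- rotated part and logarithmic coordinate `2 A a`, which turns the factor `1/4` into the required
  -- `1/2`.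
  have hvz : ∀ z, v (expPt z) = expPt z * cvec (A.symm (charVelocity ψ₀ ψ₁ (logPt A z))) := by
    intro z
    apply (hinv (expPt z)).injective
    refine ContinuousLinearMap.ext fun u => ?_
    obtain ⟨β, rfl⟩ := exists_mul_expPt z u
    rw [leviCLM_apply, hlevi, leviCLM_apply, hloc.leviForm_eq hA hF, logPt_I_smul_cvec, logPt_cvec,
      fderiv_chart hS hSz, ← hd.hessian_charVelocity]
    simp
    ring
  set logOf : (Fin n → ℂ) → RSpace n := fun w => A fun j => 2 * Real.log ‖w j‖ with hlogOf
  have hlogOfz : ∀ z, logOf (expPt z) = logPt A z := by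
    intro z
    rw [logPt_apply, hlogOf]
    simp only [expPt, Complex.norm_exp, Real.log_exp]
  have hD : Dense (univ.pi fun _ : Fin n => ({0}ᶜ : Set ℂ)) :=
    dense_pi univ fun _ _ => dense_compl_singleton 0
  -- The `k`-th component is viewed as a function of its own coordinate with the point `x` as
  -- parameter; the `k`-th entry of `x` is overwritten and plays no role.
  have hfac : ∀ k : Fin n, ∃ η : (Fin n → ℂ) × ℂ → ℝ, ContDiff ℝ ∞ η ∧
      (∀ x ∈ univ.pi fun _ : Fin n => ({0}ᶜ : Set ℂ), ∀ w, w ≠ 0 → η (x, w) =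
        A.symm (charVelocity ψ₀ ψ₁ (logOf (Function.update x k w))) k) ∧
      ∀ x w, v (Function.update x k w) k = w * η (x, w) := by
    intro k
    have hupd : ContDiff ℝ ∞ fun q : (Fin n → ℂ) × ℂ => Function.update q.1 k q.2 := by
      rw [contDiff_pi]
      intro i
      rcases eq_or_ne i k with rfl | hik
      · simpa using contDiff_snd
      · simp only [Function.update_of_ne hik]
        exact (contDiff_apply ℝ ℂ i).comp contDiff_fst
    refine exists_contDiff_radial_factor (v := fun q => v (Function.update q.1 k q.2) k)
      (ξ := fun q => A.symm (charVelocity ψ₀ ψ₁ (logOf (Function.update q.1 k q.2))) k)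
      ((contDiff_apply ℝ ℂ k).comp (hvc.comp hupd)) hD ?_ ?_
    · intro x hx w hw
      have hne : ∀ j, Function.update x k w j ≠ 0 := by
        intro j
        rcases eq_or_ne j k with rfl | hjk
        · simpa using hw
        · rw [Function.update_of_ne hjk]
          exact hx j (mem_univ j)
      obtain ⟨z, hz⟩ := exists_expPt hne
      simp only
      rw [hz, hvz, hlogOfz, Pi.mul_apply, cvec_apply, ← hz, Function.update_self]
    · intro x hx w hw
      have : logOf (Function.update x k w) = logOf (Function.update x k (‖w‖ : ℂ)) := by
        simp only [hlogOf]
        congr 1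
        funext j
        rcases eq_or_ne j k with rfl | hjk
        · simp
        · rw [Function.update_of_ne hjk, Function.update_of_ne hjk]
      simp only
      rw [this]
  choose η hη hηz hηv using hfac
  have hvel : ∀ w, v w = w * cvec fun k => η k (w, w k) := by
    intro w
    funext k
    have := hηv k w (w k)
    rw [Function.update_eq_self] at this
    rw [this]
    rfl
  refine ⟨⟨A, hA, F, hF, hloc, hpos, S, hS, hSz, fun w k => η k (w, w k), ?_, ?_, ?_⟩⟩
  · rw [contDiff_pi]
    exact fun k => (hη k).comp (contDiff_id.prodMk (contDiff_apply ℝ ℂ k))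
  · intro z
    funext k
    rw [hηz k _ (fun j _ => expPt_ne_zero z j) _ (expPt_ne_zero z k), Function.update_eq_self, hlogOfz]
  · intro w u
    rw [← hvel, hlevi]

/-- The velocity of the characteristics of toric Cauchy data is bounded, since it extends continuously
to the compact toric manifold. -/
theorem IsToricCauchyData.charVelocity_bounded {n : ℕ} {P : DelzantPolytope n} {ψ₀ ψ₁ : RSpace n → ℝ}
    (hd : IsToricCauchyData P ψ₀ ψ₁) : ∃ C : ℝ, ∀ x, ‖charVelocity ψ₀ ψ₁ x‖ ≤ C := by
  have h : ∀ p ∈ P.vertices, ∃ C : ℝ, ∀ x, (∀ j, inner ℝ (intVec (P.edge p j)) x ≤ 0) →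
      ‖charVelocity ψ₀ ψ₁ x‖ ≤ C := by
    intro p hp
    obtain ⟨c⟩ := exists_toricChart hd hp
    obtain ⟨C, hC⟩ := (isCompact_closedBall (0 : Fin n → ℂ) 1).exists_bound_of_continuousOn
      ((c.frame : (Fin n → ℝ) →L[ℝ] RSpace n).continuous.comp c.contDiff_vel.continuous).continuousOn
    refine ⟨C, fun x hx => ?_⟩
    have h1 := hC (expPt (logSection c.frame x)) (by
      rw [mem_closedBall_zero_iff, pi_norm_le_iff_of_nonneg zero_le_one]
      intro j
      rw [expPt, Complex.norm_exp, logSection_apply, Complex.ofReal_re, Real.exp_le_one_iff]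
      have := c.isChartFrame (c.frame.symm x) j
      rw [c.frame.apply_symm_apply] at this
      have h2 := hx j
      linarith)
    simpa [c.vel_eq, logPt_logSection] using h1
  choose! C hC using h
  refine ⟨∑ p ∈ P.vertices, |C p|, fun x => ?_⟩
  obtain ⟨p, hp, hx⟩ := exists_vertex_inner_nonpos P x
  exact (hC p hp x hx).trans ((le_abs_self _).trans
    (Finset.single_le_sum (f := fun p => |C p|) (fun _ _ => abs_nonneg _) hp))

theorem hasDerivAt_expPt_comp {n : ℕ} {c : ℝ → Fin n → ℂ} {c' : Fin n → ℂ} {t : ℝ}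
    (hc : HasDerivAt c c' t) : HasDerivAt (fun t => expPt (c t)) (expPt (c t) * c') t := by
  rw [hasDerivAt_pi] at hc ⊢
  intro j
  exact (Complex.hasDerivAt_exp (c t j)).comp t (hc j)

theorem logPt_eq_of_expPt_eq {n : ℕ} (A : (Fin n → ℝ) ≃L[ℝ] RSpace n) {z z' : Fin n → ℂ}
    (h : expPt z = expPt z') : logPt A z = logPt A z' := by
  rw [logPt_apply, logPt_apply]
  congr 1
  funext j
  have := congrArg (fun w : Fin n → ℂ => ‖w j‖) h
  simp only [expPt, Complex.norm_exp] at this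
  rw [Real.exp_injective this]

/-! ### The characteristic flow on a chart -/

namespace ToricChart

variable {n : ℕ} {P : DelzantPolytope n} {ψ₀ ψ₁ : RSpace n → ℝ} {p : Fin n → ℤ}

/-- The flow along characteristics in the chart. -/
def flow (c : ToricChart P ψ₀ ψ₁ p) (q : ℝ × (Fin n → ℂ)) : Fin n → ℂ :=
  q.2 * expPt (-(q.1 / 2) • cvec (c.vel q.2))

theorem contDiff_flow (c : ToricChart P ψ₀ ψ₁ p) : ContDiff ℝ ∞ c.flow := by
  have h1 : ContDiff ℝ ∞ fun q : ℝ × (Fin n → ℂ) => cvec (c.vel q.2) :=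
    (cvec (n := n)).contDiff.comp (c.contDiff_vel.comp contDiff_snd)
  have h2 : ContDiff ℝ ∞ fun q : ℝ × (Fin n → ℂ) => -(q.1 / 2) :=
    (contDiff_fst.div_const 2).neg
  exact contDiff_snd.mul (contDiff_expPt.comp (h2.smul h1))

theorem contDiff_flow_slice (c : ToricChart P ψ₀ ψ₁ p) (s : ℝ) :
    ContDiff ℝ ∞ fun w => c.flow (s, w) :=
  c.contDiff_flow.comp (contDiff_const.prodMk contDiff_id)

theorem vel_expPt (c : ToricChart P ψ₀ ψ₁ p) (z : Fin n → ℂ) :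
    cvec (c.vel (expPt z)) = (2 : ℝ) • logSection c.frame (charVelocity ψ₀ ψ₁ (logPt c.frame z)) := by
  rw [c.vel_eq, two_smul_logSection]

/-- Only real logarithmic parts are translated, so the chart flow covers `charFlow` and preserves
angles. The factor `1/2` in the exponent comes from `|w_j|² = exp⟨·,x⟩`. -/
theorem flow_expPt (c : ToricChart P ψ₀ ψ₁ p) (s : ℝ) (z : Fin n → ℂ) :
    c.flow (s, expPt z) =
      expPt (z - s • logSection c.frame (charVelocity ψ₀ ψ₁ (logPt c.frame z))) := by
  rw [flow, c.vel_expPt]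
  funext j
  simp only [Pi.mul_apply, expPt]
  rw [← Complex.exp_add]
  congr 1
  simp only [Pi.smul_apply, Pi.sub_apply, Complex.real_smul]
  push_cast
  ring

theorem logPt_flow (c : ToricChart P ψ₀ ψ₁ p) (s : ℝ) (z : Fin n → ℂ) :
    logPt c.frame (z - s • logSection c.frame (charVelocity ψ₀ ψ₁ (logPt c.frame z))) =
      charFlow ψ₀ ψ₁ (s, logPt c.frame z) := by
  rw [map_sub, map_smul, logPt_logSection, charFlow]

/-- The linearized flow in logarithmic coordinates. -/
def linFlow (c : ToricChart P ψ₀ ψ₁ p) (s : ℝ) (z α : Fin n → ℂ) : Fin n → ℂ :=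
  α - s • logSection c.frame
    (fderiv ℝ (charVelocity ψ₀ ψ₁) (logPt c.frame z) (logPt c.frame α))

theorem logPt_linFlow (c : ToricChart P ψ₀ ψ₁ p) (s : ℝ) (z α : Fin n → ℂ) :
    logPt c.frame (c.linFlow s z α) = logPt c.frame α -
      s • fderiv ℝ (charVelocity ψ₀ ψ₁) (logPt c.frame z) (logPt c.frame α) := by
  rw [linFlow, map_sub, map_smul, logPt_logSection]

theorem logPt_I_smul_linFlow (c : ToricChart P ψ₀ ψ₁ p) (s : ℝ) (z α : Fin n → ℂ) :
    logPt c.frame (Complex.I • c.linFlow s z α) = logPt c.frame (Complex.I • α) := by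
  have h : ∀ v : Fin n → ℂ, logPt c.frame (s • v) = s • logPt c.frame v := map_smul _ s
  rw [linFlow, smul_sub, map_sub, smul_comm, h, logPt_I_smul_logSection, smul_zero, sub_zero]

theorem fderiv_flow (c : ToricChart P ψ₀ ψ₁ p) (hd : IsToricCauchyData P ψ₀ ψ₁) (s : ℝ)
    (z α : Fin n → ℂ) : fderiv ℝ (fun w => c.flow (s, w)) (expPt z) (expPt z * α) =
      c.flow (s, expPt z) * c.linFlow s z α := by
  have h1 : HasDerivAt (fun t : ℝ => c.flow (s, expPt (z + t • α)))
      (fderiv ℝ (fun w => c.flow (s, w)) (expPt z) (expPt z * α)) 0 :=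
    ((c.contDiff_flow_slice s).differentiable (by simp) (expPt z)).hasFDerivAt.comp_hasDerivAt_of_eq 0
      (hasDerivAt_expPt_line z α) (by simp)
  have h2 : HasDerivAt (fun t : ℝ => charVelocity ψ₀ ψ₁ (logPt c.frame z + t • logPt c.frame α))
      (fderiv ℝ (charVelocity ψ₀ ψ₁) (logPt c.frame z) (logPt c.frame α)) 0 :=
    (hd.contDiff_charVelocity.differentiable (by simp)
      (logPt c.frame z)).hasFDerivAt.comp_hasDerivAt_of_eq 0 (hasDerivAt_line _ _) (by simp)
  have h3 := (hasDerivAt_line z α).sub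
    (((logSection c.frame).hasFDerivAt.comp_hasDerivAt 0 h2).const_smul s)
  have h4 := hasDerivAt_expPt_comp h3
  have h5 := h1.unique (h4.congr_of_eventuallyEq (Eventually.of_forall fun t => by
    simp only
    rw [c.flow_expPt, map_add, map_smul]
    rfl))
  rw [h5, c.flow_expPt, linFlow]
  simp

theorem exp_mul_flow (c : ToricChart P ψ₀ ψ₁ p) (s : ℝ) (w : Fin n → ℂ) :
    expPt ((s / 2) • cvec (c.vel w)) * c.flow (s, w) = w := by
  rw [flow, mul_left_comm]
  have : expPt ((s / 2) • cvec (c.vel w)) * expPt (-(s / 2) • cvec (c.vel w)) = 1 := by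
    funext j
    simp only [Pi.mul_apply, expPt, Pi.smul_apply, Pi.one_apply, ← Complex.exp_add, ← add_smul]
    simp
  simp only
  rw [this, mul_one]

theorem flow_ne_zero_iff (c : ToricChart P ψ₀ ψ₁ p) (s : ℝ) (w : Fin n → ℂ) (j : Fin n) :
    c.flow (s, w) j ≠ 0 ↔ w j ≠ 0 := by
  rw [flow, Pi.mul_apply, mul_ne_zero_iff]
  exact and_iff_left (expPt_ne_zero _ j)

/-- The linearized flow is positive with respect to the initial metric. -/
theorem levi_fderiv_flow_ge (c : ToricChart P ψ₀ ψ₁ p) (hd : IsToricCauchyData P ψ₀ ψ₁) {s : ℝ}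
    (hs : IsSubcritical P.carrier ψ₀ ψ₁ s) : ∃ δ > 0, ∀ w v, δ * leviForm c.potential w v v ≤
      leviForm c.potential w (expPt ((s / 2) • cvec (c.vel w)) *
        fderiv ℝ (fun w => c.flow (s, w)) w v) v := by
  obtain ⟨δ, hδ, h⟩ := hd.hessian_fderiv_charFlow_ge hs
  -- The radial part of the Levi form is bounded below with constant `δ`; the angular part is
  -- unchanged by the flow and contributes the constant `1`.
  refine ⟨min δ 1, lt_min hδ one_pos, ?_⟩
  have key : ∀ z α, min δ 1 * leviForm c.potential (expPt z) (expPt z * α) (expPt z * α) ≤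
      leviForm c.potential (expPt z) (expPt ((s / 2) • cvec (c.vel (expPt z))) *
        fderiv ℝ (fun w => c.flow (s, w)) (expPt z) (expPt z * α)) (expPt z * α) := by
    intro z α
    rw [c.fderiv_flow hd, ← mul_assoc, c.exp_mul_flow,
      c.isLocalPotential.leviForm_eq c.isChartFrame c.contDiff_potential,
      c.isLocalPotential.leviForm_eq c.isChartFrame c.contDiff_potential, logPt_I_smul_linFlow,
      logPt_linFlow]
    have h1 := h (logPt c.frame z) (logPt c.frame α)
    rw [hd.hessian_symm _ (logPt c.frame α) (_ - _)] at h1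
    have hnn : ∀ x v, 0 ≤ fderiv ℝ (fderiv ℝ ψ₀) x v v := fun x v => by
      rcases eq_or_ne v 0 with rfl | hv
      · simp
      · exact (hd.hessian_pos x v hv).le
    have h2 := mul_le_mul_of_nonneg_right (min_le_left δ 1) (hnn (logPt c.frame z) (logPt c.frame α))
    have h3 := mul_le_mul_of_nonneg_right (min_le_right δ 1)
      (hnn (logPt c.frame z) (logPt c.frame (Complex.I • α)))
    linarith
  intro w v
  have hfd : Continuous fun w => fderiv ℝ (fun w => c.flow (s, w)) w v :=
    ((c.contDiff_flow_slice s).continuous_fderiv (by simp)).clm_apply continuous_const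
  have hexp : Continuous fun w => expPt ((s / 2) • cvec (c.vel w)) :=
    contDiff_expPt.continuous.comp
      (((cvec (n := n)).continuous.comp c.contDiff_vel.continuous).const_smul (s / 2))
  refine le_of_le_on_expPt (f := fun w => min δ 1 * leviForm c.potential w v v)
    (g := fun w => leviForm c.potential w (expPt ((s / 2) • cvec (c.vel w)) *
      fderiv ℝ (fun w => c.flow (s, w)) w v) v) ?_ ?_ ?_ w
  · exact continuous_const.mul (continuous_leviForm c.contDiff_potential continuous_id
      continuous_const continuous_const)
  · exact continuous_leviForm c.contDiff_potential continuous_id (hexp.mul hfd) continuous_const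
  · intro z
    obtain ⟨α, rfl⟩ := exists_mul_expPt z v
    exact key z α

theorem isInvertible_fderiv_flow (c : ToricChart P ψ₀ ψ₁ p) (hd : IsToricCauchyData P ψ₀ ψ₁) {s : ℝ}
    (hs : IsSubcritical P.carrier ψ₀ ψ₁ s) (w : Fin n → ℂ) :
    (fderiv ℝ (fun w => c.flow (s, w)) w).IsInvertible := by
  apply isInvertible_of_injective rfl
  intro v hv
  obtain ⟨δ, hδ, h⟩ := c.levi_fderiv_flow_ge hd hs
  by_contra hne
  have h1 := h w v
  have h2 := mul_pos hδ (c.levi_pos w v hne)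
  rw [hv, mul_zero] at h1
  rw [← leviCLM_apply _ _ 0, map_zero] at h1
  simp at h1
  linarith

/-- Injectivity of `charFlow` recovers the moduli. The two points then have equal velocity, and
undoing the common factor recovers the angles. -/
theorem flow_injective_expPt (c : ToricChart P ψ₀ ψ₁ p) (hd : IsToricCauchyData P ψ₀ ψ₁) {s : ℝ}
    (hs : IsSubcritical P.carrier ψ₀ ψ₁ s) {z z' : Fin n → ℂ}
    (h : c.flow (s, expPt z) = c.flow (s, expPt z')) : expPt z = expPt z' := by
  have h1 := h
  rw [c.flow_expPt, c.flow_expPt] at h1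
  have h2 := logPt_eq_of_expPt_eq c.frame h1
  rw [c.logPt_flow, c.logPt_flow] at h2
  have h3 := hd.charFlow_injective hs h2
  have h4 := c.exp_mul_flow s (expPt z)
  have h5 := c.exp_mul_flow s (expPt z')
  rw [← h4, ← h5, h, c.vel_expPt, c.vel_expPt, h3]

/-- Unlike on `ℝⁿ`, properness is immediate here, because the logarithmic velocity is bounded on the
compact manifold. Injectivity is inherited from the open orbit by density. -/
theorem flow_bijective (c : ToricChart P ψ₀ ψ₁ p) (hd : IsToricCauchyData P ψ₀ ψ₁) {s : ℝ}
    (hs : IsSubcritical P.carrier ψ₀ ψ₁ s) : Function.Bijective fun w => c.flow (s, w) := by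
  have hmap : ∀ w, map (fun w => c.flow (s, w)) (𝓝 w) = 𝓝 (c.flow (s, w)) := fun w =>
    map_nhds_eq_of_isInvertible (c.contDiff_flow_slice s) (c.isInvertible_fderiv_flow hd hs w)
  constructor
  · intro a b hab
    simp only at hab
    by_contra hne
    -- Disjoint neighborhoods of two points with the same image are mapped onto neighborhoods of
    -- that image. A common value in the dense orbit would have two preimages, both in the orbit
    -- since the flow preserves nonvanishing of coordinates.
    obtain ⟨U, V, hU, hV, haU, hbV, hUV⟩ := t2_separation hne
    have h1 : (fun w => c.flow (s, w)) '' U ∈ 𝓝 (c.flow (s, a)) := by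
      rw [← hmap]
      exact image_mem_map (hU.mem_nhds haU)
    have h2 : (fun w => c.flow (s, w)) '' V ∈ 𝓝 (c.flow (s, a)) := by
      rw [hab, ← hmap]
      exact image_mem_map (hV.mem_nhds hbV)
    obtain ⟨_, ⟨z, rfl⟩, ⟨a', ha', haw⟩, ⟨b', hb', hbw⟩⟩ :=
      dense_range_expPt.inter_nhds_nonempty (inter_mem h1 h2)
    simp only at haw hbw
    obtain ⟨za, hza⟩ := exists_expPt (w := a') fun j =>
      (c.flow_ne_zero_iff s a' j).1 (by rw [haw]; exact expPt_ne_zero z j)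
    obtain ⟨zb, hzb⟩ := exists_expPt (w := b') fun j =>
      (c.flow_ne_zero_iff s b' j).1 (by rw [hbw]; exact expPt_ne_zero z j)
    have h3 : a' = b' := by
      rw [hza, hzb]
      apply c.flow_injective_expPt hd hs
      rw [← hza, ← hzb, haw, hbw]
    exact disjoint_left.1 hUV ha' (h3 ▸ hb')
  · refine surjective_of_map_nhds_of_proper (c.contDiff_flow_slice s).continuous hmap fun R => ?_
    obtain ⟨C, hC⟩ := hd.charVelocity_bounded
    set K : ℝ := ‖(c.frame.symm : RSpace n →L[ℝ] (Fin n → ℝ))‖ * C with hK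
    have hvel : ∀ w, ‖c.vel w‖ ≤ K := by
      intro w
      refine le_of_le_on_expPt (f := fun w => ‖c.vel w‖) c.contDiff_vel.continuous.norm
        continuous_const (fun z => ?_) w
      rw [c.vel_eq]
      exact ((c.frame.symm : RSpace n →L[ℝ] (Fin n → ℝ)).le_opNorm _).trans
        (mul_le_mul_of_nonneg_left (hC _) (norm_nonneg _))
    refine ⟨Real.exp (s / 2 * K) * R, fun w hw => ?_⟩
    have hR : 0 ≤ R := (norm_nonneg _).trans hw
    rw [pi_norm_le_iff_of_nonneg (by positivity)]
    intro j
    have h1 := congrFun (c.exp_mul_flow s w) j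
    rw [← h1, Pi.mul_apply, norm_mul]
    refine mul_le_mul ?_ ((norm_le_pi_norm _ j).trans hw) (norm_nonneg _) (Real.exp_pos _).le
    rw [expPt, Complex.norm_exp, Real.exp_le_exp, Pi.smul_apply, cvec_apply, Complex.real_smul,
      ← Complex.ofReal_mul, Complex.ofReal_re]
    have h2 : c.vel w j ≤ K := (le_abs_self _).trans ((norm_le_pi_norm (c.vel w) j).trans (hvel w))
    have := hs.1
    exact mul_le_mul_of_nonneg_left h2 (by positivity)

/-- The evolved potential, pulled back by the flow. -/
def pulledPotential (c : ToricChart P ψ₀ ψ₁ p) (q : ℝ × (Fin n → ℂ)) : ℝ :=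
  c.potential q.2 + q.1 * c.speed q.2 -
    q.1 / 2 * fderiv ℝ c.potential q.2 (q.2 * cvec (c.vel q.2))

theorem contDiff_pulledPotential (c : ToricChart P ψ₀ ψ₁ p) : ContDiff ℝ ∞ c.pulledPotential := by
  have h1 : ContDiff ℝ ∞ fun q : ℝ × (Fin n → ℂ) => cvec (c.vel q.2) :=
    (cvec (n := n)).contDiff.comp (c.contDiff_vel.comp contDiff_snd)
  refine ((c.contDiff_potential.comp contDiff_snd).add
    (contDiff_fst.mul (c.contDiff_speed.comp contDiff_snd))).sub
    ((contDiff_fst.div_const 2).mul (ContDiff.clm_apply ?_ (contDiff_snd.mul h1)))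
  exact (c.contDiff_potential.fderiv_right (m := ∞) (by simp)).comp contDiff_snd

/-- The derivative of the potential along `w * cvec (c.vel w)` is twice the derivative of `ψ₀ -
⟨p,·⟩` along the characteristic velocity. With the coefficient `s / 2` the formula becomes the
supporting function at the endpoint. -/
theorem pulledPotential_expPt (c : ToricChart P ψ₀ ψ₁ p) (hd : IsToricCauchyData P ψ₀ ψ₁) {s : ℝ}
    (hs : IsSubcritical P.carrier ψ₀ ψ₁ s) (z : Fin n → ℂ) :
    c.pulledPotential (s, expPt z) = envelope ψ₀ ψ₁ (s, charFlow ψ₀ ψ₁ (s, logPt c.frame z)) -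
      inner ℝ (intVec p) (charFlow ψ₀ ψ₁ (s, logPt c.frame z)) := by
  rw [hd.envelope_charFlow hs, pulledPotential, c.vel_expPt,
    c.isLocalPotential.fderiv_eq c.isChartFrame c.contDiff_potential, map_smul, logPt_logSection,
    (isLocalPotential_iff c.isChartFrame).1 c.isLocalPotential, c.speed_eq]
  simp only [charSupport, charFlow, sub_sub_cancel_left, map_neg, map_smul, inner_sub_right,
    real_inner_smul_right, smul_eq_mul]
  ring

end ToricChart

/-! ### The evolved metric in a chart -/

/-- A nonnegative symmetric bilinear form vanishes on the kernel of its quadratic form. -/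
theorem eq_zero_of_apply_self_eq_zero {V : Type*} [NormedAddCommGroup V] [NormedSpace ℝ V]
    {B : V →L[ℝ] V →L[ℝ] ℝ} (hsymm : ∀ v u, B v u = B u v) (hnn : ∀ v, 0 ≤ B v v) {v : V}
    (hv : B v v = 0) (u : V) : B v u = 0 := by
  by_contra hne
  -- A near-optimal test vector; the added `1` keeps the denominator positive even if `B u u = 0`.
  have h := hnn (v - (B v u / (B u u + 1)) • u)
  have hu := hnn u
  simp only [map_sub, map_smul, _root_.sub_apply, _root_.smul_apply, smul_eq_mul, hv, hsymm u v] at h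
  have h2 : 0 - B v u / (B u u + 1) * B v u -
      B v u / (B u u + 1) * (B v u - B v u / (B u u + 1) * B u u) =
      -((B v u) ^ 2 * (B u u + 2) / (B u u + 1) ^ 2) := by
    field_simp
    ring
  have h3 : 0 < (B v u) ^ 2 * (B u u + 2) / (B u u + 1) ^ 2 := by positivity
  linarith

theorem hasDerivWithinAt_comp_curve {E F : Type*} [NormedAddCommGroup E] [NormedSpace ℝ E]
    [NormedAddCommGroup F] [NormedSpace ℝ F] {f : ℝ × E → F} {L : ℝ × E →L[ℝ] F} {s : ℝ} {x : E}
    {I : Set ℝ} {g : ℝ → E} {g' : E} (hf : HasFDerivWithinAt f L (I ×ˢ univ) (s, x))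
    (hg : HasDerivWithinAt g g' I s) (hx : x = g s) :
    HasDerivWithinAt (fun r => f (r, g r)) (L (1, g')) I s := by
  subst hx
  have h : HasDerivWithinAt (fun r => (r, g r)) ((1 : ℝ), g') I s := (hasDerivWithinAt_id s I).prodMk hg
  exact hf.comp_hasDerivWithinAt s h fun r hr => (⟨hr, mem_univ _⟩ : (r, g r) ∈ I ×ˢ univ)

theorem hasFDerivAt_slice_of_hasFDerivWithinAt {E F : Type*} [NormedAddCommGroup E] [NormedSpace ℝ E]
    [NormedAddCommGroup F] [NormedSpace ℝ F] {f : ℝ × E → F} {L : ℝ × E →L[ℝ] F} {s : ℝ} {x : E}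
    {I : Set ℝ} (hs : s ∈ I) (hf : HasFDerivWithinAt f L (I ×ˢ univ) (s, x)) :
    HasFDerivAt (fun z => f (s, z)) (L.comp (ContinuousLinearMap.inr ℝ ℝ E)) x := by
  have h2 : HasFDerivWithinAt (fun z : E => (s, z)) (ContinuousLinearMap.inr ℝ ℝ E) univ x :=
    (hasFDerivAt_prodMk_right s x).hasFDerivWithinAt
  have h3 := hf.comp x h2 fun z _ => ⟨hs, mem_univ _⟩
  rwa [hasFDerivWithinAt_univ] at h3

/-! ### The Hessian of the envelope along characteristics -/

namespace IsCauchyData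

variable {n : ℕ} {P : Set (RSpace n)} {ψ₀ ψ₁ : RSpace n → ℝ}

theorem contDiff_envelope_slice (hd : IsCauchyData P ψ₀ ψ₁) (hP : Bornology.IsBounded P) {s : ℝ}
    (hs : IsSubcritical P ψ₀ ψ₁ s) : ContDiff ℝ ∞ fun x => envelope ψ₀ ψ₁ (s, x) := by
  have h := hd.contDiffOn_envelope hP (I := {s}) (by rintro _ rfl; exact hs)
  exact h.comp_contDiff (contDiff_const.prodMk contDiff_id) fun x => ⟨rfl, mem_univ _⟩

/-- The Hessian is transported by the characteristics. -/
theorem hessian_envelope (hd : IsCauchyData P ψ₀ ψ₁) (hP : Bornology.IsBounded P) {s : ℝ}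
    (hs : IsSubcritical P ψ₀ ψ₁ s) (x a : RSpace n) :
    fderiv ℝ (fderiv ℝ fun z => envelope ψ₀ ψ₁ (s, z)) (charFlow ψ₀ ψ₁ (s, x))
      (a - s • fderiv ℝ (charVelocity ψ₀ ψ₁) x a) = fderiv ℝ (fderiv ℝ ψ₀) x a := by
  have h1 : Differentiable ℝ (fderiv ℝ fun z => envelope ψ₀ ψ₁ (s, z)) :=
    ((hd.contDiff_envelope_slice hP hs).fderiv_right (m := ∞) (by simp)).differentiable (by simp)
  have h2 := (h1 (charFlow ψ₀ ψ₁ (s, x))).hasFDerivAt.comp x (hd.hasFDerivAt_charFlow s x)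
  have h3 := h2.unique ((hd.hasFDerivAt_fderiv x).congr_of_eventuallyEq (Eventually.of_forall
    fun z => (hd.hasFDerivAt_envelope_slice hP hs z).fderiv))
  have h4 := congrArg (fun L => L a) h3
  simpa using h4

theorem hessian_nonneg (hd : IsCauchyData P ψ₀ ψ₁) (x v : RSpace n) :
    0 ≤ fderiv ℝ (fderiv ℝ ψ₀) x v v := by
  rcases eq_or_ne v 0 with rfl | hv
  · simp
  · exact (hd.hessian_pos x v hv).le

theorem hessian_envelope_nonneg (hd : IsCauchyData P ψ₀ ψ₁) (hP : Bornology.IsBounded P) {s : ℝ}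
    (hs : IsSubcritical P ψ₀ ψ₁ s) (x v : RSpace n) :
    0 ≤ fderiv ℝ (fderiv ℝ fun z => envelope ψ₀ ψ₁ (s, z)) x v v := by
  obtain ⟨x, rfl⟩ := (hd.charFlow_bijective hP hs).2 x
  obtain ⟨e, he⟩ := hd.isInvertible_fderiv_charFlow hs x
  have hev : ∀ a, e a = a - s • fderiv ℝ (charVelocity ψ₀ ψ₁) x a := fun a => by
    have h := congrArg (fun L => L a) he
    rw [(hd.hasFDerivAt_charFlow s x).fderiv] at h
    simpa using h
  obtain ⟨a, rfl⟩ := e.surjective v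
  obtain ⟨c, hc, h⟩ := hd.hessian_fderiv_charFlow_ge hs
  simp only [hev]
  rw [hd.hessian_envelope hP hs]
  exact (mul_nonneg hc.le (hd.hessian_nonneg x a)).trans (h x a)

end IsCauchyData

/-! ### The evolved potential and the geodesic equation -/

namespace ToricChart

variable {n : ℕ} {P : DelzantPolytope n} {ψ₀ ψ₁ : RSpace n → ℝ} {p : Fin n → ℤ}

/-- The inverse of the flow. -/
def invFlow (c : ToricChart P ψ₀ ψ₁ p) (q : ℝ × (Fin n → ℂ)) : Fin n → ℂ :=
  Function.invFun (fun w => c.flow (q.1, w)) q.2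

/-- The evolved local potential. -/
def evolved (c : ToricChart P ψ₀ ψ₁ p) (q : ℝ × (Fin n → ℂ)) : ℝ :=
  c.pulledPotential (q.1, c.invFlow q)

theorem flow_invFlow (c : ToricChart P ψ₀ ψ₁ p) (hd : IsToricCauchyData P ψ₀ ψ₁) {s : ℝ}
    (hs : IsSubcritical P.carrier ψ₀ ψ₁ s) (w : Fin n → ℂ) : c.flow (s, c.invFlow (s, w)) = w :=
  Function.rightInverse_invFun (c.flow_bijective hd hs).2 w

theorem invFlow_flow (c : ToricChart P ψ₀ ψ₁ p) (hd : IsToricCauchyData P ψ₀ ψ₁) {s : ℝ}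
    (hs : IsSubcritical P.carrier ψ₀ ψ₁ s) (w : Fin n → ℂ) : c.invFlow (s, c.flow (s, w)) = w :=
  Function.leftInverse_invFun (c.flow_bijective hd hs).1 w

theorem contDiffOn_invFlow (c : ToricChart P ψ₀ ψ₁ p) (hd : IsToricCauchyData P ψ₀ ψ₁) {I : Set ℝ}
    (hI : ∀ s ∈ I, IsSubcritical P.carrier ψ₀ ψ₁ s) : ContDiffOn ℝ ∞ c.invFlow (I ×ˢ univ) := by
  obtain ⟨Ψ, hΨ, hr, -⟩ := contDiffOn_inverse_of_bijective c.contDiff_flow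
    (fun s hs w => c.isInvertible_fderiv_flow hd (hI s hs) w)
    (fun s hs => c.flow_bijective hd (hI s hs))
  refine hΨ.congr ?_
  rintro ⟨s, w⟩ ⟨hs, -⟩
  apply (c.flow_bijective hd (hI s hs)).1
  simp only
  rw [hr s hs, c.flow_invFlow hd (hI s hs)]

theorem contDiffOn_evolved (c : ToricChart P ψ₀ ψ₁ p) (hd : IsToricCauchyData P ψ₀ ψ₁) {I : Set ℝ}
    (hI : ∀ s ∈ I, IsSubcritical P.carrier ψ₀ ψ₁ s) : ContDiffOn ℝ ∞ c.evolved (I ×ˢ univ) :=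
  c.contDiff_pulledPotential.comp_contDiffOn
    (contDiff_fst.contDiffOn.prodMk (c.contDiffOn_invFlow hd hI))

theorem evolved_flow (c : ToricChart P ψ₀ ψ₁ p) (hd : IsToricCauchyData P ψ₀ ψ₁) {s : ℝ}
    (hs : IsSubcritical P.carrier ψ₀ ψ₁ s) (w : Fin n → ℂ) :
    c.evolved (s, c.flow (s, w)) = c.pulledPotential (s, w) := by
  rw [evolved, c.invFlow_flow hd hs]

theorem contDiff_evolved_slice (c : ToricChart P ψ₀ ψ₁ p) (hd : IsToricCauchyData P ψ₀ ψ₁) {s : ℝ}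
    (hs : IsSubcritical P.carrier ψ₀ ψ₁ s) : ContDiff ℝ ∞ fun w => c.evolved (s, w) :=
  (c.contDiffOn_evolved hd (I := {s}) (by rintro _ rfl; exact hs)).comp_contDiff
    (contDiff_const.prodMk contDiff_id) fun _ => ⟨rfl, mem_univ _⟩

theorem isLocalPotential_evolved (c : ToricChart P ψ₀ ψ₁ p) (hd : IsToricCauchyData P ψ₀ ψ₁) {s : ℝ}
    (hs : IsSubcritical P.carrier ψ₀ ψ₁ s) :
    IsLocalPotential P p (fun x => envelope ψ₀ ψ₁ (s, x)) fun w => c.evolved (s, w) := by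
  rw [isLocalPotential_iff c.isChartFrame]
  intro z'
  obtain ⟨w, hw⟩ := (c.flow_bijective hd hs).2 (expPt z')
  simp only at hw
  obtain ⟨z, rfl⟩ := exists_expPt (w := w) fun j =>
    (c.flow_ne_zero_iff s w j).1 (by rw [hw]; exact expPt_ne_zero z' j)
  have h1 := hw
  rw [c.flow_expPt] at h1
  rw [← hw, c.evolved_flow hd hs, c.pulledPotential_expPt hd hs,
    ← c.logPt_flow, logPt_eq_of_expPt_eq c.frame h1]

theorem hasFDerivAt_flow_slice (c : ToricChart P ψ₀ ψ₁ p) (s : ℝ) (w : Fin n → ℂ) :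
    HasFDerivAt (fun w => c.flow (s, w)) (fderiv ℝ (fun w => c.flow (s, w)) w) w :=
  ((c.contDiff_flow_slice s).differentiable (by simp) w).hasFDerivAt

theorem continuous_fderiv_flow (c : ToricChart P ψ₀ ψ₁ p) (s : ℝ) (u : Fin n → ℂ) :
    Continuous fun w => fderiv ℝ (fun w => c.flow (s, w)) w u :=
  ((c.contDiff_flow_slice s).continuous_fderiv (by simp)).clm_apply continuous_const

/-- The flow is symplectic. -/
theorem levi_I_smul_fderiv_flow (c : ToricChart P ψ₀ ψ₁ p) (hd : IsToricCauchyData P ψ₀ ψ₁) {s : ℝ}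
    (hs : IsSubcritical P.carrier ψ₀ ψ₁ s) (w v u : Fin n → ℂ) :
    leviForm (fun w => c.evolved (s, w)) (c.flow (s, w))
      (Complex.I • fderiv ℝ (fun w => c.flow (s, w)) w v) (fderiv ℝ (fun w => c.flow (s, w)) w u) =
      leviForm c.potential w (Complex.I • v) u := by
  have hP := (isCompact_carrier P).isBounded
  refine eq_of_eq_on_expPt (f := fun w => leviForm (fun w => c.evolved (s, w)) (c.flow (s, w))
      (Complex.I • fderiv ℝ (fun w => c.flow (s, w)) w v) (fderiv ℝ (fun w => c.flow (s, w)) w u))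
    (g := fun w => leviForm c.potential w (Complex.I • v) u) ?_ ?_ (fun z => ?_) w
  · exact continuous_leviForm (c.contDiff_evolved_slice hd hs) (c.contDiff_flow_slice s).continuous
      ((c.continuous_fderiv_flow s v).const_smul Complex.I) (c.continuous_fderiv_flow s u)
  · exact continuous_leviForm c.contDiff_potential continuous_id continuous_const continuous_const
  · obtain ⟨α, rfl⟩ := exists_mul_expPt z v
    obtain ⟨β, rfl⟩ := exists_mul_expPt z u
    have hII : ∀ v : Fin n → ℂ, Complex.I • Complex.I • v = -v := fun v => by
      rw [smul_smul, Complex.I_mul_I, neg_one_smul]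
    have hsymm : ∀ x a b, fderiv ℝ (fderiv ℝ fun x => envelope ψ₀ ψ₁ (s, x)) x a b =
        fderiv ℝ (fderiv ℝ fun x => envelope ψ₀ ψ₁ (s, x)) x b a := fun x a b =>
      (hd.contDiff_envelope_slice hP hs).contDiffAt.isSymmSndFDerivAt
        (by simpa using ENat.LEInfty.out) a b
    rw [c.fderiv_flow hd, c.fderiv_flow hd, c.flow_expPt, ← mul_smul_comm, ← mul_smul_comm,
      (c.isLocalPotential_evolved hd hs).leviForm_eq c.isChartFrame (c.contDiff_evolved_slice hd hs),
      c.isLocalPotential.leviForm_eq c.isChartFrame c.contDiff_potential, hII, hII, map_neg, map_neg,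
      logPt_I_smul_linFlow, logPt_I_smul_linFlow, logPt_linFlow, logPt_linFlow, c.logPt_flow,
      map_neg, map_neg, hd.hessian_envelope hP hs, hsymm _ (logPt c.frame (Complex.I • α)),
      hd.hessian_envelope hP hs, hd.hessian_symm _ (logPt c.frame β)]

/-- A direction `w * cvec a` has a fixed real logarithmic vector, so only the other argument is
transported, and symmetry of the Hessian applies. This identifies the gradient of the evolved speed.
-/
theorem levi_mul_cvec_fderiv_flow (c : ToricChart P ψ₀ ψ₁ p) (hd : IsToricCauchyData P ψ₀ ψ₁) {s : ℝ}
    (hs : IsSubcritical P.carrier ψ₀ ψ₁ s) (a : Fin n → ℝ) (w u : Fin n → ℂ) :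
    leviForm (fun w => c.evolved (s, w)) (c.flow (s, w)) (c.flow (s, w) * cvec a)
      (fderiv ℝ (fun w => c.flow (s, w)) w u) = leviForm c.potential w (w * cvec a) u := by
  have hP := (isCompact_carrier P).isBounded
  refine eq_of_eq_on_expPt (f := fun w => leviForm (fun w => c.evolved (s, w)) (c.flow (s, w))
      (c.flow (s, w) * cvec a) (fderiv ℝ (fun w => c.flow (s, w)) w u))
    (g := fun w => leviForm c.potential w (w * cvec a) u) ?_ ?_ (fun z => ?_) w
  · exact continuous_leviForm (c.contDiff_evolved_slice hd hs) (c.contDiff_flow_slice s).continuous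
      ((c.contDiff_flow_slice s).continuous.mul continuous_const) (c.continuous_fderiv_flow s u)
  · exact continuous_leviForm c.contDiff_potential continuous_id
      (continuous_id.mul continuous_const) continuous_const
  · obtain ⟨β, rfl⟩ := exists_mul_expPt z u
    have hsymm : ∀ x a b, fderiv ℝ (fderiv ℝ fun x => envelope ψ₀ ψ₁ (s, x)) x a b =
        fderiv ℝ (fderiv ℝ fun x => envelope ψ₀ ψ₁ (s, x)) x b a := fun x a b =>
      (hd.contDiff_envelope_slice hP hs).contDiffAt.isSymmSndFDerivAt
        (by simpa using ENat.LEInfty.out) a b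
    rw [c.fderiv_flow hd, c.flow_expPt,
      (c.isLocalPotential_evolved hd hs).leviForm_eq c.isChartFrame (c.contDiff_evolved_slice hd hs),
      c.isLocalPotential.leviForm_eq c.isChartFrame c.contDiff_potential, logPt_I_smul_cvec,
      logPt_linFlow, c.logPt_flow, hsymm, hd.hessian_envelope hP hs,
      hd.hessian_symm _ (logPt c.frame β)]
    simp

theorem fderiv_evolved_flow (c : ToricChart P ψ₀ ψ₁ p) (hd : IsToricCauchyData P ψ₀ ψ₁) {s : ℝ}
    (hs : IsSubcritical P.carrier ψ₀ ψ₁ s) (w β : Fin n → ℂ) :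
    fderiv ℝ (fun w => c.evolved (s, w)) (c.flow (s, w)) (c.flow (s, w) * β) =
      fderiv ℝ c.potential w (w * β) := by
  have hP := (isCompact_carrier P).isBounded
  refine eq_of_eq_on_expPt (f := fun w => fderiv ℝ (fun w => c.evolved (s, w)) (c.flow (s, w))
      (c.flow (s, w) * β)) (g := fun w => fderiv ℝ c.potential w (w * β)) ?_ ?_ (fun z => ?_) w
  · exact (((c.contDiff_evolved_slice hd hs).continuous_fderiv (by simp)).comp
      (c.contDiff_flow_slice s).continuous).clm_apply
        ((c.contDiff_flow_slice s).continuous.mul continuous_const)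
  · exact (c.contDiff_potential.continuous_fderiv (by simp)).clm_apply
      (continuous_id.mul continuous_const)
  · rw [c.flow_expPt, (c.isLocalPotential_evolved hd hs).fderiv_eq c.isChartFrame
      (c.contDiff_evolved_slice hd hs), c.isLocalPotential.fderiv_eq c.isChartFrame
      c.contDiff_potential, c.logPt_flow, (hd.hasFDerivAt_envelope_slice hP hs _).fderiv]

/-- Semipositivity passes from the open orbit by density. A null vector would lie in the kernel of
the whole form, and the symplectic identity would carry it to a null vector of the initial metric.
-/
theorem levi_evolved_pos (c : ToricChart P ψ₀ ψ₁ p) (hd : IsToricCauchyData P ψ₀ ψ₁) {s : ℝ}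
    (hs : IsSubcritical P.carrier ψ₀ ψ₁ s) (w v : Fin n → ℂ) (hv : v ≠ 0) :
    0 < leviForm (fun w => c.evolved (s, w)) w v v := by
  have hP := (isCompact_carrier P).isBounded
  have hsm := c.contDiff_evolved_slice hd hs
  have hnn : ∀ w v, 0 ≤ leviForm (fun w => c.evolved (s, w)) w v v := by
    intro w v
    refine le_of_le_on_expPt (f := fun _ => 0)
      (g := fun w => leviForm (fun w => c.evolved (s, w)) w v v) continuous_const
      (continuous_leviForm hsm continuous_id continuous_const continuous_const) (fun z => ?_) w
    obtain ⟨α, rfl⟩ := exists_mul_expPt z v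
    rw [(c.isLocalPotential_evolved hd hs).leviForm_eq c.isChartFrame hsm]
    have h1 := hd.hessian_envelope_nonneg hP hs (logPt c.frame z) (logPt c.frame α)
    have h2 := hd.hessian_envelope_nonneg hP hs (logPt c.frame z) (logPt c.frame (Complex.I • α))
    linarith
  refine lt_of_le_of_ne (hnn w v) fun h0 => hv ?_
  have hker : ∀ u, leviForm (fun w => c.evolved (s, w)) w v u = 0 := by
    intro u
    rw [← leviCLM_apply]
    refine eq_zero_of_apply_self_eq_zero (fun v u => ?_) (fun v => ?_) ?_ u
    · rw [leviCLM_apply, leviCLM_apply, leviForm_symm hsm]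
    · rw [leviCLM_apply]
      exact hnn w v
    · rw [leviCLM_apply, ← h0]
  obtain ⟨w, rfl⟩ := (c.flow_bijective hd hs).2 w
  obtain ⟨e, he⟩ := c.isInvertible_fderiv_flow hd hs w
  obtain ⟨v', hv'⟩ := e.surjective (Complex.I • v)
  have hDv : fderiv ℝ (fun w => c.flow (s, w)) w v' = Complex.I • v := by rw [← he]; exact hv'
  have hI : Complex.I • Complex.I • v = -v := by rw [smul_smul, Complex.I_mul_I, neg_one_smul]
  have h1 := c.levi_I_smul_fderiv_flow hd hs w v' (Complex.I • v')
  rw [hDv, hI, ← leviCLM_apply, map_neg, _root_.neg_apply, leviCLM_apply, hker, neg_zero] at h1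
  have h2 : Complex.I • v' = 0 := by
    by_contra hne
    exact (c.levi_pos w _ hne).ne h1
  have h3 : v' = 0 := (smul_eq_zero_iff_right Complex.I_ne_zero).1 h2
  rw [h3, map_zero] at hv'
  exact (smul_eq_zero_iff_right Complex.I_ne_zero).1 hv'.symm

theorem hasDerivAt_flow_time (c : ToricChart P ψ₀ ψ₁ p) (s : ℝ) (w : Fin n → ℂ) :
    HasDerivAt (fun r => c.flow (r, w)) (-(1 / 2 : ℝ) • (c.flow (s, w) * cvec (c.vel w))) s := by
  have h1 : HasDerivAt (fun r : ℝ => -(r / 2) • cvec (c.vel w)) (-(1 / 2 : ℝ) • cvec (c.vel w)) s :=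
    ((hasDerivAt_id s).div_const 2).neg.smul_const _
  have h2 := (hasDerivAt_expPt_comp h1).const_mul w
  refine h2.congr_deriv ?_
  rw [mul_smul_comm, mul_smul_comm, flow, mul_assoc]

theorem hasDerivAt_pulledPotential (c : ToricChart P ψ₀ ψ₁ p) (s : ℝ) (w : Fin n → ℂ) :
    HasDerivAt (fun r => c.pulledPotential (r, w))
      (c.speed w - 1 / 2 * fderiv ℝ c.potential w (w * cvec (c.vel w))) s := by
  have h1 := (((hasDerivAt_id s).mul_const (c.speed w)).const_add (c.potential w)).sub
    (((hasDerivAt_id s).div_const 2).mul_const (fderiv ℝ c.potential w (w * cvec (c.vel w))))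
  exact h1.congr_deriv (by ring)

/-- Differentiating the pulled-back potential in time along a flow line produces a spatial term that
matches the transported differential; what remains is the initial speed, constant along the flow. -/
theorem hasDerivWithinAt_evolved (c : ToricChart P ψ₀ ψ₁ p) (hd : IsToricCauchyData P ψ₀ ψ₁)
    {I : Set ℝ} (hI : ∀ s ∈ I, IsSubcritical P.carrier ψ₀ ψ₁ s) {s : ℝ} (hs : s ∈ I)
    (hU : UniqueDiffWithinAt ℝ I s) (w : Fin n → ℂ) :
    HasDerivWithinAt (fun r => c.evolved (r, w)) (c.speed (c.invFlow (s, w))) I s := by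
  obtain ⟨w, rfl⟩ := (c.flow_bijective hd (hI s hs)).2 w
  simp only
  have h1 := ((c.contDiffOn_evolved hd hI (s, c.flow (s, w)) ⟨hs, mem_univ _⟩).differentiableWithinAt
    (by simp)).hasFDerivWithinAt
  set L := fderivWithin ℝ c.evolved (I ×ˢ univ) (s, c.flow (s, w)) with hL
  have h2 := hasDerivWithinAt_comp_curve (I := I) h1
    (c.hasDerivAt_flow_time s w).hasDerivWithinAt rfl
  have h3 := hU.eq_deriv I h2 ((c.hasDerivAt_pulledPotential s w).hasDerivWithinAt.congr
    (fun r hr => c.evolved_flow hd (hI r hr) w) (c.evolved_flow hd (hI s hs) w))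
  have h4 := (hasFDerivAt_slice_of_hasFDerivWithinAt hs h1).fderiv
  have h5 := c.fderiv_evolved_flow hd (hI s hs) w (cvec (c.vel w))
  rw [h4] at h5
  have h6 : L (1, 0) = c.speed w := by
    rw [show ((1 : ℝ), -(1 / 2 : ℝ) • (c.flow (s, w) * cvec (c.vel w))) =
      (1, 0) + (-(1 / 2 : ℝ)) • ((0 : ℝ), c.flow (s, w) * cvec (c.vel w)) by simp, map_add,
      map_smul] at h3
    simp only [ContinuousLinearMap.comp_apply, ContinuousLinearMap.inr_apply] at h5
    rw [h5, smul_eq_mul] at h3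
    linarith
  have h7 := hasDerivWithinAt_comp_curve h1 (hasDerivWithinAt_const s I (c.flow (s, w))) rfl
  rw [h6] at h7
  rw [c.invFlow_flow hd (hI s hs)]
  exact h7

/-- The gradient is the transported radial vector `w * cvec vel`, which is `-2` times the flow
velocity. Since the speed is constant along flow lines, its time derivative at a fixed point is half
its derivative along the gradient, which is the squared norm. -/
theorem solvesGeodesicEq_evolved (c : ToricChart P ψ₀ ψ₁ p) (hd : IsToricCauchyData P ψ₀ ψ₁)
    {I : Set ℝ} (hI : ∀ s ∈ I, IsSubcritical P.carrier ψ₀ ψ₁ s) (hU : UniqueDiffOn ℝ I) :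
    SolvesGeodesicEq I c.evolved := by
  have hdot : ∀ s ∈ I, ∀ w, derivWithin (fun r => c.evolved (r, w)) I s =
      c.speed (c.invFlow (s, w)) := fun s hs w =>
    (c.hasDerivWithinAt_evolved hd hI hs (hU s hs) w).derivWithin (hU s hs)
  intro s hs w
  obtain ⟨w, rfl⟩ := (c.flow_bijective hd (hI s hs)).2 w
  simp only
  have h1 := ((c.contDiffOn_invFlow hd hI (s, c.flow (s, w)) ⟨hs, mem_univ _⟩).differentiableWithinAt
    (by simp)).hasFDerivWithinAt
  set L := fderivWithin ℝ c.invFlow (I ×ˢ univ) (s, c.flow (s, w)) with hL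
  have h2 := hasFDerivAt_slice_of_hasFDerivWithinAt hs h1
  have hinv : ∀ u, fderiv ℝ (fun w => c.flow (s, w)) w (L (0, u)) = u := by
    intro u
    have h3 := HasFDerivAt.comp (c.flow (s, w)) (f := fun z => c.invFlow (s, z))
      (g := fun z => c.flow (s, z)) (by
        rw [c.invFlow_flow hd (hI s hs)]
        exact c.hasFDerivAt_flow_slice s w) h2
    have h4 := h3.unique ((hasFDerivAt_id _).congr_of_eventuallyEq (Eventually.of_forall
      fun z => c.flow_invFlow hd (hI s hs) z))
    exact congrArg (fun M => M u) h4
  have hspeed : HasFDerivAt c.speed (fderiv ℝ c.speed w) (c.invFlow (s, c.flow (s, w))) := by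
    rw [c.invFlow_flow hd (hI s hs)]
    exact (c.contDiff_speed.differentiable (by simp) w).hasFDerivAt
  have key : ∀ u, leviForm (fun w => c.evolved (s, w)) (c.flow (s, w))
      (c.flow (s, w) * cvec (c.vel w)) u = fderiv ℝ c.speed w (L (0, u)) / 2 := by
    intro u
    have h3 := c.levi_mul_cvec_fderiv_flow hd (hI s hs) (c.vel w) w (L (0, u))
    rwa [hinv, c.levi_vel] at h3
  refine ⟨c.flow (s, w) * cvec (c.vel w), fun u => ?_, ?_⟩
  · have h3 : HasFDerivAt (c.speed ∘ fun w' => c.invFlow (s, w')) _ (c.flow (s, w)) :=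
      hspeed.comp (c.flow (s, w)) h2
    rw [show (fun w' => derivWithin (fun r => c.evolved (r, w')) I s) =
      c.speed ∘ fun w' => c.invFlow (s, w') from funext (hdot s hs), h3.fderiv, key]
    simp
  · have h3 := hasDerivWithinAt_comp_curve (I := I) h1
      (c.hasDerivAt_flow_time s w).hasDerivWithinAt rfl
    have h4 := (hU s hs).eq_deriv I h3 ((hasDerivWithinAt_const s I w).congr
      (fun r hr => c.invFlow_flow hd (hI r hr) w) (c.invFlow_flow hd (hI s hs) w))
    rw [show ((1 : ℝ), -(1 / 2 : ℝ) • (c.flow (s, w) * cvec (c.vel w))) =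
      (1, 0) + (-(1 / 2 : ℝ)) • ((0 : ℝ), c.flow (s, w) * cvec (c.vel w)) by simp, map_add,
      map_smul] at h4
    -- The starting point is constant along a flow line; differentiating this relates the time
    -- derivative of the inverse flow to its spatial derivative.
    have h5 : L (1, 0) = (1 / 2 : ℝ) • L (0, c.flow (s, w) * cvec (c.vel w)) := by
      rw [neg_smul, add_neg_eq_zero] at h4
      exact h4
    have h6 := hasDerivWithinAt_comp_curve h1 (hasDerivWithinAt_const s I (c.flow (s, w))) rfl
    have h7 := (hspeed.comp_hasDerivWithinAt s h6).congr (fun r hr => hdot r hr (c.flow (s, w)))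
      (hdot s hs (c.flow (s, w)))
    rw [h7.derivWithin (hU s hs), key, h5, map_smul, smul_eq_mul]
    ring

end ToricChart

namespace IsToricCauchyData

variable {n : ℕ} {P : DelzantPolytope n} {ψ₀ ψ₁ : RSpace n → ℝ}

theorem isToricKahlerPotential_envelope (hd : IsToricCauchyData P ψ₀ ψ₁) {s : ℝ}
    (hs : IsSubcritical P.carrier ψ₀ ψ₁ s) :
    IsToricKahlerPotential P fun x => envelope ψ₀ ψ₁ (s, x) := by
  intro p hp
  obtain ⟨c⟩ := exists_toricChart hd hp
  exact ⟨_, c.contDiff_evolved_slice hd hs, c.isLocalPotential_evolved hd hs,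
    c.levi_evolved_pos hd hs⟩

theorem isSmoothToricPath_envelope_sub (hd : IsToricCauchyData P ψ₀ ψ₁) {I : Set ℝ}
    (hI : ∀ s ∈ I, IsSubcritical P.carrier ψ₀ ψ₁ s) {ψω : RSpace n → ℝ}
    (hω : IsToricKahlerPotential P ψω) :
    IsSmoothToricPath P I fun q => envelope ψ₀ ψ₁ q - ψω q.2 := by
  intro p hp
  obtain ⟨c⟩ := exists_toricChart hd hp
  obtain ⟨F, hF, hloc, -⟩ := hω p hp
  refine ⟨fun q => c.evolved q - F q.2, (c.contDiffOn_evolved hd hI).sub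
    (hF.comp contDiff_snd).contDiffOn, fun s hs w x hwx => ?_⟩
  have h := c.isLocalPotential_evolved hd (hI s hs) w x hwx
  simp only at h ⊢
  rw [h, hloc w x hwx]
  ring

end IsToricCauchyData

/-! ### Lifespans -/

section Lifespan

variable {n : ℕ} {P : Set (RSpace n)} {ψ₀ ψ₁ : RSpace n → ℝ}

theorem IsSubcritical.mono {s r : ℝ} (hs : IsSubcritical P ψ₀ ψ₁ s) (hr : 0 ≤ r) (hrs : r ≤ s) :
    IsSubcritical P ψ₀ ψ₁ r := by
  obtain ⟨-, T, hsT, hT⟩ := hs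
  exact ⟨hr, T, hrs.trans_lt hsT, hT⟩

theorem ofReal_le_of_forall_lt {T : ℝ} {c : ℝ≥0∞} (h : ∀ s, 0 < s → s < T → ENNReal.ofReal s ≤ c) :
    ENNReal.ofReal T ≤ c := by
  refine le_of_forall_lt_imp_le_of_dense fun b hb => ?_
  have hb' : b ≠ ⊤ := hb.ne_top
  have hlt : b.toReal < T := (ENNReal.lt_ofReal_iff_toReal_lt hb').1 hb
  rcases eq_or_lt_of_le (ENNReal.toReal_nonneg (a := b)) with h0 | h0
  · rw [(ENNReal.toReal_eq_zero_iff b).1 h0.symm |>.resolve_right hb']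
    exact zero_le
  · rw [← ENNReal.ofReal_toReal hb']
    exact h _ h0 hlt

/-- Convexity of the transform is known at interior times only; the endpoint `T` is reached as a
supremum. -/
theorem IsAdmissibleSolution.ofReal_le_convexLifespan {ψ : ℝ × RSpace n → ℝ} {T : ℝ}
    (hψ : IsAdmissibleSolution P (Icc 0 T) ψ₀ ψ₁ ψ) (hd : IsCauchyData P ψ₀ ψ₁) (hT : 0 ≤ T) :
    ENNReal.ofReal T ≤ convexLifespan P ψ₀ ψ₁ := by
  refine ofReal_le_of_forall_lt fun s h0 hs => le_sSup ⟨s, h0, rfl, ?_⟩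
  refine hψ.convexOn_legendre_sub hd (convex_Icc 0 T) ⟨le_rfl, hT⟩ (fun r hr => hr.1) ?_
  rw [interior_Icc]
  exact ⟨h0, hs⟩

/-- Convexity at a time `s` makes only the strictly earlier times subcritical, which is enough for
the supremum. -/
theorem convexLifespan_le {c : ℝ≥0∞} (h : ∀ T, IsSubcritical P ψ₀ ψ₁ T → ENNReal.ofReal T ≤ c) :
    convexLifespan P ψ₀ ψ₁ ≤ c := by
  refine sSup_le ?_
  rintro _ ⟨s, hs, rfl, hconv⟩
  exact ofReal_le_of_forall_lt fun r hr hrs => h r ⟨hr.le, s, hrs, hconv⟩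

theorem IsSubcritical.isAdmissibleSolution (hd : IsCauchyData P ψ₀ ψ₁) (hP : Bornology.IsBounded P)
    {T : ℝ} (hT : IsSubcritical P ψ₀ ψ₁ T) :
    IsAdmissibleSolution P (Icc 0 T) ψ₀ ψ₁ (envelope ψ₀ ψ₁) :=
  hd.isAdmissibleSolution_envelope hP (fun _ hs => hT.mono hs.1 hs.2) (convex_Icc 0 T)
    ⟨le_rfl, hT.1⟩

theorem smoothLifespan_eq (hd : IsCauchyData P ψ₀ ψ₁) (hP : Bornology.IsBounded P) :
    smoothLifespan P ψ₀ ψ₁ = convexLifespan P ψ₀ ψ₁ := by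
  apply le_antisymm
  · refine sSup_le ?_
    rintro _ ⟨T, hT, rfl, ψ, hψ, -⟩
    exact hψ.ofReal_le_convexLifespan hd hT
  · exact convexLifespan_le fun T hT => le_sSup ⟨T, hT.1, rfl, _, hT.isAdmissibleSolution hd hP,
      hd.contDiffOn_envelope hP fun _ hs => hT.mono hs.1 hs.2⟩

theorem toricSmoothLifespan_eq {P : DelzantPolytope n} (hd : IsToricCauchyData P ψ₀ ψ₁) :
    toricSmoothLifespan P ψ₀ ψ₁ = convexLifespan P.carrier ψ₀ ψ₁ := by
  apply le_antisymm
  · refine sSup_le ?_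
    rintro _ ⟨T, hT, rfl, ψ, hψ, -⟩
    exact hψ.ofReal_le_convexLifespan hd.toIsCauchyData hT
  · exact convexLifespan_le fun T hT => le_sSup ⟨T, hT.1, rfl, _,
      hT.isAdmissibleSolution hd.toIsCauchyData (isCompact_carrier P).isBounded,
      hd.isSmoothToricPath_envelope_sub (fun _ hs => hT.mono hs.1 hs.2) hd.kahler⟩

theorem IsCauchyData.convexOn_legendre (hd : IsCauchyData P ψ₀ ψ₁) :
    ConvexOn ℝ (interior P) (legendre ψ₀) := by
  have hle : ∀ y ∈ interior P, ∀ x, inner ℝ x y - ψ₀ x ≤ legendre ψ₀ y := by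
    intro y hy x
    rw [← hd.range_gradient] at hy
    obtain ⟨w, rfl⟩ := hy
    rw [hd.legendre_gradient, real_inner_comm, inner_gradient]
    have := hd.add_fderiv_le w x
    rw [map_sub] at this
    linarith
  refine ⟨hd.convex.interior, fun y hy z hz a b ha hb hab => ?_⟩
  have hm : a • y + b • z ∈ range (gradient ψ₀) := by
    rw [hd.range_gradient]
    exact hd.convex.interior hy hz ha hb hab
  obtain ⟨x, hx⟩ := hm
  have h1 := mul_le_mul_of_nonneg_left (hle y hy x) ha
  have h2 := mul_le_mul_of_nonneg_left (hle z hz x) hb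
  have h3 : inner ℝ x (gradient ψ₀ x) = fderiv ℝ ψ₀ x x := by rw [real_inner_comm, inner_gradient]
  rw [← hx, hd.legendre_gradient, ← h3, hx, inner_add_right, real_inner_smul_right,
    real_inner_smul_right]
  simp only [smul_eq_mul]
  have h4 : ψ₀ x = a * ψ₀ x + b * ψ₀ x := by rw [← add_mul, hab, one_mul]
  linarith

theorem IsCauchyData.isSubcritical_of_concaveOn (hd : IsCauchyData P ψ₀ ψ₁)
    (hg : ConcaveOn ℝ (interior P) (momentVelocity ψ₀ ψ₁)) {s : ℝ} (hs : 0 ≤ s) :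
    IsSubcritical P ψ₀ ψ₁ s :=
  ⟨hs, s + 1, by linarith, hd.convexOn_legendre.sub (hg.smul (by linarith))⟩

/-- Dividing by `s` and letting `s` grow removes `f`. Quantitatively, a concavity defect `δ`
contradicts convexity at `s = (|C| + 1) / δ`, with `C` the Jensen gap of `f`. -/
theorem concaveOn_of_forall_convexOn_sub {E : Type*} [AddCommGroup E] [Module ℝ E] {S : Set E}
    {f g : E → ℝ} (h : ∀ s : ℝ, 0 < s → ConvexOn ℝ S fun y => f y - s * g y) : ConcaveOn ℝ S g := by
  refine ⟨(h 1 one_pos).1, fun y hy z hz a b ha hb hab => ?_⟩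
  by_contra! hlt
  set δ := a • g y + b • g z - g (a • y + b • z) with hδ
  set C := a • f y + b • f z - f (a • y + b • z) with hC
  have hδ0 : 0 < δ := sub_pos.2 hlt
  have hs : 0 < (|C| + 1) / δ := by positivity
  have h1 := (h _ hs).2 hy hz ha hb hab
  have h2 : (|C| + 1) / δ * δ = |C| + 1 := by field_simp
  have h3 := le_abs_self C
  simp only [smul_eq_mul] at h1 hδ hC
  have h4 : (|C| + 1) / δ * δ ≤ C := by
    generalize (|C| + 1) / δ = r at h1
    rw [hδ, hC]
    linarith
  linarith

theorem IsAdmissibleSolution.concaveOn_momentVelocity {ψ : ℝ × RSpace n → ℝ}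
    (hψ : IsAdmissibleSolution P (Ici 0) ψ₀ ψ₁ ψ) (hd : IsCauchyData P ψ₀ ψ₁) :
    ConcaveOn ℝ (interior P) (momentVelocity ψ₀ ψ₁) :=
  concaveOn_of_forall_convexOn_sub fun s hs =>
    hψ.convexOn_legendre_sub hd (convex_Ici 0) self_mem_Ici Subset.rfl (by rwa [interior_Ici])

theorem IsAdmissibleSolution.congr {I : Set ℝ} {ψ χ : ℝ × RSpace n → ℝ}
    (hψ : IsAdmissibleSolution P I ψ₀ ψ₁ ψ) (h0 : 0 ∈ I) (h : ∀ s ∈ I, ∀ x, χ (s, x) = ψ (s, x)) :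
    IsAdmissibleSolution P I ψ₀ ψ₁ χ where
  convex := hψ.convex.congr fun q hq => (h q.1 hq.1 q.2).symm
  initial x := by rw [h 0 h0, hψ.initial]
  initial_deriv x := (hψ.initial_deriv x).congr (fun s hs => h s hs x) (h 0 h0 x)
  strictConvex s hs := by
    rw [funext (h s hs)]
    exact hψ.strictConvex s hs
  closure_image s hs := by
    rw [funext (h s hs)]
    exact hψ.closure_image s hs
  weak := by
    refine (congrArg volume ?_).trans hψ.weak
    refine iUnion₂_congr fun s hs => iUnion_congr fun x => ?_
    ext q
    refine forall₂_congr fun r hr => ?_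
    simp only [h s (interior_subset hs), h r hr]

theorem IsAdmissibleSolution.eq_of_Ici {ψ χ : ℝ × RSpace n → ℝ}
    (hψ : IsAdmissibleSolution P (Ici 0) ψ₀ ψ₁ ψ) (hχ : IsAdmissibleSolution P (Ici 0) ψ₀ ψ₁ χ)
    (hd : IsCauchyData P ψ₀ ψ₁) {s : ℝ} (hs : 0 ≤ s) (x : RSpace n) : ψ (s, x) = χ (s, x) := by
  rcases hs.eq_or_lt with rfl | hs
  · rw [hψ.initial, hχ.initial]
  · exact hψ.eq_of_mem_interior hχ hd (convex_Ici 0) self_mem_Ici Subset.rfl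
      (by rwa [interior_Ici]) x

theorem IsCauchyData.isAdmissibleSolution_of_concaveOn (hd : IsCauchyData P ψ₀ ψ₁)
    (hP : Bornology.IsBounded P) (hg : ConcaveOn ℝ (interior P) (momentVelocity ψ₀ ψ₁)) :
    IsAdmissibleSolution P (Ici 0) ψ₀ ψ₁ (envelope ψ₀ ψ₁) :=
  hd.isAdmissibleSolution_envelope hP (fun _ hs => hd.isSubcritical_of_concaveOn hg hs)
    (convex_Ici 0) self_mem_Ici

theorem rayFun_coe (γ : ℝ≥0 → RSpace n → ℝ) (s : ℝ≥0) (x : RSpace n) :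
    rayFun γ (s, x) = γ s x := by
  rw [rayFun, Real.toNNReal_coe]

/-- Parametrizing by `ℝ≥0` discards the values at negative times, which no condition constrains. -/
theorem IsCauchyData.existsUnique_of_concaveOn (hd : IsCauchyData P ψ₀ ψ₁)
    (hP : Bornology.IsBounded P) (hg : ConcaveOn ℝ (interior P) (momentVelocity ψ₀ ψ₁)) :
    ∃! ψ : ℝ≥0 → RSpace n → ℝ, IsAdmissibleSolution P (Ici 0) ψ₀ ψ₁ (rayFun ψ) := by
  have h := hd.isAdmissibleSolution_of_concaveOn hP hg
  refine ⟨fun s x => envelope ψ₀ ψ₁ (s, x), h.congr self_mem_Ici fun s hs x => ?_, fun χ hχ => ?_⟩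
  · simp only [rayFun, Real.coe_toNNReal s hs]
  · funext s x
    rw [← rayFun_coe χ]
    exact IsAdmissibleSolution.eq_of_Ici hχ h hd s.2 x

end Lifespan

/-- The metrics given by an admissible solution with concave data form a smooth geodesic ray. -/
theorem IsToricCauchyData.isSmoothToricGeodesicRay {n : ℕ} {P : DelzantPolytope n}
    {ψ₀ ψ₁ ψω : RSpace n → ℝ} (hd : IsToricCauchyData P ψ₀ ψ₁)
    (hg : ConcaveOn ℝ (interior P.carrier) (momentVelocity ψ₀ ψ₁)) (hω : IsToricKahlerPotential P ψω)
    {φ : ℝ≥0 → RSpace n → ℝ} (hφ : ∀ s x, ψω x + φ s x = envelope ψ₀ ψ₁ (s, x)) :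
    IsSmoothToricGeodesicRay P ψω φ := by
  have hI : ∀ s ∈ Ici (0 : ℝ), IsSubcritical P.carrier ψ₀ ψ₁ s := fun s hs =>
    hd.isSubcritical_of_concaveOn hg hs
  have hray : ∀ s ∈ Ici (0 : ℝ), ∀ x, ψω x + rayFun φ (s, x) = envelope ψ₀ ψ₁ (s, x) := by
    intro s hs x
    rw [rayFun, hφ]
    simp only [Real.coe_toNNReal s hs]
  have hpath : IsSmoothToricPath P (Ici 0) (rayFun φ) := by
    intro p hp
    obtain ⟨F, hF, h⟩ := hd.isSmoothToricPath_envelope_sub hI hω p hp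
    refine ⟨F, hF, fun s hs w x hwx => ?_⟩
    rw [h s hs w x hwx]
    simp only
    rw [← hray s hs, add_sub_cancel_left]
  refine ⟨fun s => ⟨fun p hp => ?_, ?_⟩, hpath, fun p hp => ?_⟩
  · obtain ⟨F, hF, h⟩ := hpath p hp
    refine ⟨fun w => F (s, w), ?_, fun w x hwx => ?_⟩
    · exact hF.comp_contDiff (contDiff_const.prodMk contDiff_id) fun _ => ⟨s.2, mem_univ _⟩
    · rw [← rayFun_coe φ]
      exact h s s.2 w x hwx
  · simp only [hφ]
    exact hd.isToricKahlerPotential_envelope (hI s s.2)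
  · obtain ⟨c⟩ := exists_toricChart hd hp
    refine ⟨c.evolved, c.contDiffOn_evolved hd hI, fun s hs => ?_,
      c.solvesGeodesicEq_evolved hd hI (uniqueDiffOn_Ici 0)⟩
    rw [funext (hray s hs)]
    exact c.isLocalPotential_evolved hd (hI s hs)

/-! ### Geodesic rays as solutions of the Cauchy problem -/

theorem contDiff_slice {E F : Type*} [NormedAddCommGroup E] [NormedSpace ℝ E] [NormedAddCommGroup F]
    [NormedSpace ℝ F] {G : ℝ × E → F} {I : Set ℝ} (hG : ContDiffOn ℝ ∞ G (I ×ˢ univ)) {s : ℝ}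
    (hs : s ∈ I) : ContDiff ℝ ∞ fun w => G (s, w) :=
  hG.comp_contDiff (contDiff_const.prodMk contDiff_id) fun _ => ⟨hs, mem_univ _⟩

theorem hasDerivWithinAt_time {E F : Type*} [NormedAddCommGroup E] [NormedSpace ℝ E]
    [NormedAddCommGroup F] [NormedSpace ℝ F] {G : ℝ × E → F} {I : Set ℝ}
    (hG : ContDiffOn ℝ ∞ G (I ×ˢ univ)) {s : ℝ} (hs : s ∈ I) (w : E) :
    HasDerivWithinAt (fun r => G (r, w)) (fderivWithin ℝ G (I ×ˢ univ) (s, w) (1, 0)) I s :=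
  hasDerivWithinAt_comp_curve ((hG (s, w) ⟨hs, mem_univ _⟩).differentiableWithinAt
    (by simp)).hasFDerivWithinAt (hasDerivWithinAt_const s I w) rfl

theorem contDiff_derivWithin_slice {E F : Type*} [NormedAddCommGroup E] [NormedSpace ℝ E]
    [NormedAddCommGroup F] [NormedSpace ℝ F] {G : ℝ × E → F} {I : Set ℝ}
    (hG : ContDiffOn ℝ ∞ G (I ×ˢ univ)) (hI : UniqueDiffOn ℝ I) {s : ℝ} (hs : s ∈ I) :
    ContDiff ℝ ∞ fun w => derivWithin (fun r => G (r, w)) I s := by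
  have h1 : ContDiffOn ℝ ∞ (fderivWithin ℝ G (I ×ˢ univ)) (I ×ˢ univ) :=
    hG.fderivWithin (hI.prod uniqueDiffOn_univ) (by simp)
  have h2 : (fun w => derivWithin (fun r => G (r, w)) I s) =
      fun w => fderivWithin ℝ G (I ×ˢ univ) (s, w) (1, 0) :=
    funext fun w => (hasDerivWithinAt_time hG hs w).derivWithin (hI s hs)
  rw [h2]
  exact (contDiff_slice h1 hs).clm_apply contDiff_const

theorem IsSmoothToricFunction.contDiff {n : ℕ} {P : DelzantPolytope n} {h : RSpace n → ℝ}
    (hh : IsSmoothToricFunction P h) : ContDiff ℝ ∞ h := by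
  obtain ⟨p, hp⟩ := P.vertices_nonempty
  obtain ⟨F, hF, hFh⟩ := hh p hp
  obtain ⟨A, hA⟩ := exists_chartFrame P hp
  exact contDiff_of_chart hF ((forall_overChart_iff hA).1 hFh)

/-- A continuous function on a compact toric manifold is bounded. -/
theorem IsSmoothToricFunction.bounded {n : ℕ} {P : DelzantPolytope n} {h : RSpace n → ℝ}
    (hh : IsSmoothToricFunction P h) : ∃ C : ℝ, ∀ x, |h x| ≤ C := by
  have hch : ∀ p ∈ P.vertices, ∃ C : ℝ, ∀ x, (∀ j, inner ℝ (intVec (P.edge p j)) x ≤ 0) →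
      |h x| ≤ C := by
    intro p hp
    obtain ⟨F, hF, hFh⟩ := hh p hp
    obtain ⟨A, hA⟩ := exists_chartFrame P hp
    obtain ⟨C, hC⟩ := (isCompact_closedBall (0 : Fin n → ℂ) 1).exists_bound_of_continuousOn
      hF.continuous.continuousOn
    refine ⟨C, fun x hx => ?_⟩
    have h1 := hC (expPt (logSection A x)) (by
      rw [mem_closedBall_zero_iff, pi_norm_le_iff_of_nonneg zero_le_one]
      intro j
      rw [expPt, Complex.norm_exp, logSection_apply, Complex.ofReal_re, Real.exp_le_one_iff]
      have := hA (A.symm x) j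
      rw [A.apply_symm_apply] at this
      have h2 := hx j
      linarith)
    rwa [(forall_overChart_iff hA).1 hFh, logPt_logSection, Real.norm_eq_abs] at h1
  choose! C hC using hch
  refine ⟨∑ p ∈ P.vertices, |C p|, fun x => ?_⟩
  obtain ⟨p, hp, hx⟩ := exists_vertex_inner_nonpos P x
  exact (hC p hp x hx).trans ((le_abs_self _).trans
    (Finset.single_le_sum (f := fun p => |C p|) (fun _ _ => abs_nonneg _) hp))

/-- The geodesic equation in logarithmic coordinates. -/
theorem exists_geodesic_velocity {n : ℕ} {P : DelzantPolytope n} {p : Fin n → ℤ}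
    {A : (Fin n → ℝ) ≃L[ℝ] RSpace n} (hA : IsChartFrame P p A) {I : Set ℝ} (hI : UniqueDiffOn ℝ I)
    {G : ℝ × (Fin n → ℂ) → ℝ} {Ψ : ℝ × RSpace n → ℝ} (hG : ContDiffOn ℝ ∞ G (I ×ˢ univ))
    (hloc : ∀ s ∈ I, IsLocalPotential P p (fun x => Ψ (s, x)) fun w => G (s, w))
    (hgeo : SolvesGeodesicEq I G) {s : ℝ} (hs : s ∈ I) (x : RSpace n) :
    ∃ η, (∀ b, fderiv ℝ (fderiv ℝ fun x => Ψ (s, x)) x η b =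
        fderiv ℝ (fun x => derivWithin (fun r => Ψ (r, x)) I s) x b) ∧
      derivWithin (fun r => derivWithin (fun r' => Ψ (r', x)) I r) I s =
        fderiv ℝ (fderiv ℝ fun x => Ψ (s, x)) x η η := by
  have hdot : ∀ r ∈ I, ∀ z, derivWithin (fun r => G (r, expPt z)) I r =
      derivWithin (fun r => Ψ (r, logPt A z)) I r := by
    intro r hr z
    rw [derivWithin_congr (f := fun r => Ψ (r, logPt A z) - inner ℝ (intVec p) (logPt A z))
      (fun t ht => (isLocalPotential_iff hA).1 (hloc t ht) z)
      ((isLocalPotential_iff hA).1 (hloc r hr) z), derivWithin_sub_const]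
  set z := logSection A x with hz
  have hzx : logPt A z = x := logPt_logSection A x
  obtain ⟨v, hv1, hv2⟩ := hgeo s hs (expPt z)
  obtain ⟨α, rfl⟩ := exists_mul_expPt z v
  have hGs := contDiff_slice hG hs
  have hlevi : ∀ β γ, leviForm (fun w => G (s, w)) (expPt z) (expPt z * β) (expPt z * γ) =
      (fderiv ℝ (fderiv ℝ fun x => Ψ (s, x)) x (logPt A β) (logPt A γ) +
        fderiv ℝ (fderiv ℝ fun x => Ψ (s, x)) x (logPt A (Complex.I • β))
          (logPt A (Complex.I • γ))) / 4 := by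
    intro β γ
    rw [(hloc s hs).leviForm_eq hA hGs, hzx]
  have hfd : ∀ β, fderiv ℝ (fun w => derivWithin (fun r => G (r, w)) I s) (expPt z) (expPt z * β) =
      fderiv ℝ (fun x => derivWithin (fun r => Ψ (r, x)) I s) x (logPt A β) := by
    intro β
    rw [fderiv_chart (A := A) (f := fun x => derivWithin (fun r => Ψ (r, x)) I s)
      (contDiff_derivWithin_slice hG hI hs) (hdot s hs), hzx]
  have heq : ∀ β, fderiv ℝ (fderiv ℝ fun x => Ψ (s, x)) x (logPt A α) (logPt A β) +
        fderiv ℝ (fderiv ℝ fun x => Ψ (s, x)) x (logPt A (Complex.I • α))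
          (logPt A (Complex.I • β)) =
      2 * fderiv ℝ (fun x => derivWithin (fun r => Ψ (r, x)) I s) x (logPt A β) := by
    intro β
    have h := hv1 (expPt z * β)
    rw [hlevi, hfd] at h
    linarith
  have hre : ∀ b, fderiv ℝ (fderiv ℝ fun x => Ψ (s, x)) x (logPt A α) b =
      2 * fderiv ℝ (fun x => derivWithin (fun r => Ψ (r, x)) I s) x b := by
    intro b
    have h := heq (logSection A b)
    rwa [logPt_logSection, logPt_I_smul_logSection, map_zero, add_zero] at h
  -- Testing against angular directions, along which the invariant speed is constant, shows that the
  -- angular part of the gradient contributes nothing.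
  have him : ∀ b, fderiv ℝ (fderiv ℝ fun x => Ψ (s, x)) x (logPt A (Complex.I • α)) b = 0 := by
    intro b
    have h := heq (Complex.I • logSection A b)
    rw [smul_smul, Complex.I_mul_I, neg_one_smul, map_neg, logPt_logSection,
      logPt_I_smul_logSection] at h
    simpa using h
  -- The half compensates the doubling in `logPt`, so that the complex equation becomes the real one
  -- without constants.
  refine ⟨(2 : ℝ)⁻¹ • logPt A α, fun b => ?_, ?_⟩
  · rw [map_smul, _root_.smul_apply, hre, smul_eq_mul]
    ring
  · rw [hlevi, him, add_zero] at hv2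
    have h1 : derivWithin (fun r => derivWithin (fun r' => Ψ (r', x)) I r) I s =
        derivWithin (fun r => derivWithin (fun r' => G (r', expPt z)) I r) I s :=
      derivWithin_congr (fun r hr => by rw [hdot r hr, hzx]) (by rw [hdot s hs, hzx])
    rw [h1, hv2, map_smul, map_smul, _root_.smul_apply, smul_eq_mul, smul_eq_mul]
    ring

/-- The derivative of a differential along a curve. -/
theorem hasDerivAt_fderiv_comp {E : Type*} [NormedAddCommGroup E] [NormedSpace ℝ E] {f : E → ℝ}
    {γ : ℝ → E} {v : E} {t : ℝ} (hf : DifferentiableAt ℝ (fderiv ℝ f) (γ t)) (hγ : HasDerivAt γ v t)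
    (u : E) : HasDerivAt (fun t => fderiv ℝ f (γ t) u) (fderiv ℝ (fderiv ℝ f) (γ t) v u) t :=
  ((hf.hasFDerivAt.comp_hasDerivAt t hγ).clm_apply (hasDerivAt_const t u)).congr_deriv (by simp)

theorem hasDerivAt_segment {E : Type*} [NormedAddCommGroup E] [NormedSpace ℝ E] (x v : E) (t : ℝ) :
    HasDerivAt (fun t : ℝ => x + t • v) v t := by
  simpa using ((hasDerivAt_id t).smul_const v).const_add x

/-! ### From the geodesic equation to the homogeneous Monge–Ampère equation -/

section Ray

variable {n : ℕ} {Ψ : ℝ × RSpace n → ℝ}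

/-- At positive times the Hessian on space-time has a kernel, which is transversal to the slices. -/
theorem hessian_eq_zero_of_geodesic (hΨ : ContDiffOn ℝ ∞ Ψ (Ici 0 ×ˢ univ)) {s : ℝ} (hs : 0 < s)
    (x : RSpace n) {η : RSpace n}
    (h1 : ∀ b, fderiv ℝ (fderiv ℝ fun x => Ψ (s, x)) x η b =
      fderiv ℝ (fun x => derivWithin (fun r => Ψ (r, x)) (Ici 0) s) x b)
    (h2 : derivWithin (fun r => derivWithin (fun r' => Ψ (r', x)) (Ici 0) r) (Ici 0) s =
      fderiv ℝ (fderiv ℝ fun x => Ψ (s, x)) x η η) :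
    DifferentiableAt ℝ (fderiv ℝ Ψ) (s, x) ∧ fderiv ℝ (fderiv ℝ Ψ) (s, x) (1, -η) = 0 ∧
      ∀ a b, fderiv ℝ (fderiv ℝ Ψ) (s, x) (0, a) (0, b) =
        fderiv ℝ (fderiv ℝ fun x => Ψ (s, x)) x a b := by
  have hat : ∀ r, 0 < r → ∀ z, ContDiffAt ℝ ∞ Ψ (r, z) := fun r hr z =>
    hΨ.contDiffAt (prod_mem_nhds (Ici_mem_nhds hr) univ_mem)
  have hF1 : ∀ r, 0 < r → ∀ z, HasFDerivAt Ψ (fderiv ℝ Ψ (r, z)) (r, z) := fun r hr z =>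
    ((hat r hr z).differentiableAt (by simp)).hasFDerivAt
  have hd2 : DifferentiableAt ℝ (fderiv ℝ Ψ) (s, x) :=
    ((hat s hs x).fderiv_right (m := ∞) (by simp)).differentiableAt (by simp)
  have hF2 := hd2.hasFDerivAt
  have htime : ∀ z, HasDerivAt (fun r : ℝ => (r, z)) ((1 : ℝ), (0 : RSpace n)) s := fun z =>
    (hasDerivAt_id s).prodMk (hasDerivAt_const s z)
  have hdot : ∀ r, 0 < r → ∀ z, derivWithin (fun r => Ψ (r, z)) (Ici 0) r =
      fderiv ℝ Ψ (r, z) (1, 0) := by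
    intro r hr z
    rw [derivWithin_of_mem_nhds (Ici_mem_nhds hr)]
    exact ((hF1 r hr z).comp_hasDerivAt r
      ((hasDerivAt_id r).prodMk (hasDerivAt_const r z))).deriv
  have hslice : (fderiv ℝ fun x => Ψ (s, x)) = fun z =>
      (fderiv ℝ Ψ (s, z)).comp (ContinuousLinearMap.inr ℝ ℝ (RSpace n)) :=
    funext fun z => ((hF1 s hs z).comp z (hasFDerivAt_prodMk_right s z)).fderiv
  have hF2s : HasFDerivAt (fun z => fderiv ℝ Ψ (s, z))
      ((fderiv ℝ (fderiv ℝ Ψ) (s, x)).comp (ContinuousLinearMap.inr ℝ ℝ (RSpace n))) x :=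
    hF2.comp x (hasFDerivAt_prodMk_right s x)
  have hess : ∀ a b, fderiv ℝ (fderiv ℝ Ψ) (s, x) (0, a) (0, b) =
      fderiv ℝ (fderiv ℝ fun x => Ψ (s, x)) x a b := by
    intro a b
    rw [hslice, (hF2s.clm_comp (hasFDerivAt_const _ x)).fderiv]
    simp
  have hmix : ∀ b, fderiv ℝ (fun x => derivWithin (fun r => Ψ (r, x)) (Ici 0) s) x b =
      fderiv ℝ (fderiv ℝ Ψ) (s, x) (0, b) (1, 0) := by
    intro b
    rw [funext (hdot s hs), (hF2s.clm_apply (hasFDerivAt_const _ x)).fderiv]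
    simp
  have htt : derivWithin (fun r => derivWithin (fun r' => Ψ (r', x)) (Ici 0) r) (Ici 0) s =
      fderiv ℝ (fderiv ℝ Ψ) (s, x) (1, 0) (1, 0) := by
    rw [derivWithin_of_mem_nhds (Ici_mem_nhds hs)]
    have h3 := hasDerivAt_fderiv_comp hd2 (htime x) (1, 0)
    have h4 := h3.congr_of_eventuallyEq
      (f₁ := fun r => derivWithin (fun r' => Ψ (r', x)) (Ici 0) r) (by
      filter_upwards [Ioi_mem_nhds hs] with r hr
      exact hdot r hr x)
    exact h4.deriv
  have hsymm : ∀ a b, fderiv ℝ (fderiv ℝ Ψ) (s, x) a b = fderiv ℝ (fderiv ℝ Ψ) (s, x) b a :=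
    (hat s hs x).isSymmSndFDerivAt (by simpa using ENat.LEInfty.out)
  -- Pairing `(1, -η)` with spatial vectors vanishes by the equation for the gradient, and pairing
  -- with `(1, 0)` by the geodesic equation itself.
  refine ⟨hd2, ContinuousLinearMap.ext fun ⟨τ, b⟩ => ?_, hess⟩
  have hk : ((1 : ℝ), -η) = (1, 0) - (0, η) := by simp
  have hb : (τ, b) = τ • ((1 : ℝ), (0 : RSpace n)) + (0, b) := by simp
  have e1 : ∀ b, fderiv ℝ (fderiv ℝ Ψ) (s, x) (0, η) (0, b) =
      fderiv ℝ (fderiv ℝ Ψ) (s, x) (1, 0) (0, b) := fun b => by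
    rw [hess, h1, hmix, hsymm]
  have e2 : fderiv ℝ (fderiv ℝ Ψ) (s, x) (1, 0) (1, 0) =
      fderiv ℝ (fderiv ℝ Ψ) (s, x) (0, η) (1, 0) := by
    rw [← htt, h2, h1, hmix]
  rw [hk, hb, map_sub, _root_.sub_apply, map_add, map_add, map_smul, map_smul, e1, e2]
  simp

/-- The gradient as a linear function of the differential. -/
def gradientCLM (n : ℕ) : (ℝ × RSpace n →L[ℝ] ℝ) →L[ℝ] ℝ × RSpace n :=
  (ContinuousLinearMap.apply ℝ ℝ ((1 : ℝ), (0 : RSpace n))).prod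
    ((EuclideanSpace.equiv (Fin n) ℝ).symm.toContinuousLinearMap.comp
      (ContinuousLinearMap.pi fun i =>
        ContinuousLinearMap.apply ℝ ℝ ((0 : ℝ), EuclideanSpace.single i (1 : ℝ))))

theorem gradientCLM_eq {q : ℝ × RSpace n} {L : ℝ × RSpace n →L[ℝ] ℝ} (h1 : q.1 = L (1, 0))
    (h2 : ∀ v, inner ℝ q.2 v = L (0, v)) : gradientCLM n L = q := by
  refine Prod.ext h1.symm ?_
  ext i
  have h3 := h2 (EuclideanSpace.single i (1 : ℝ))
  rw [EuclideanSpace.inner_single_right] at h3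
  simp at h3
  rw [h3]
  rfl

/-- A Hessian positive on slices and with a kernel transversal to them is semidefinite, which gives
convexity in space-time. Its degeneracy makes the gradient image null. -/
theorem isAdmissibleSolution_of_geodesic {P : DelzantPolytope n}
    (hΨ : ContDiffOn ℝ ∞ Ψ (Ici 0 ×ˢ univ))
    (hK : ∀ s ∈ Ici (0 : ℝ), IsToricKahlerPotential P fun x => Ψ (s, x))
    (hgeo : ∀ s, 0 < s → ∀ x, ∃ η, (∀ b, fderiv ℝ (fderiv ℝ fun x => Ψ (s, x)) x η b =
      fderiv ℝ (fun x => derivWithin (fun r => Ψ (r, x)) (Ici 0) s) x b) ∧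
      derivWithin (fun r => derivWithin (fun r' => Ψ (r', x)) (Ici 0) r) (Ici 0) s =
        fderiv ℝ (fderiv ℝ fun x => Ψ (s, x)) x η η) :
    IsAdmissibleSolution P.carrier (Ici 0) (fun x => Ψ (0, x))
      (fun x => derivWithin (fun r => Ψ (r, x)) (Ici 0) 0) Ψ := by
  have hker : ∀ s, 0 < s → ∀ x, ∃ η, DifferentiableAt ℝ (fderiv ℝ Ψ) (s, x) ∧
      fderiv ℝ (fderiv ℝ Ψ) (s, x) (1, -η) = 0 ∧ ∀ a b, fderiv ℝ (fderiv ℝ Ψ) (s, x) (0, a) (0, b) =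
        fderiv ℝ (fderiv ℝ fun x => Ψ (s, x)) x a b := by
    intro s hs x
    obtain ⟨η, h1, h2⟩ := hgeo s hs x
    exact ⟨η, hessian_eq_zero_of_geodesic hΨ hs x h1 h2⟩
  have hat : ∀ r, 0 < r → ∀ z, ContDiffAt ℝ ∞ Ψ (r, z) := fun r hr z =>
    hΨ.contDiffAt (prod_mem_nhds (Ici_mem_nhds hr) univ_mem)
  have hnn : ∀ s, 0 < s → ∀ x v, 0 ≤ fderiv ℝ (fderiv ℝ Ψ) (s, x) v v := by
    intro s hs x ⟨τ, b⟩
    obtain ⟨η, -, h1, h2⟩ := hker s hs x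
    have hsymm := (hat s hs x).isSymmSndFDerivAt (by simpa using ENat.LEInfty.out)
    -- Splitting off the kernel vector reduces the quadratic form to a spatial vector.
    have hv : (τ, b) = τ • ((1 : ℝ), -η) + (0, b + τ • η) := by simp
    have h3 : fderiv ℝ (fderiv ℝ Ψ) (s, x) (τ, b) = fderiv ℝ (fderiv ℝ Ψ) (s, x) (0, b + τ • η) := by
      rw [hv, map_add, map_smul, h1, smul_zero, zero_add]
    rw [h3, hsymm, h3, h2]
    rcases eq_or_ne (b + τ • η) 0 with h0 | h0
    · rw [h0]; simp
    · exact ((hK s hs.le).hessian_pos x _ h0).le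
  refine ⟨?_, fun _ => rfl, fun x => ?_, fun s hs => ?_, fun s hs => ?_, ?_⟩
  · refine ⟨(convex_Ici 0).prod convex_univ, ?_⟩
    rintro ⟨s, x⟩ ⟨hs, -⟩ ⟨r, z⟩ ⟨hr, -⟩ a b ha hb hab
    rw [mem_Ici] at hs hr
    -- The space-time Hessian is controlled only at positive times. A segment lies either entirely
    -- in the initial slice or has its open part at positive times.
    rcases (add_nonneg hs hr).eq_or_lt with h0 | h0
    · obtain rfl : s = 0 := by linarith
      obtain rfl : r = 0 := by linarith
      have h1 := (convexOn_of_add_fderiv_le (hK 0 self_mem_Ici).add_fderiv_le).2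
        (mem_univ x) (mem_univ z) ha hb hab
      simpa using h1
    · set γ : ℝ → ℝ × RSpace n := fun t => (s, x) + t • ((r, z) - (s, x)) with hγ
      have hγd : ∀ t, HasDerivAt γ ((r, z) - (s, x)) t := fun t =>
        hasDerivAt_segment _ _ t
      have hγ1 : ∀ t, (γ t).1 = (1 - t) * s + t * r := fun t => by
        simp [hγ]; ring
      have hpos : ∀ t ∈ Ioo (0 : ℝ) 1, 0 < (γ t).1 := by
        intro t ht
        rw [hγ1]
        rcases hs.eq_or_lt with rfl | hs'
        · have : 0 < r := by linarith
          have := mul_pos ht.1 this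
          linarith
        · have h3 := mul_pos (sub_pos.2 ht.2) hs'
          have h4 := mul_nonneg ht.1.le hr
          linarith
      have hconv : ConvexOn ℝ (Icc 0 1) fun t => Ψ (γ t) := by
        refine convexOn_of_hasDerivWithinAt2_nonneg (convex_Icc 0 1)
          (f' := fun t => fderiv ℝ Ψ (γ t) ((r, z) - (s, x)))
          (f'' := fun t => fderiv ℝ (fderiv ℝ Ψ) (γ t) ((r, z) - (s, x)) ((r, z) - (s, x))) ?_ ?_ ?_ ?_
        · refine hΨ.continuousOn.comp
            (fun t _ => (hγd t).continuousAt.continuousWithinAt) fun t ht => ⟨?_, mem_univ _⟩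
          rw [mem_Ici, hγ1]
          have h3 := mul_nonneg (sub_nonneg.2 ht.2) hs
          have h4 := mul_nonneg ht.1 hr
          linarith
        · intro t ht
          rw [interior_Icc] at ht
          have h3 := ((hat _ (hpos t ht) (γ t).2).differentiableAt (by simp)).hasFDerivAt
          exact (h3.comp_hasDerivAt t (hγd t)).hasDerivWithinAt
        · intro t ht
          rw [interior_Icc] at ht
          obtain ⟨η, h3, -⟩ := hker _ (hpos t ht) (γ t).2
          exact (hasDerivAt_fderiv_comp h3 (hγd t) _).hasDerivWithinAt
        · intro t ht
          rw [interior_Icc] at ht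
          exact hnn _ (hpos t ht) (γ t).2 _
      have h5 := hconv.2 (left_mem_Icc.2 zero_le_one) (right_mem_Icc.2 zero_le_one) ha hb hab
      have h6 : γ (a • 0 + b • 1) = a • (s, x) + b • (r, z) := by
        obtain rfl : a = 1 - b := by linarith
        simp only [hγ, smul_eq_mul, mul_zero, mul_one, zero_add]
        module
      have h7 : γ 0 = (s, x) := by simp [hγ]
      have h8 : γ 1 = (r, z) := by simp [hγ]
      simp only at h5
      rwa [h6, h7, h8] at h5
  · have h := hasDerivWithinAt_time hΨ self_mem_Ici x
    rwa [← h.derivWithin (uniqueDiffOn_Ici 0 0 self_mem_Ici)] at h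
  · exact strictConvexOn_of_add_fderiv_lt fun x z => (hK s hs).add_fderiv_lt
  · rw [iUnion_subdiff_eq_range ((hK s hs).contDiff.differentiable (by simp)) (hK s hs).add_fderiv_le,
      (hK s hs).closure_range_gradient]
  · have hnull : volume ((fun q => gradientCLM n (fderiv ℝ Ψ q)) '' (Ioi 0 ×ˢ univ)) = 0 := by
      apply volume_image_eq_zero_of_singular
        (f' := fun q => (gradientCLM n).comp (fderiv ℝ (fderiv ℝ Ψ) q))
      · rintro ⟨s, x⟩ ⟨hs, -⟩
        obtain ⟨η, h1, -⟩ := hker s hs x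
        exact ((gradientCLM n).hasFDerivAt.comp (s, x) h1.hasFDerivAt).hasFDerivWithinAt
      · rintro ⟨s, x⟩ ⟨hs, -⟩
        obtain ⟨η, -, h1, -⟩ := hker s hs x
        exact ⟨(1, -η), by simp, by rw [ContinuousLinearMap.comp_apply, h1, map_zero]⟩
    refine measure_mono_null ?_ hnull
    intro q hq
    simp only [mem_iUnion] at hq
    obtain ⟨s, hs, x, hq⟩ := hq
    have hs' : 0 < s := by rwa [interior_Ici] at hs
    obtain ⟨h1, h2⟩ := subdiffOn_eq_of_hasFDerivAt hs
      ((hat s hs' x).differentiableAt (by simp)).hasFDerivAt hq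
    exact ⟨(s, x), ⟨hs', mem_univ _⟩, gradientCLM_eq h1 h2⟩

end Ray

/-- The initial data of a smooth geodesic ray, and the solution of the Cauchy problem it defines. -/
theorem IsSmoothToricGeodesicRay.isAdmissibleSolution {n : ℕ} {P : DelzantPolytope n}
    {ψω : RSpace n → ℝ} {φ : ℝ≥0 → RSpace n → ℝ} (hφ : IsSmoothToricGeodesicRay P ψω φ) :
    ∃ ψ₀ ψ₁ : RSpace n → ℝ, IsToricCauchyData P ψ₀ ψ₁ ∧
      IsAdmissibleSolution P.carrier (Ici 0) ψ₀ ψ₁ (rayFun fun s x => ψω x + φ s x) := by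
  obtain ⟨hmet, -, hgeo⟩ := hφ
  set Ψ : ℝ × RSpace n → ℝ := rayFun fun s x => ψω x + φ s x with hΨdef
  have hK : ∀ s ∈ Ici (0 : ℝ), IsToricKahlerPotential P fun x => Ψ (s, x) := fun s _ =>
    (hmet s.toNNReal).2
  -- One chart suffices: it contains the open orbit, into which the real logarithmic section embeds
  -- `ℝⁿ`.
  have hΨ : ContDiffOn ℝ ∞ Ψ (Ici 0 ×ˢ univ) := by
    obtain ⟨p, hp⟩ := P.vertices_nonempty
    obtain ⟨G, hG, hloc, -⟩ := hgeo p hp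
    obtain ⟨A, hA⟩ := exists_chartFrame P hp
    have h1 : ContDiffOn ℝ ∞ (fun q : ℝ × RSpace n => G (q.1, expPt (logSection A q.2)) +
        innerSL ℝ (intVec p) q.2) (Ici 0 ×ˢ univ) := by
      refine ContDiffOn.add (hG.comp (contDiff_fst.prodMk
        (contDiff_expPt.comp ((logSection A).contDiff.comp contDiff_snd))).contDiffOn
        fun q hq => ⟨hq.1, mem_univ _⟩) ?_
      exact ((innerSL ℝ (intVec p)).contDiff.comp contDiff_snd).contDiffOn
    refine h1.congr ?_
    rintro ⟨s, x⟩ ⟨hs, -⟩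
    have h2 := (isLocalPotential_iff hA).1 (hloc s hs) (logSection A x)
    rw [logPt_logSection] at h2
    simp only [innerSL_apply_apply] at h2 ⊢
    rw [h2, hΨdef]
    simp only [rayFun]
    ring
  have hU : UniqueDiffOn ℝ (Ici (0 : ℝ)) := uniqueDiffOn_Ici 0
  have hsol := isAdmissibleSolution_of_geodesic hΨ hK fun s hs x => by
    obtain ⟨p, hp⟩ := P.vertices_nonempty
    obtain ⟨G, hG, hloc, heq⟩ := hgeo p hp
    obtain ⟨A, hA⟩ := exists_chartFrame P hp
    exact exists_geodesic_velocity hA hU hG hloc heq hs.le x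
  have hdot : IsSmoothToricFunction P fun x => derivWithin (fun r => Ψ (r, x)) (Ici 0) 0 := by
    intro p hp
    obtain ⟨G, hG, hloc, -⟩ := hgeo p hp
    refine ⟨fun w => derivWithin (fun r => G (r, w)) (Ici 0) 0,
      contDiff_derivWithin_slice hG hU self_mem_Ici, fun w x hwx => ?_⟩
    simp only
    rw [derivWithin_congr (f := fun r => Ψ (r, x) - inner ℝ (intVec p) x)
      (fun t ht => hloc t ht w x hwx) (hloc 0 self_mem_Ici w x hwx), derivWithin_sub_const]
  have h0 := hK 0 self_mem_Ici
  exact ⟨_, _, ⟨⟨h0.contDiff, h0.hessian_pos, h0.closure_range_gradient, hdot.contDiff,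
    hdot.bounded⟩, h0, hdot⟩, hsol⟩

/-! ### Assembly of the theorem -/

theorem corollary1p9 {n : ℕ} (P : DelzantPolytope n) :
    -- (i) the smooth lifespan, on the open orbit and on the toric manifold
    (∀ ψ₀ ψ₁ : RSpace n → ℝ, IsCauchyData P.carrier ψ₀ ψ₁ →
      smoothLifespan P.carrier ψ₀ ψ₁ = convexLifespan P.carrier ψ₀ ψ₁) ∧
    (∀ ψ₀ ψ₁ : RSpace n → ℝ, IsToricCauchyData P ψ₀ ψ₁ →
      toricSmoothLifespan P ψ₀ ψ₁ = convexLifespan P.carrier ψ₀ ψ₁) ∧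
    -- (ii) smooth toric geodesic rays and admissible solutions with concave data
    (∀ ψω : RSpace n → ℝ, IsToricKahlerPotential P ψω →
      BijOn (fun (φ : ℝ≥0 → RSpace n → ℝ) (s : ℝ≥0) (x : RSpace n) => ψω x + φ s x)
        {φ | IsSmoothToricGeodesicRay P ψω φ}
        {ψ | ∃ ψ₀ ψ₁ : RSpace n → ℝ, IsToricCauchyData P ψ₀ ψ₁ ∧
          ConcaveOn ℝ (interior P.carrier) (momentVelocity ψ₀ ψ₁) ∧
          IsAdmissibleSolution P.carrier (Ici 0) ψ₀ ψ₁ (rayFun ψ)}) ∧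
    (∀ ψ₀ ψ₁ : RSpace n → ℝ, IsToricCauchyData P ψ₀ ψ₁ →
      ConcaveOn ℝ (interior P.carrier) (momentVelocity ψ₀ ψ₁) →
      ∃! ψ : ℝ≥0 → RSpace n → ℝ, IsAdmissibleSolution P.carrier (Ici 0) ψ₀ ψ₁ (rayFun ψ)) := by

  refine ⟨fun ψ₀ ψ₁ hd => smoothLifespan_eq hd (isCompact_carrier P).isBounded,
    fun ψ₀ ψ₁ hd => toricSmoothLifespan_eq hd, fun ψω hω => ⟨?_, ?_, ?_⟩,
    fun ψ₀ ψ₁ hd hg => hd.existsUnique_of_concaveOn (isCompact_carrier P).isBounded hg⟩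
  · intro φ hφ
    obtain ⟨ψ₀, ψ₁, hd, hsol⟩ := IsSmoothToricGeodesicRay.isAdmissibleSolution hφ
    exact ⟨ψ₀, ψ₁, hd, hsol.concaveOn_momentVelocity hd.toIsCauchyData, hsol⟩
  · intro φ _ φ' _ h
    funext s x
    exact add_left_cancel (congrFun (congrFun h s) x)
  -- No smoothness on `M` is assumed of `ψ`; uniqueness identifies it with the envelope, which is
  -- known to give a smooth geodesic ray.
  · rintro ψ ⟨ψ₀, ψ₁, hd, hg, hψ⟩
    refine ⟨fun s x => ψ s x - ψω x, hd.isSmoothToricGeodesicRay hg hω fun s x => ?_, ?_⟩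
    · rw [add_sub_cancel, ← rayFun_coe ψ]
      exact hψ.eq_of_Ici (hd.isAdmissibleSolution_of_concaveOn (isCompact_carrier P).isBounded hg)
        hd.toIsCauchyData s.2 x
    · funext s x
      exact add_sub_cancel _ _

end
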